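/- A twofold triple system of order $v$, or TTS($v$), is a pair $(V,\mathcal{B})$ where $V$ is a set of $v$ points and $\mathcal{B}$ is a set of $3$-element subsets of $V$ (blocks) such that every $2$-element subset of $V$ is contained in exactly two blocks. Its $2$-block intersection graph ($2$-BIG) has the blocks as vertices, two blocks being adjacent when they have exactly two points in common. A positive integer $v$ is admissible if $v\equiv 1$ or $3\pmod 6$. Theorem. Let $u>13$ and let $(U,\mathcal{T})$ be a TTS($u$) whose $2$-BIG is bipartite and connected. Then for every admissible $v>2u$ there exists a TTS($v$), $(V,\mathcal{T}')$, with $U\subset V$ and $\mathcal{T}\subset\mathcal{T}'$, whose $2$-BIG is bipartite and has exactly two connected components. Furthermore, $(V,\mathcal{T}')$ can be chosen so that there are three distinct points $a,b,c\in V\setminus U$ such that each block of $\mathcal{T}'$ that is disjoint from $U$ contains at most one of $a$, $b$ and $c$ (equivalently, every block of $\mathcal{T}'$ containing two of $a,b,c$ has its third point in $U$). -/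

import Mathlib

/-- `(V, B)` is a `(v, k, l)`-BIBD: `V` is a set of `v` points, `B` is a set of `k`-element subsets
of `V` (the blocks), and every 2-element subset of `V` is contained in exactly `l` blocks. -/
structure IsBIBD {α : Type*} [DecidableEq α] (V : Finset α) (B : Finset (Finset α))
    (v k l : ℕ) : Prop where
  card_points : V.card = v
  subset_points : ∀ b ∈ B, b ⊆ V
  card_block : ∀ b ∈ B, b.card = k
  card_pair : ∀ p : Finset α, p ⊆ V → p.card = 2 → (B.filter (fun b => p ⊆ b)).card = l

/-- A twofold triple system of order `v`, TTS(`v`): a `(v, 3, 2)`-BIBD. -/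
def IsTTS {α : Type*} [DecidableEq α] (V : Finset α) (B : Finset (Finset α)) (v : ℕ) : Prop :=
  IsBIBD V B v 3 2

/-- The `i`-block intersection graph of a set of blocks `B`: its vertices are the blocks, and two
(different) blocks are adjacent when they have exactly `i` points in common. -/
def blockIntersectionGraph {α : Type*} [DecidableEq α] (i : ℕ) (B : Finset (Finset α)) :
    SimpleGraph {b : Finset α // b ∈ B} where
  Adj b c := b ≠ c ∧ (b.1 ∩ c.1).card = i
  symm := ⟨fun b c h => ⟨h.1.symm, by rw [Finset.inter_comm]; exact h.2⟩⟩
  loopless := ⟨fun _ h => h.1 rfl⟩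

/-- A positive integer `v` is admissible if it is congruent to 1 or 3 modulo 6. -/
def Admissible (v : ℕ) : Prop := v % 6 = 1 ∨ v % 6 = 3

/-! ### Two systems of matchings and triples as the two colour classes of the new blocks. -/

open Finset

/-! The two blocks through a pair of points are adjacent in the 2-BIG, so a 2-colouring splits the
blocks into two Steiner triple systems. In particular `u` is admissible
(`admissible_of_isBipartite`), and `v - u = 2 * m` is even. The new points are `ZMod (2 * m)`. It
suffices to decompose the complete graph on them twice, each time into `u` perfect matchings
labelled by the points of `U` and some pure triples. An edge `x y` of the matching labelled `j`
becomes the block `{j, x, y}`. If the two decompositions give no common block, they are the colour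
classes of the new blocks. A new block has at most one point in `U`, so `T` stays a component, and
only the connectedness of the new blocks remains (`exists_tts_of_systems`). A pair of new points
lies in one block of each class and these are adjacent, so components can be followed on pairs: the
pairs of a triple belong together, and so do the two edges at `x` which carry the same label in the
two decompositions.

Write `2 * m = u + 6 * k + 2 * r + 1` with `r ≤ 2`; each point then needs `6 * k + 2 * r` neighbours
in pure triples. A linked gadget supplies `6 * k` of them and a split gadget `2 * r`; all other
pairs go to matchings used by both decompositions. These common matchings form a chain. In the
second decomposition the labels are shifted by one along the chain, and the distinguished matchings
of the gadgets close it to a cycle, so being in one component propagates from matching to matching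
and into both gadgets (`exists_tts_of_gadgets`). The start is a label whose two matchings together
form a connected graph.

An odd difference `g` gives a perfect matching `half g` between even and odd elements. An even
difference may give odd cycles; joined with an odd difference it gives prisms, which are
3-edge-colourable. Hence leftover pairs can be matched once the leftover even differences are
assigned distinct leftover odd ones (`exists_matchings`).

The linked gadget develops `k` base triples cyclically in two ways, with the same short differences
`d` but with long differences arranged as a Langford-type sequence and as its reversal. Comparing
the two arrangements rotates the long differences, and two rotations move by one step, which links
everything (`iff_of_rotation`). Each arrangement misses one even difference of the common set, which
a prism absorbs (`hasLinkedGadget_of_families`). The split gadget comes from a finite table modulo 6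
or 3; it is nontrivial only for `r ≠ 0`, when 3 divides `m`. The points `a, b, c` are chosen so that
their pairs avoid the pure triples, and `13 < u` leaves room for the differences needed in the nine
cases of `hasScheme`. -/

/-- `f` is a family of edge-disjoint perfect matchings (given as involutions) on `Z`, and `L` is a
set of triples on `Z`, such that every pair lies in at most one matching or triple. -/
structure IsSystem {J Z : Type} (f : J → Z → Z) (L : Z → Z → Z → Prop) : Prop where
  invol : ∀ j x, f j (f j x) = x
  ne : ∀ j x, f j x ≠ x
  inj : ∀ i j x, f i x = f j x → i = j
  swap : ∀ x y z, L x y z → L y x z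
  rot : ∀ x y z, L x y z → L x z y
  irrefl : ∀ x y z, L x y z → x ≠ y
  uniq : ∀ x y z z', L x y z → L x y z' → z = z'
  disj : ∀ j x y z, L x y z → f j x ≠ y

/-- The pair `x, y` lies in a matching or in a triple. -/
def Covers {J Z : Type} (f : J → Z → Z) (L : Z → Z → Z → Prop) (x y : Z) : Prop :=
  (∃ j, f j x = y) ∨ ∃ z, L x y z

/-- A set of pairs is closed if it is a union of connected components: pairs in a common triple, and
intersecting pairs from the matchings with the same label, are in the same component. -/
structure Closed {J Z : Type} (f₀ : J → Z → Z) (L₀ : Z → Z → Z → Prop) (f₁ : J → Z → Z)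
    (L₁ : Z → Z → Z → Prop) (P : Z → Z → Prop) : Prop where
  symm : ∀ x y, P x y → P y x
  pure₀ : ∀ x y z, L₀ x y z → P x y → P x z
  pure₁ : ∀ x y z, L₁ x y z → P x y → P x z
  pos : ∀ j x, P x (f₀ j x) ↔ P x (f₁ j x)

/-- All pairs are in one component. -/
def Linked {J Z : Type} (f₀ : J → Z → Z) (L₀ : Z → Z → Z → Prop) (f₁ : J → Z → Z)
    (L₁ : Z → Z → Z → Prop) : Prop :=
  ∃ x₀ y₀ : Z, x₀ ≠ y₀ ∧ ∀ P, Closed f₀ L₀ f₁ L₁ P → P x₀ y₀ → ∀ x y, x ≠ y → P x y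

/-- The partial triple system on labels and points defined by matchings and triples. -/
def Tern {J Z : Type} (f : J → Z → Z) (L : Z → Z → Z → Prop) :
    J ⊕ Z → J ⊕ Z → J ⊕ Z → Prop
  | .inl j, .inr x, .inr y => f j x = y
  | .inr x, .inl j, .inr y => f j x = y
  | .inr x, .inr y, .inl j => f j x = y
  | .inr x, .inr y, .inr z => L x y z
  | _, _, _ => False

structure IsTern {Q : Type} (R : Q → Q → Q → Prop) : Prop where
  swap : ∀ x y z, R x y z → R y x z
  rot : ∀ x y z, R x y z → R x z y
  irrefl : ∀ x y z, R x y z → x ≠ y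
  uniq : ∀ x y z z', R x y z → R x y z' → z = z'

theorem IsSystem.isTern {J Z : Type} {f : J → Z → Z} {L : Z → Z → Z → Prop} (h : IsSystem f L) :
    IsTern (Tern f L) where
  swap := by
    rintro (i | x) (j | y) (k | z) H <;> simp only [Tern] at H ⊢
    · exact H
    · exact H
    · rw [← H, h.invol]
    · exact h.swap _ _ _ H
  rot := by
    rintro (i | x) (j | y) (k | z) H <;> simp only [Tern] at H ⊢
    · rw [← H, h.invol]
    · exact H
    · exact H
    · exact h.rot _ _ _ H
  irrefl := by
    rintro (i | x) (j | y) (k | z) H <;> simp only [Tern] at H ⊢ <;> simp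
    · rintro rfl; exact h.ne _ _ H
    · exact h.irrefl _ _ _ H
  uniq := by
    rintro (i | x) (j | y) (k | z) (k' | z') H H' <;> simp only [Tern] at H H' ⊢
    · rw [← H, ← H']
    · rw [← H, ← H']
    · rw [h.inj _ _ _ (H.trans H'.symm)]
    · exact absurd H (h.disj _ _ _ _ H')
    · exact absurd H' (h.disj _ _ _ _ H)
    · rw [h.uniq _ _ _ _ H H']

section Blocks
variable {α : Type*} [DecidableEq α] {Q : Type} [Fintype Q]

open Classical in
/-- The blocks of a symmetric ternary relation. -/
noncomputable def ternBlocks (ε : Q ↪ α) (R : Q → Q → Q → Prop) : Finset (Finset α) :=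
  (univ.filter fun t : Q × Q × Q => R t.1 t.2.1 t.2.2).image fun t => {ε t.1, ε t.2.1, ε t.2.2}

theorem mem_ternBlocks {ε : Q ↪ α} {R : Q → Q → Q → Prop} {b : Finset α} :
    b ∈ ternBlocks ε R ↔ ∃ p q s, R p q s ∧ b = {ε p, ε q, ε s} := by
  simp only [ternBlocks, mem_image, mem_filter, mem_univ, true_and, Prod.exists]
  exact ⟨fun ⟨p, q, s, h, e⟩ => ⟨p, q, s, h, e.symm⟩, fun ⟨p, q, s, h, e⟩ => ⟨p, q, s, h, e.symm⟩⟩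

theorem ternBlocks_through {ε : Q ↪ α} {R : Q → Q → Q → Prop} (hR : IsTern R) {b : Finset α}
    (hb : b ∈ ternBlocks ε R) {p q : Q} (hp : ε p ∈ b) (hq : ε q ∈ b) (hpq : p ≠ q) :
    ∃ s, R p q s ∧ b = {ε p, ε q, ε s} := by
  obtain ⟨x, y, z, h, rfl⟩ := mem_ternBlocks.1 hb
  simp only [mem_insert, mem_singleton, EmbeddingLike.apply_eq_iff_eq] at hp hq
  have h1 := hR.swap _ _ _ h
  have h2 := hR.rot _ _ _ h
  have h3 := hR.rot _ _ _ h1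
  have h4 := hR.swap _ _ _ h2
  have h5 := hR.swap _ _ _ h3
  rcases hp with rfl | rfl | rfl <;> rcases hq with rfl | rfl | rfl
  · exact absurd rfl hpq
  · exact ⟨_, h, rfl⟩
  · exact ⟨_, h2, by ext a; simp; tauto⟩
  · exact ⟨_, h1, by ext a; simp; tauto⟩
  · exact absurd rfl hpq
  · exact ⟨_, h3, by ext a; simp; tauto⟩
  · exact ⟨_, h4, by ext a; simp; tauto⟩
  · exact ⟨_, h5, by ext a; simp; tauto⟩
  · exact absurd rfl hpq

theorem ternBlocks_unique {ε : Q ↪ α} {R : Q → Q → Q → Prop} (hR : IsTern R) {b b' : Finset α}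
    (hb : b ∈ ternBlocks ε R) (hb' : b' ∈ ternBlocks ε R) {p q : Q} (hp : ε p ∈ b) (hq : ε q ∈ b)
    (hp' : ε p ∈ b') (hq' : ε q ∈ b') (hpq : p ≠ q) : b = b' := by
  obtain ⟨s, h, rfl⟩ := ternBlocks_through hR hb hp hq hpq
  obtain ⟨s', h', rfl⟩ := ternBlocks_through hR hb' hp' hq' hpq
  rw [hR.uniq _ _ _ _ h h']

theorem card_of_mem_ternBlocks {ε : Q ↪ α} {R : Q → Q → Q → Prop} (hR : IsTern R) {b : Finset α}
    (hb : b ∈ ternBlocks ε R) : b.card = 3 := by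
  obtain ⟨x, y, z, h, rfl⟩ := mem_ternBlocks.1 hb
  have h2 := hR.rot _ _ _ h
  have h4 := hR.rot _ _ _ (hR.swap _ _ _ h)
  refine card_eq_three.2 ⟨_, _, _, ?_, ?_, ?_, rfl⟩ <;> rw [Ne, EmbeddingLike.apply_eq_iff_eq]
  · exact hR.irrefl _ _ _ h
  · exact hR.irrefl _ _ _ h2
  · exact hR.irrefl _ _ _ h4

end Blocks

/-- The pair `p, q` is not a pair of labels. -/
def Mixed {J Z : Type} (p q : J ⊕ Z) : Prop := p.isRight ∨ q.isRight

theorem Tern.mixed {J Z : Type} {f : J → Z → Z} {L : Z → Z → Z → Prop} :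
    ∀ {p q s : J ⊕ Z}, Tern f L p q s → Mixed p q := by
  rintro (i | x) (j | y) (k | z) H <;> simp_all [Tern, Mixed]

theorem exists_tern {J Z : Type} {f : J → Z → Z} {L : Z → Z → Z → Prop}
    (hc : ∀ x y, x ≠ y → Covers f L x y) :
    ∀ {p q : J ⊕ Z}, Mixed p q → p ≠ q → ∃ s, Tern f L p q s := by
  rintro (i | x) (j | y) h hne
  · simp [Mixed] at h
  · exact ⟨.inr (f i y), rfl⟩
  · exact ⟨.inr (f j x), rfl⟩
  · rcases hc x y (fun h => hne (by rw [h])) with ⟨j, h⟩ | ⟨z, h⟩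
    · exact ⟨.inl j, h⟩
    · exact ⟨.inr z, h⟩

theorem inter_card_eq_two {α : Type*} [DecidableEq α] {b c : Finset α} (hb : b.card = 3)
    (hc : c.card = 3) (hne : b ≠ c) {x y : α} (hxy : x ≠ y) (hx : x ∈ b) (hy : y ∈ b) (hx' : x ∈ c)
    (hy' : y ∈ c) : (b ∩ c).card = 2 := by
  have h1 : 2 ≤ (b ∩ c).card := by
    rw [← card_pair hxy]
    apply card_le_card
    intro a ha
    simp only [mem_insert, mem_singleton] at ha
    rcases ha with rfl | rfl <;> simp [*]
  have h2 : (b ∩ c).card < 3 := by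
    by_contra h
    have e1 : b ∩ c = b := eq_of_subset_of_card_le inter_subset_left (by omega)
    have e2 : b ∩ c = c := eq_of_subset_of_card_le inter_subset_right (by omega)
    exact hne (e1.symm.trans e2)
  omega

theorem exists_embedding_extending {α : Type*} [DecidableEq α] [Infinite α] {J Z : Type}
    [Fintype J] [Fintype Z] (U : Finset α) (hJ : Fintype.card J = U.card) :
    ∃ ε : J ⊕ Z ↪ α, (∀ a, a ∈ U ↔ ∃ j, ε (.inl j) = a) ∧ ∀ x, ε (.inr x) ∉ U := by
  have e : J ≃ U := Fintype.equivOfCardEq (by rw [hJ, Fintype.card_coe])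
  have : Infinite ((U : Set α)ᶜ : Set α) := U.finite_toSet.infinite_compl.to_subtype
  let g : Z ↪ ((U : Set α)ᶜ : Set α) :=
    (Fintype.equivFin Z).toEmbedding.trans (Fin.valEmbedding.trans (Infinite.natEmbedding _))
  refine ⟨⟨Sum.elim (fun j => (e j : α)) (fun x => (g x : α)), ?_⟩, ?_, ?_⟩
  · rintro (i | x) (j | y) h <;> simp only [Sum.elim_inl, Sum.elim_inr] at h
    · rw [e.injective (Subtype.ext h)]
    · exact absurd (e i).2 (by rw [h]; exact (g y).2)
    · exact absurd (e j).2 (by rw [← h]; exact (g x).2)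
    · rw [g.injective (Subtype.ext h)]
  · intro a
    refine ⟨fun ha => ⟨e.symm ⟨a, ha⟩, congrArg Subtype.val (e.apply_symm_apply ⟨a, ha⟩)⟩, ?_⟩
    rintro ⟨j, rfl⟩
    exact (e j).2
  · intro x
    exact (g x).2

theorem Tern.exists_points {J Z : Type} {f : J → Z → Z} {L : Z → Z → Z → Prop}
    (h : IsSystem f L) {p q s : J ⊕ Z} (H : Tern f L p q s) :
    ∃ x y : Z, x ≠ y ∧ (p = .inr x ∨ q = .inr x ∨ s = .inr x) ∧
      (p = .inr y ∨ q = .inr y ∨ s = .inr y) := by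
  rcases p with (i | x) <;> rcases q with (j | y) <;> rcases s with (k | z) <;>
    simp only [Tern] at H
  · exact ⟨y, z, by rintro rfl; exact h.ne _ _ H, by simp, by simp⟩
  · exact ⟨x, z, by rintro rfl; exact h.ne _ _ H, by simp, by simp⟩
  · exact ⟨x, y, by rintro rfl; exact h.ne _ _ H, by simp, by simp⟩
  · exact ⟨x, y, h.irrefl _ _ _ H, by simp, by simp⟩

/-- The old blocks form one component and the new blocks another. `Linked` is tested on the set of
pairs all of whose blocks are reachable from a fixed new block. -/
theorem exists_tts_of_systems {α : Type*} [DecidableEq α] [Infinite α] {J Z : Type} [Fintype J]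
    [Fintype Z] {u : ℕ} {U : Finset α} {T : Finset (Finset α)} (hT : IsTTS U T u)
    (hbip : (blockIntersectionGraph 2 T).IsBipartite)
    (hconn : (blockIntersectionGraph 2 T).Connected) (hJ : Fintype.card J = u)
    {f₀ f₁ : J → Z → Z} {L₀ L₁ : Z → Z → Z → Prop} (h₀ : IsSystem f₀ L₀) (h₁ : IsSystem f₁ L₁)
    (hc₀ : ∀ x y, x ≠ y → Covers f₀ L₀ x y) (hc₁ : ∀ x y, x ≠ y → Covers f₁ L₁ x y)
    (hf : ∀ j x, f₀ j x ≠ f₁ j x) (hL : ∀ x y z, L₀ x y z → ¬ L₁ x y z)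
    (hlink : Linked f₀ L₀ f₁ L₁)
    (habc : ∃ a b c : Z, a ≠ b ∧ a ≠ c ∧ b ≠ c ∧ ∀ z, ¬ L₀ a b z ∧ ¬ L₀ a c z ∧ ¬ L₀ b c z ∧
      ¬ L₁ a b z ∧ ¬ L₁ a c z ∧ ¬ L₁ b c z) :
    ∃ (V : Finset α) (T' : Finset (Finset α)),
      IsTTS V T' (u + Fintype.card Z) ∧ U ⊂ V ∧ T ⊂ T' ∧
      (blockIntersectionGraph 2 T').IsBipartite ∧
      Nat.card (blockIntersectionGraph 2 T').ConnectedComponent = 2 ∧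
      ∃ a ∈ V \ U, ∃ b ∈ V \ U, ∃ c ∈ V \ U, a ≠ b ∧ a ≠ c ∧ b ≠ c ∧
        ∀ B ∈ T', Disjoint B U → (B ∩ {a, b, c}).card ≤ 1 := by
  obtain ⟨ε, hεU, hεZ⟩ := exists_embedding_extending (J := J) (Z := Z) U
    (hJ.trans hT.card_points.symm)
  have hεJ : ∀ j, ε (.inl j) ∈ U := fun j => (hεU _).2 ⟨j, rfl⟩
  have t₀ := h₀.isTern
  have t₁ := h₁.isTern
  set N₀ := ternBlocks ε (Tern f₀ L₀) with hN₀
  set N₁ := ternBlocks ε (Tern f₁ L₁) with hN₁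
  set T' := T ∪ (N₀ ∪ N₁) with hT'
  set V : Finset α := univ.map ε with hV
  have hmemV : ∀ p, ε p ∈ V := fun p => by simp [hV]
  have hUV : U ⊆ V := fun a ha => by
    obtain ⟨j, rfl⟩ := (hεU a).1 ha
    exact hmemV _
  have hpts₀ : ∀ b ∈ N₀, ∃ x y : Z, x ≠ y ∧ ε (.inr x) ∈ b ∧ ε (.inr y) ∈ b := by
    intro b hb
    obtain ⟨p, q, s, H, rfl⟩ := mem_ternBlocks.1 hb
    obtain ⟨x, y, hxy, hx, hy⟩ := H.exists_points h₀
    refine ⟨x, y, hxy, ?_, ?_⟩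
    · rcases hx with rfl | rfl | rfl <;> simp
    · rcases hy with rfl | rfl | rfl <;> simp
  have hpts₁ : ∀ b ∈ N₁, ∃ x y : Z, x ≠ y ∧ ε (.inr x) ∈ b ∧ ε (.inr y) ∈ b := by
    intro b hb
    obtain ⟨p, q, s, H, rfl⟩ := mem_ternBlocks.1 hb
    obtain ⟨x, y, hxy, hx, hy⟩ := H.exists_points h₁
    refine ⟨x, y, hxy, ?_, ?_⟩
    · rcases hx with rfl | rfl | rfl <;> simp
    · rcases hy with rfl | rfl | rfl <;> simp
  have hpts : ∀ b ∈ N₀ ∪ N₁, ∃ x y : Z, x ≠ y ∧ ε (.inr x) ∈ b ∧ ε (.inr y) ∈ b := by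
    intro b hb
    rcases mem_union.1 hb with h | h
    exacts [hpts₀ b h, hpts₁ b h]
  have hTN : ∀ b ∈ T, b ∉ N₀ ∪ N₁ := by
    intro b hb hb'
    obtain ⟨x, _, _, hx, _⟩ := hpts b hb'
    exact hεZ x (hT.subset_points b hb hx)
  have hcard₀ : ∀ b ∈ N₀, b.card = 3 := fun b hb => card_of_mem_ternBlocks t₀ hb
  have hcard₁ : ∀ b ∈ N₁, b.card = 3 := fun b hb => card_of_mem_ternBlocks t₁ hb
  have hcard : ∀ b ∈ T', b.card = 3 := by
    intro b hb
    simp only [hT', mem_union] at hb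
    rcases hb with h | h | h
    exacts [hT.card_block b h, hcard₀ b h, hcard₁ b h]
  have hsubV : ∀ b ∈ T', b ⊆ V := by
    intro b hb
    simp only [hT', mem_union] at hb
    rcases hb with h | h | h
    · exact (hT.subset_points b h).trans hUV
    all_goals
      obtain ⟨p, q, s, -, rfl⟩ := mem_ternBlocks.1 h
      intro a ha
      simp only [mem_insert, mem_singleton] at ha
      rcases ha with rfl | rfl | rfl <;> exact hmemV _
  have hN01 : ∀ b ∈ N₀, b ∉ N₁ := by
    intro b hb hb'
    obtain ⟨x, y, hxy, hx, hy⟩ := hpts₀ b hb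
    have hne : (Sum.inr x : J ⊕ Z) ≠ .inr y := by simpa using hxy
    obtain ⟨s, hs, e⟩ := ternBlocks_through t₀ hb hx hy hne
    obtain ⟨s', hs', e'⟩ := ternBlocks_through t₁ hb' hx hy hne
    have hss : s = s' := by
      have h1 : ε s ∈ b := by rw [e]; simp
      rw [e'] at h1
      simp only [mem_insert, mem_singleton, EmbeddingLike.apply_eq_iff_eq] at h1
      rcases h1 with h | h | h
      · exact absurd h.symm (t₀.irrefl _ _ _ (t₀.rot _ _ _ hs))
      · exact absurd h.symm (t₀.irrefl _ _ _ (t₀.rot _ _ _ (t₀.swap _ _ _ hs)))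
      · exact h
    subst hss
    rcases s with j | z
    · exact hf j x (Eq.trans hs (Eq.symm hs'))
    · exact hL _ _ _ hs hs'
  have hmixed : ∀ b ∈ N₀ ∪ N₁, ∀ i j : J, i ≠ j → ε (.inl i) ∈ b → ε (.inl j) ∉ b := by
    intro b hb i j hij hi hj
    have hne : (Sum.inl i : J ⊕ Z) ≠ .inl j := by simpa using hij
    rcases mem_union.1 hb with h | h
    · obtain ⟨s, hs, -⟩ := ternBlocks_through t₀ h hi hj hne
      simpa [Mixed] using hs.mixed
    · obtain ⟨s, hs, -⟩ := ternBlocks_through t₁ h hi hj hne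
      simpa [Mixed] using hs.mixed
  have hcount : ∀ (f : J → Z → Z) (L : Z → Z → Z → Prop), IsSystem f L →
      (∀ x y, x ≠ y → Covers f L x y) → ∀ p q : J ⊕ Z, p ≠ q → Mixed p q →
      ((ternBlocks ε (Tern f L)).filter fun b => {ε p, ε q} ⊆ b).card = 1 := by
    intro f L h hc p q hpq hm
    obtain ⟨s, hs⟩ := exists_tern hc hm hpq
    rw [card_eq_one]
    refine ⟨{ε p, ε q, ε s}, ?_⟩
    ext b
    simp only [mem_filter, mem_singleton, insert_subset_iff, singleton_subset_iff]
    constructor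
    · rintro ⟨hb, hp, hq⟩
      exact ternBlocks_unique h.isTern hb (mem_ternBlocks.2 ⟨p, q, s, hs, rfl⟩) hp hq (by simp)
        (by simp) hpq
    · rintro rfl
      exact ⟨mem_ternBlocks.2 ⟨p, q, s, hs, rfl⟩, by simp, by simp⟩
  obtain ⟨x₀, y₀, hxy₀, hlink⟩ := hlink
  have htts : IsTTS V T' (u + Fintype.card Z) := by
    refine ⟨?_, hsubV, hcard, ?_⟩
    · simp [hV, hJ]
    · intro P hPV hP
      obtain ⟨a, b, hab, rfl⟩ := card_eq_two.1 hP
      obtain ⟨p, rfl⟩ : ∃ p, ε p = a := by simpa [hV] using hPV (mem_insert_self a _)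
      obtain ⟨q, rfl⟩ : ∃ q, ε q = b := by
        simpa [hV] using hPV (mem_insert_of_mem (mem_singleton_self b))
      have hpq : p ≠ q := fun h => hab (by rw [h])
      by_cases hm : Mixed p q
      · have e0 : (T.filter fun b => {ε p, ε q} ⊆ b) = ∅ := by
          rw [filter_eq_empty_iff]
          intro b hb hs
          have hp := hT.subset_points b hb (hs (mem_insert_self _ _))
          have hq := hT.subset_points b hb (hs (mem_insert_of_mem (mem_singleton_self _)))
          rcases p with i | x <;> rcases q with j | y
          · simp [Mixed] at hm
          · exact hεZ _ hq
          · exact hεZ _ hp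
          · exact hεZ _ hp
        rw [hT', filter_union, e0, empty_union, filter_union, card_union_of_disjoint,
          hcount _ _ h₀ hc₀ p q hpq hm, hcount _ _ h₁ hc₁ p q hpq hm]
        rw [disjoint_left]
        intro b hb hb'
        exact hN01 b (mem_filter.1 hb).1 (mem_filter.1 hb').1
      · rcases p with i | x <;> rcases q with j | y
        · have e0 : ((N₀ ∪ N₁).filter fun b => {ε (.inl i), ε (.inl j)} ⊆ b) = ∅ := by
            rw [filter_eq_empty_iff]
            intro b hb hs
            exact hmixed b hb i j (by simpa using hpq) (hs (mem_insert_self _ _))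
              (hs (mem_insert_of_mem (mem_singleton_self _)))
          rw [hT', filter_union, e0, union_empty]
          refine hT.card_pair _ ?_ (card_pair hab)
          intro a ha
          simp only [mem_insert, mem_singleton] at ha
          rcases ha with rfl | rfl <;> exact hεJ _
        all_goals simp [Mixed] at hm
  have hres : ∀ b ∈ T', b ∉ T → b ∈ N₀ ∪ N₁ := fun b hb hb' =>
    (mem_union.1 hb).resolve_left hb'
  -- Two points shared with an old block lie in `U`, and a new block contains at most one point of
  -- `U`.
  have hTadj : ∀ b c : {b // b ∈ T'}, (blockIntersectionGraph 2 T').Adj b c → b.1 ∈ T →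
      c.1 ∈ T := by
    intro b c hbc hb
    by_contra hc
    have hc' : c.1 ∈ N₀ ∪ N₁ := hres _ c.2 hc
    obtain ⟨a, a', haa, hi⟩ := card_eq_two.1 hbc.2
    have ha : a ∈ b.1 ∩ c.1 := by rw [hi]; simp
    have ha' : a' ∈ b.1 ∩ c.1 := by rw [hi]; simp
    rw [mem_inter] at ha ha'
    obtain ⟨i, rfl⟩ := (hεU a).1 (hT.subset_points _ hb ha.1)
    obtain ⟨j, rfl⟩ := (hεU a').1 (hT.subset_points _ hb ha'.1)
    exact hmixed _ hc' i j (fun h => haa (by rw [h])) ha.2 ha'.2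
  have hreach : ∀ b c : {b // b ∈ T'}, ∀ a a' : α, a ≠ a' → a ∈ b.1 → a' ∈ b.1 → a ∈ c.1 →
      a' ∈ c.1 → (blockIntersectionGraph 2 T').Reachable b c := by
    intro b c a a' haa h1 h2 h3 h4
    by_cases hbc : b = c
    · rw [hbc]
    · refine SimpleGraph.Adj.reachable ⟨hbc, ?_⟩
      exact inter_card_eq_two (hcard _ b.2) (hcard _ c.2) (fun h => hbc (Subtype.ext h)) haa
        h1 h2 h3 h4
  have hNT' : ∀ b, b ∈ N₀ ∪ N₁ → b ∈ T' := fun b hb => mem_union_right _ hb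
  have hblk : ∀ x y : Z, x ≠ y → ∃ b ∈ N₀, ε (.inr x) ∈ b ∧ ε (.inr y) ∈ b := by
    intro x y hxy
    obtain ⟨s, hs⟩ := exists_tern hc₀ (p := .inr x) (q := .inr y) (by simp [Mixed])
      (by simpa using hxy)
    exact ⟨_, mem_ternBlocks.2 ⟨_, _, _, hs, rfl⟩, by simp, by simp⟩
  obtain ⟨b₀, hb₀, hb₀x, hb₀y⟩ := hblk x₀ y₀ hxy₀
  have hb₀' : b₀ ∈ T' := hNT' _ (mem_union_left _ hb₀)
  -- The second component of the predicate quantifies over all blocks through the pair; they share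
  -- two points, so reaching one of them is enough.
  have hP : Closed f₀ L₀ f₁ L₁ fun x y => x ≠ y ∧ ∀ b : {b // b ∈ T'}, ε (.inr x) ∈ b.1 →
      ε (.inr y) ∈ b.1 → (blockIntersectionGraph 2 T').Reachable ⟨b₀, hb₀'⟩ b := by
    have key : ∀ (p q s : J ⊕ Z), (Tern f₀ L₀ p q s ∨ Tern f₁ L₁ p q s) → p ≠ s → q ≠ s →
        (∀ b : {b // b ∈ T'}, ε p ∈ b.1 →
        ε q ∈ b.1 → (blockIntersectionGraph 2 T').Reachable ⟨b₀, hb₀'⟩ b) →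
        (∀ b : {b // b ∈ T'}, ε p ∈ b.1 →
        ε s ∈ b.1 → (blockIntersectionGraph 2 T').Reachable ⟨b₀, hb₀'⟩ b) := by
      intro p q s hR hps hqs h b hp hs
      have hmem : ({ε p, ε q, ε s} : Finset α) ∈ T' := by
        apply hNT'
        rcases hR with hR | hR
        · exact mem_union_left _ (mem_ternBlocks.2 ⟨_, _, _, hR, rfl⟩)
        · exact mem_union_right _ (mem_ternBlocks.2 ⟨_, _, _, hR, rfl⟩)
      refine (h ⟨_, hmem⟩ (by simp) (by simp)).trans
        (hreach _ _ (ε p) (ε s) (by simpa using hps) (by simp) (by simp) hp hs)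
    refine ⟨fun x y h => ⟨h.1.symm, fun b hx hy => h.2 b hy hx⟩, ?_, ?_, ?_⟩
    · intro x y z hz h
      have hxz := h₀.irrefl _ _ _ (h₀.rot _ _ _ hz)
      have hyz := h₀.irrefl _ _ _ (h₀.rot _ _ _ (h₀.swap _ _ _ hz))
      exact ⟨hxz, key (.inr x) (.inr y) (.inr z) (Or.inl hz) (by simpa using hxz)
        (by simpa using hyz) h.2⟩
    · intro x y z hz h
      have hxz := h₁.irrefl _ _ _ (h₁.rot _ _ _ hz)
      have hyz := h₁.irrefl _ _ _ (h₁.rot _ _ _ (h₁.swap _ _ _ hz))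
      exact ⟨hxz, key (.inr x) (.inr y) (.inr z) (Or.inr hz) (by simpa using hxz)
        (by simpa using hyz) h.2⟩
    · intro j x
      have k1 := key (.inr x) (.inr (f₀ j x)) (.inl j) (Or.inl rfl) (by simp) (by simp)
      have k2 := key (.inr x) (.inr (f₁ j x)) (.inl j) (Or.inr rfl) (by simp) (by simp)
      have k3 := key (.inr x) (.inl j) (.inr (f₀ j x)) (Or.inl rfl)
        (by simpa using (h₀.ne j x).symm) (by simp)
      have k4 := key (.inr x) (.inl j) (.inr (f₁ j x)) (Or.inr rfl)
        (by simpa using (h₁.ne j x).symm) (by simp)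
      exact ⟨fun h => ⟨(h₁.ne j x).symm, k4 (k1 h.2)⟩, fun h => ⟨(h₀.ne j x).symm, k3 (k2 h.2)⟩⟩
  have hall := hlink _ hP ⟨hxy₀, fun b hx hy =>
    hreach _ _ (ε (.inr x₀)) (ε (.inr y₀)) (by simpa using hxy₀) hb₀x hb₀y hx hy⟩
  have hreachN : ∀ b : {b // b ∈ T'}, b.1 ∉ T →
      (blockIntersectionGraph 2 T').Reachable ⟨b₀, hb₀'⟩ b := by
    intro b hb
    have hb' : b.1 ∈ N₀ ∪ N₁ := hres _ b.2 hb
    obtain ⟨x, y, hxy, hx, hy⟩ := hpts _ hb'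
    exact (hall x y hxy).2 b hx hy
  obtain ⟨t⟩ := hconn.nonempty
  have hpre := hconn.preconnected
  have htT' : t.1 ∈ T' := mem_union_left _ t.2
  have hreachT : ∀ b : {b // b ∈ T'}, b.1 ∈ T →
      (blockIntersectionGraph 2 T').Reachable ⟨t.1, htT'⟩ b := by
    intro b hb
    let φ : blockIntersectionGraph 2 T →g blockIntersectionGraph 2 T' :=
      ⟨fun c => ⟨c.1, mem_union_left _ c.2⟩, fun {c d} h =>
        ⟨fun e => h.1 (Subtype.ext (congrArg (fun z => z.1) e)), h.2⟩⟩
    exact (hpre t ⟨b.1, hb⟩).map φ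
  have hb₀T : b₀ ∉ T := fun h => hTN _ h (mem_union_left _ hb₀)
  have hnot : ¬ (blockIntersectionGraph 2 T').Reachable ⟨t.1, htT'⟩ ⟨b₀, hb₀'⟩ := by
    rintro ⟨p⟩
    have : ∀ (b c : {b // b ∈ T'}) (p : (blockIntersectionGraph 2 T').Walk b c), b.1 ∈ T →
        c.1 ∈ T := by
      intro b c p
      induction p with
      | nil => exact id
      | cons h _ ih => exact fun hb => ih (hTadj _ _ h hb)
    exact hb₀T (this _ _ p t.2)
  refine ⟨V, T', htts, ?_, ?_, ?_, ?_, ?_⟩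
  · refine ⟨hUV, fun h => hεZ x₀ (h (hmemV _))⟩
  · refine ⟨subset_union_left, fun h => hb₀T (h hb₀')⟩
  · obtain ⟨C⟩ := hbip
    classical
    -- Old blocks keep their colours; the two systems get one colour each, since blocks of the same
    -- system share at most one point.
    refine ⟨SimpleGraph.Coloring.mk (fun b => if h : b.1 ∈ T then C ⟨b.1, h⟩ else
      if b.1 ∈ N₀ then 0 else 1) ?_⟩
    intro b c hbc
    by_cases hb : b.1 ∈ T
    · have hc := hTadj b c hbc hb
      rw [dif_pos hb, dif_pos hc]
      exact C.valid ⟨fun e => hbc.1 (Subtype.ext (congrArg (fun z => z.1) e)), hbc.2⟩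
    · have hc : c.1 ∉ T := fun hc => hb (hTadj c b hbc.symm hc)
      rw [dif_neg hb, dif_neg hc]
      have hb' : b.1 ∈ N₀ ∪ N₁ := hres _ b.2 hb
      have hc' : c.1 ∈ N₀ ∪ N₁ := hres _ c.2 hc
      obtain ⟨a, a', haa, hi⟩ := card_eq_two.1 hbc.2
      have ha : a ∈ b.1 ∩ c.1 := by rw [hi]; simp
      have ha' : a' ∈ b.1 ∩ c.1 := by rw [hi]; simp
      rw [mem_inter] at ha ha'
      obtain ⟨p, rfl⟩ : ∃ p, ε p = a := by simpa [hV] using hsubV _ b.2 ha.1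
      obtain ⟨q, rfl⟩ : ∃ p, ε p = a' := by simpa [hV] using hsubV _ b.2 ha'.1
      have hpq : p ≠ q := fun h => haa (by rw [h])
      by_cases hb0 : b.1 ∈ N₀ <;> by_cases hc0 : c.1 ∈ N₀
      · exact absurd (Subtype.ext (ternBlocks_unique t₀ hb0 hc0 ha.1 ha'.1 ha.2 ha'.2 hpq)) hbc.1
      · simp [hb0, hc0]
      · simp [hb0, hc0]
      · have hb1 := (mem_union.1 hb').resolve_left hb0
        have hc1 := (mem_union.1 hc').resolve_left hc0
        exact absurd (Subtype.ext (ternBlocks_unique t₁ hb1 hc1 ha.1 ha'.1 ha.2 ha'.2 hpq)) hbc.1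
  · rw [Nat.card_eq_two_iff]
    refine ⟨(blockIntersectionGraph 2 T').connectedComponentMk ⟨t.1, htT'⟩,
      (blockIntersectionGraph 2 T').connectedComponentMk ⟨b₀, hb₀'⟩, ?_, ?_⟩
    · intro h
      exact hnot (SimpleGraph.ConnectedComponent.exact h)
    · ext c
      simp only [Set.mem_insert_iff, Set.mem_singleton_iff, Set.mem_univ, iff_true]
      induction c using SimpleGraph.ConnectedComponent.ind with
      | h b =>
        by_cases hb : b.1 ∈ T
        · exact Or.inl (SimpleGraph.ConnectedComponent.sound (hreachT b hb).symm)
        · exact Or.inr (SimpleGraph.ConnectedComponent.sound (hreachN b hb).symm)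
  · obtain ⟨a, b, c, hab, hac, hbc, h⟩ := habc
    have hout : ∀ x : Z, ε (.inr x) ∈ V \ U := fun x => mem_sdiff.2 ⟨hmemV _, hεZ x⟩
    refine ⟨_, hout a, _, hout b, _, hout c, by simpa using hab, by simpa using hac,
      by simpa using hbc, ?_⟩
    intro B hB hBU
    have hB' : B ∈ N₀ ∪ N₁ := by
      rw [hT', mem_union] at hB
      refine hB.resolve_left fun hBT => ?_
      have : B = ∅ := by
        rw [← disjoint_self_iff_empty]
        exact hBU.mono_right (hT.subset_points B hBT)
      have h3 := hT.card_block B hBT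
      simp [this] at h3
    have pair : ∀ x y : Z, x ≠ y → (∀ z, ¬ L₀ x y z ∧ ¬ L₁ x y z) → ε (.inr x) ∈ B →
        ε (.inr y) ∈ B → False := by
      intro x y hxy hz hx hy
      have hne : (Sum.inr x : J ⊕ Z) ≠ .inr y := by simpa using hxy
      rcases mem_union.1 hB' with hB' | hB'
      · obtain ⟨s, hs, e⟩ := ternBlocks_through t₀ hB' hx hy hne
        rcases s with j | z
        · exact disjoint_left.1 hBU (show ε (.inl j) ∈ B by rw [e]; simp) (hεJ j)
        · exact (hz z).1 hs
      · obtain ⟨s, hs, e⟩ := ternBlocks_through t₁ hB' hx hy hne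
        rcases s with j | z
        · exact disjoint_left.1 hBU (show ε (.inl j) ∈ B by rw [e]; simp) (hεJ j)
        · exact (hz z).2 hs
    have p1 := pair a b hab fun z => ⟨(h z).1, (h z).2.2.2.1⟩
    have p2 := pair a c hac fun z => ⟨(h z).2.1, (h z).2.2.2.2.1⟩
    have p3 := pair b c hbc fun z => ⟨(h z).2.2.1, (h z).2.2.2.2.2⟩
    rw [card_le_one]
    intro s hs t ht
    simp only [mem_inter, mem_insert, mem_singleton] at hs ht
    obtain ⟨hsB, rfl | rfl | rfl⟩ := hs <;> obtain ⟨htB, rfl | rfl | rfl⟩ := ht <;>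
      first | rfl | exact (p1 ‹_› ‹_›).elim | exact (p2 ‹_› ‹_›).elim | exact (p3 ‹_› ‹_›).elim

/-! ### Admissibility of the order of the given system. -/

/-- A twofold triple system with bipartite 2-block intersection graph splits into two Steiner triple
systems, so its order is admissible. -/
theorem admissible_of_isBipartite {α : Type*} [DecidableEq α] {u : ℕ} (hu : 0 < u) {U : Finset α}
    {T : Finset (Finset α)} (hT : IsTTS U T u)
    (hbip : (blockIntersectionGraph 2 T).IsBipartite) : Admissible u := by
  obtain ⟨C⟩ := hbip
  classical
  set S : Finset (Finset α) := T.filter fun b => ∃ h : b ∈ T, C ⟨b, h⟩ = 0 with hS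
  have hone : ∀ x ∈ U, ∀ y ∈ U, x ≠ y → (S.filter fun b => {x, y} ⊆ b).card = 1 := by
    intro x hx y hy hxy
    have h2 := hT.card_pair {x, y} (by
      intro a ha
      simp only [mem_insert, mem_singleton] at ha
      rcases ha with rfl | rfl <;> assumption) (card_pair hxy)
    obtain ⟨b, c, hbc, e⟩ := card_eq_two.1 h2
    have hb : b ∈ T.filter fun b => {x, y} ⊆ b := by rw [e]; simp
    have hc : c ∈ T.filter fun b => {x, y} ⊆ b := by rw [e]; simp
    rw [mem_filter, insert_subset_iff, singleton_subset_iff] at hb hc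
    have hadj : (blockIntersectionGraph 2 T).Adj ⟨b, hb.1⟩ ⟨c, hc.1⟩ :=
      ⟨fun h => hbc (congrArg (fun z => z.1) h), inter_card_eq_two (hT.card_block b hb.1)
        (hT.card_block c hc.1) hbc hxy hb.2.1 hb.2.2 hc.2.1 hc.2.2⟩
    have hval := C.valid hadj
    have heq : (S.filter fun b => {x, y} ⊆ b) =
        ({b, c} : Finset (Finset α)).filter fun b => ∃ h : b ∈ T, C ⟨b, h⟩ = 0 := by
      rw [← e, hS, filter_filter, filter_filter]
      congr 1
      ext b
      tauto
    have hcases : (C ⟨b, hb.1⟩ = 0 ∧ C ⟨c, hc.1⟩ = 1) ∨ (C ⟨b, hb.1⟩ = 1 ∧ C ⟨c, hc.1⟩ = 0) := by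
      generalize C ⟨b, hb.1⟩ = p at *
      generalize C ⟨c, hc.1⟩ = q at *
      revert p q
      decide
    rw [heq, card_eq_one]
    rcases hcases with ⟨h1, h2⟩ | ⟨h1, h2⟩
    · refine ⟨b, ?_⟩
      ext d
      simp only [mem_filter, mem_insert, mem_singleton]
      constructor
      · rintro ⟨rfl | rfl, h, h'⟩
        · rfl
        · rw [h2] at h'; exact absurd h' (by decide)
      · rintro rfl
        exact ⟨Or.inl rfl, hb.1, h1⟩
    · refine ⟨c, ?_⟩
      ext d
      simp only [mem_filter, mem_insert, mem_singleton]
      constructor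
      · rintro ⟨rfl | rfl, h, h'⟩
        · rw [h1] at h'; exact absurd h' (by decide)
        · rfl
      · rintro rfl
        exact ⟨Or.inr rfl, hc.1, h2⟩
  have hST : S ⊆ T := filter_subset _ _
  have hpt : ∀ x ∈ U, (S.filter fun b => x ∈ b).card * 2 = u - 1 := by
    intro x hx
    have := sum_card_bipartiteAbove_eq_sum_card_bipartiteBelow (s := U.erase x)
      (t := S.filter fun b => x ∈ b) (fun (y : α) (b : Finset α) => y ∈ b)
    rw [sum_const_nat (m := 1), sum_const_nat (m := 2), card_erase_of_mem hx, hT.card_points] at this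
    · omega
    · intro b hb
      rw [mem_filter] at hb
      have : (U.erase x).bipartiteBelow (fun (y : α) (b : Finset α) => y ∈ b) b = b.erase x := by
        ext y
        simp only [bipartiteBelow, mem_filter, mem_erase]
        exact ⟨fun h => ⟨h.1.1, h.2⟩,
          fun h => ⟨⟨h.1, hT.subset_points b (hST hb.1) h.2⟩, h.2⟩⟩
      rw [this, card_erase_of_mem hb.2, hT.card_block b (hST hb.1)]
    · intro y hy
      rw [mem_erase] at hy
      rw [← hone x hx y hy.2 hy.1.symm]
      congr 1
      ext b
      simp only [bipartiteAbove, mem_filter, insert_subset_iff, singleton_subset_iff]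
      tauto
  have htot : 6 * S.card = u * (u - 1) := by
    have := sum_card_bipartiteAbove_eq_sum_card_bipartiteBelow (s := U) (t := S)
      (fun (y : α) (b : Finset α) => y ∈ b)
    rw [sum_const_nat (s := S) (m := 3)] at this
    · have h2 : (∑ a ∈ U, (S.bipartiteAbove (fun (y : α) (b : Finset α) => y ∈ b) a).card) * 2
          = u * (u - 1) := by
        rw [sum_mul, sum_const_nat (m := u - 1), hT.card_points]
        intro x hx
        exact hpt x hx
      omega
    · intro b hb
      have : U.bipartiteBelow (fun (y : α) (b : Finset α) => y ∈ b) b = b := by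
        ext y
        simp only [bipartiteBelow, mem_filter]
        exact ⟨fun h => h.2, fun h => ⟨hT.subset_points b (hST hb) h, h⟩⟩
      rw [this, hT.card_block b (hST hb)]
  obtain ⟨x, hx⟩ : U.Nonempty := by
    rw [← card_pos, hT.card_points]
    exact hu
  have hodd : u % 2 = 1 := by
    have := hpt x hx
    omega
  have h6 : u * (u - 1) % 6 = 0 := by rw [← htot]; omega
  have hlt : u % 6 < 6 := Nat.mod_lt _ (by norm_num)
  have : u % 6 ≠ 5 := by
    intro h
    obtain ⟨q, rfl⟩ : ∃ q, u = 6 * q + 5 := ⟨u / 6, by omega⟩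
    have : (6 * q + 5) * (6 * q + 5 - 1) = 6 * (6 * q * q + 9 * q + 3) + 2 := by
      rw [show 6 * q + 5 - 1 = 6 * q + 4 by omega]
      ring
    omega
  unfold Admissible
  omega

/-! ### Unions and relabellings of systems. -/

theorem IsSystem.sumElim {J K Z : Type} {f : J → Z → Z} {g : K → Z → Z}
    {L M : Z → Z → Z → Prop} (hf : IsSystem f L) (hg : IsSystem g M)
    (h : ∀ x y, Covers f L x y → ¬ Covers g M x y) :
    IsSystem (Sum.elim f g) (fun x y z => L x y z ∨ M x y z) where
  invol := by rintro (j | j) x; exacts [hf.invol j x, hg.invol j x]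
  ne := by rintro (j | j) x; exacts [hf.ne j x, hg.ne j x]
  inj := by
    rintro (i | i) (j | j) x H
    · exact congrArg Sum.inl (hf.inj i j x H)
    · exact absurd (Or.inl ⟨j, H.symm⟩) (h x _ (Or.inl ⟨i, rfl⟩))
    · exact absurd (Or.inl ⟨i, H⟩) (h x _ (Or.inl ⟨j, rfl⟩))
    · exact congrArg Sum.inr (hg.inj i j x H)
  swap := fun x y z => Or.imp (hf.swap x y z) (hg.swap x y z)
  rot := fun x y z => Or.imp (hf.rot x y z) (hg.rot x y z)
  irrefl := fun x y z H => H.elim (hf.irrefl x y z) (hg.irrefl x y z)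
  uniq := by
    rintro x y z z' (H | H) (H' | H')
    · exact hf.uniq _ _ _ _ H H'
    · exact absurd (Or.inr ⟨_, H'⟩) (h x y (Or.inr ⟨_, H⟩))
    · exact absurd (Or.inr ⟨_, H⟩) (h x y (Or.inr ⟨_, H'⟩))
    · exact hg.uniq _ _ _ _ H H'
  disj := by
    rintro (j | j) x y z (H | H) e
    · exact hf.disj _ _ _ _ H e
    · exact absurd (Or.inr ⟨_, H⟩) (h x y (Or.inl ⟨_, e⟩))
    · exact absurd (Or.inl ⟨_, e⟩) (h x y (Or.inr ⟨_, H⟩))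
    · exact hg.disj _ _ _ _ H e

theorem covers_sumElim {J K Z : Type} {f : J → Z → Z} {g : K → Z → Z}
    {L M : Z → Z → Z → Prop} {x y : Z} :
    Covers (Sum.elim f g) (fun x y z => L x y z ∨ M x y z) x y ↔ Covers f L x y ∨ Covers g M x y := by
  simp only [Covers, Sum.exists, Sum.elim_inl, Sum.elim_inr, exists_or]
  tauto

theorem IsSystem.reindex {J K Z : Type} {f : J → Z → Z} {L : Z → Z → Z → Prop} (h : IsSystem f L)
    {σ : K → J} (hσ : σ.Injective) : IsSystem (fun k => f (σ k)) L where
  invol j := h.invol (σ j)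
  ne j := h.ne (σ j)
  inj _ _ x H := hσ (h.inj _ _ x H)
  swap := h.swap
  rot := h.rot
  irrefl := h.irrefl
  uniq := h.uniq
  disj j := h.disj (σ j)

theorem covers_reindex {J K Z : Type} {f : J → Z → Z} {L : Z → Z → Z → Prop} {σ : K → J}
    (hσ : σ.Surjective) {x y : Z} : Covers (fun k => f (σ k)) L x y ↔ Covers f L x y := by
  unfold Covers
  rw [hσ.exists]

/-- The number of labels is determined by the number of points joined to `x` by triples. -/
theorem IsSystem.card_labels {J Z : Type} [Fintype J] [Fintype Z] {f : J → Z → Z}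
    {L : Z → Z → Z → Prop} (h : IsSystem f L) (hc : ∀ x y, x ≠ y → Covers f L x y) (x : Z)
    (S : Finset Z) (hS : ∀ y, y ∈ S ↔ ∃ z, L x y z) :
    Fintype.card J + S.card + 1 = Fintype.card Z := by
  classical
  have e : (univ : Finset Z) = insert x ((univ.image fun j => f j x) ∪ S) := by
    ext y
    simp only [mem_univ, mem_insert, mem_union, mem_image, true_and, true_iff]
    by_cases hxy : y = x
    · exact Or.inl hxy
    · right
      rw [hS]
      exact hc x y (Ne.symm hxy)
  rw [← card_univ (α := Z), e, card_insert_of_notMem, card_union_of_disjoint, card_image_of_injective,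
    card_univ]
  · exact fun i j H => h.inj i j x H
  · rw [disjoint_left]
    simp only [mem_image, mem_univ, true_and, hS]
    rintro _ ⟨j, rfl⟩ ⟨z, H⟩
    exact h.disj _ _ _ _ H rfl
  · simp only [mem_union, mem_image, mem_univ, true_and, hS, not_or, not_exists]
    exact ⟨fun j => h.ne j x, fun z H => h.irrefl _ _ _ H rfl⟩

/-! ### Gluing two gadgets along a chain of common matchings. -/

/-- The union of two matchings is connected. -/
def ConnPair {Z : Type} (f g : Z → Z) : Prop :=
  ∀ Q : Z → Prop, (∀ x, Q x → Q (f x)) → (∀ x, Q x → Q (g x)) → ∀ x y, Q x → Q y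

/-- Two systems on the same pairs, whose labels are matched except for a distinguished one. -/
structure Gadget {D Z : Type} (f₀ f₁ : Option D → Z → Z) (L₀ L₁ : Z → Z → Z → Prop) : Prop where
  sys₀ : IsSystem f₀ L₀
  sys₁ : IsSystem f₁ L₁
  cov : ∀ x y, Covers f₀ L₀ x y ↔ Covers f₁ L₁ x y
  ne : ∀ d x, f₀ (some d) x ≠ f₁ (some d) x
  disj : ∀ x y z, L₀ x y z → ¬ L₁ x y z

section Join
variable {D E Z : Type} {n : ℕ}

/-- The cyclic shift of the labels along the chain formed by the first distinguished label, the
common labels and the second distinguished label. -/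
def shiftLabel (hn : 0 < n) : Option D ⊕ (Fin n ⊕ Option E) → Option D ⊕ (Fin n ⊕ Option E)
  | .inl none => .inr (.inl ⟨0, hn⟩)
  | .inl (some d) => .inl (some d)
  | .inr (.inl i) => if h : i.1 + 1 < n then .inr (.inl ⟨i.1 + 1, h⟩) else .inr (.inr none)
  | .inr (.inr none) => .inl none
  | .inr (.inr (some d)) => .inr (.inr (some d))

theorem shiftLabel_injective (hn : 0 < n) :
    Function.Injective (shiftLabel (D := D) (E := E) hn) := by
  rintro ((_ | a) | i | _ | a) ((_ | b) | j | _ | b) h <;> simp only [shiftLabel] at h <;>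
    (try split_ifs at h) <;> simp_all [Fin.ext_iff] <;>
    omega

variable [Fintype D] [Fintype E] [Fintype Z]

/-- The first system uses `e₀`, `c`, `x₀`, the second `e₁`, `c`, `x₁` after `shiftLabel`. Thus one
label carries `e₀ none` and the first `c`, the next ones carry consecutive matchings of `c`, then
one carries the last `c` and `x₁ none`, and one carries `x₀ none` and `e₁ none`. The shift keeps a
common matching from meeting itself, and it transports membership in a component along the chain.
The equation `hu` makes the number of labels equal to `u`. -/
theorem exists_tts_of_gadgets {α : Type*} [DecidableEq α] [Infinite α]
    {u : ℕ} {U : Finset α} {T : Finset (Finset α)} (hT : IsTTS U T u)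
    (hbip : (blockIntersectionGraph 2 T).IsBipartite)
    (hconn : (blockIntersectionGraph 2 T).Connected)
    {e₀ e₁ : Option D → Z → Z} {LE₀ LE₁ : Z → Z → Z → Prop} (hE : Gadget e₀ e₁ LE₀ LE₁)
    {x₀ x₁ : Option E → Z → Z} {LX₀ LX₁ : Z → Z → Z → Prop} (hX : Gadget x₀ x₁ LX₀ LX₁)
    (hElink : ∀ P, Closed (fun d => e₀ (some d)) LE₀ (fun d => e₁ (some d)) LE₁ P →
      (∀ x, P x (e₀ none x)) → ∀ x y, Covers e₀ LE₀ x y → P x y)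
    (hXlink : ∀ P, Closed (fun d => x₀ (some d)) LX₀ (fun d => x₁ (some d)) LX₁ P →
      (∀ x, P x (x₀ none x)) → (∀ x, P x (x₁ none x)) → ∀ x y, Covers x₀ LX₀ x y → P x y)
    (hn : 0 < n) {c : Fin n → Z → Z} (hc : IsSystem c fun _ _ _ => False)
    (hEX : ∀ x y, Covers e₀ LE₀ x y → ¬ Covers x₀ LX₀ x y)
    (hcE : ∀ i x, ¬ Covers e₀ LE₀ x (c i x)) (hcX : ∀ i x, ¬ Covers x₀ LX₀ x (c i x))
    (htot : ∀ x y, x ≠ y → Covers e₀ LE₀ x y ∨ Covers x₀ LX₀ x y ∨ ∃ i, c i x = y)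
    (hroot : ConnPair (e₀ none) (c ⟨0, hn⟩) ∨
      ∃ (i : ℕ) (h : i + 1 < n), ConnPair (c ⟨i, by omega⟩) (c ⟨i + 1, h⟩))
    (z₀ : Z) (S : Finset Z) (hS : ∀ y, y ∈ S ↔ ∃ z, LE₀ z₀ y z ∨ LX₀ z₀ y z)
    (hu : u + S.card + 1 = Fintype.card Z)
    (habc : ∃ a b c : Z, a ≠ b ∧ a ≠ c ∧ b ≠ c ∧ ∀ z,
      ¬ LE₀ a b z ∧ ¬ LE₀ a c z ∧ ¬ LE₀ b c z ∧ ¬ LE₁ a b z ∧ ¬ LE₁ a c z ∧ ¬ LE₁ b c z ∧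
      ¬ LX₀ a b z ∧ ¬ LX₀ a c z ∧ ¬ LX₀ b c z ∧ ¬ LX₁ a b z ∧ ¬ LX₁ a c z ∧ ¬ LX₁ b c z) :
    ∃ (V : Finset α) (T' : Finset (Finset α)),
      IsTTS V T' (u + Fintype.card Z) ∧ U ⊂ V ∧ T ⊂ T' ∧
      (blockIntersectionGraph 2 T').IsBipartite ∧
      Nat.card (blockIntersectionGraph 2 T').ConnectedComponent = 2 ∧
      ∃ a ∈ V \ U, ∃ b ∈ V \ U, ∃ c ∈ V \ U, a ≠ b ∧ a ≠ c ∧ b ≠ c ∧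
        ∀ B ∈ T', Disjoint B U → (B ∩ {a, b, c}).card ≤ 1 := by
  have hcov : ∀ x y, Covers c (fun _ _ _ => False) x y ↔ ∃ i, c i x = y := by
    intro x y
    simp [Covers]
  have hcX₀ : ∀ x y, Covers c (fun _ _ _ => False) x y → ¬ Covers x₀ LX₀ x y := by
    intro x y h
    obtain ⟨i, rfl⟩ := (hcov x y).1 h
    exact hcX i x
  have hcX₁ : ∀ x y, Covers c (fun _ _ _ => False) x y → ¬ Covers x₁ LX₁ x y := by
    intro x y h
    rw [← hX.cov]
    exact hcX₀ x y h
  have hsum₀ : ∀ x y, Covers e₀ LE₀ x y →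
      ¬ Covers (Sum.elim c x₀) (fun x y z => False ∨ LX₀ x y z) x y := by
    intro x y h h'
    rcases covers_sumElim.1 h' with h' | h'
    · obtain ⟨i, rfl⟩ := (hcov x y).1 h'
      exact hcE i x h
    · exact hEX x y h h'
  have hsum₁ : ∀ x y, Covers e₁ LE₁ x y →
      ¬ Covers (Sum.elim c x₁) (fun x y z => False ∨ LX₁ x y z) x y := by
    intro x y h h'
    rw [← hE.cov] at h
    rcases covers_sumElim.1 h' with h' | h'
    · obtain ⟨i, rfl⟩ := (hcov x y).1 h'
      exact hcE i x h
    · exact hEX x y h ((hX.cov x y).2 h')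
  have s₀ := hE.sys₀.sumElim (hc.sumElim hX.sys₀ hcX₀) hsum₀
  have s₁' := hE.sys₁.sumElim (hc.sumElim hX.sys₁ hcX₁) hsum₁
  have hσ := shiftLabel_injective (D := D) (E := E) hn
  have s₁ := s₁'.reindex hσ
  have c₀ : ∀ x y, x ≠ y → Covers (Sum.elim e₀ (Sum.elim c x₀))
      (fun x y z => LE₀ x y z ∨ False ∨ LX₀ x y z) x y := by
    intro x y hxy
    rw [covers_sumElim, covers_sumElim, hcov]
    have := htot x y hxy
    tauto
  have c₁ : ∀ x y, x ≠ y → Covers (fun k => Sum.elim e₁ (Sum.elim c x₁) (shiftLabel hn k))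
      (fun x y z => LE₁ x y z ∨ False ∨ LX₁ x y z) x y := by
    intro x y hxy
    rw [covers_reindex (Finite.surjective_of_injective hσ), covers_sumElim, covers_sumElim, hcov,
      ← hE.cov, ← hX.cov]
    have := htot x y hxy
    tauto
  have hcard := s₀.card_labels c₀ z₀ S (by
    intro y
    rw [hS]
    simp)
  have sh : ∀ (i : ℕ) (h : i + 1 < n), shiftLabel (D := D) (E := E) hn (.inr (.inl ⟨i, by omega⟩)) =
      .inr (.inl ⟨i + 1, h⟩) := by
    intro i h
    simp only [shiftLabel, dif_pos h]
  have sl : shiftLabel (D := D) (E := E) hn (.inr (.inl ⟨n - 1, by omega⟩)) =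
      .inr (.inr none) := by
    have h : ¬ (n - 1 + 1 < n) := by omega
    simp only [shiftLabel, dif_neg h]
  refine exists_tts_of_systems hT hbip hconn (by omega) s₀ s₁ c₀ c₁ ?_ ?_ ?_ ?_
  · rintro ((_ | d) | i | _ | d) x H
    · simp only [shiftLabel, Sum.elim_inl, Sum.elim_inr] at H
      exact hcE ⟨0, hn⟩ x (Or.inl ⟨none, H⟩)
    · exact hE.ne d x H
    · by_cases h : i.1 + 1 < n
      · simp only [shiftLabel, dif_pos h, Sum.elim_inl, Sum.elim_inr] at H
        have := hc.inj _ _ x H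
        rw [Fin.ext_iff] at this
        simp at this
      · simp only [shiftLabel, dif_neg h, Sum.elim_inl, Sum.elim_inr] at H
        exact hcX i x ((hX.cov _ _).2 (Or.inl ⟨none, H.symm⟩))
    · simp only [shiftLabel, Sum.elim_inl, Sum.elim_inr] at H
      exact hEX x _ ((hE.cov _ _).2 (Or.inl ⟨none, rfl⟩)) (Or.inl ⟨none, H⟩)
    · exact hX.ne d x H
  · rintro x y z (h | h | h) (h' | h' | h')
    · exact hE.disj _ _ _ h h'
    · exact h'
    · exact hEX x y (Or.inr ⟨z, h⟩) ((hX.cov _ _).2 (Or.inr ⟨z, h'⟩))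
    · exact h
    · exact h
    · exact h
    · exact hEX x y ((hE.cov _ _).2 (Or.inr ⟨z, h'⟩)) (Or.inr ⟨z, h⟩)
    · exact h'
    · exact hX.disj _ _ _ h h'
  · have main : ∀ P, Closed (Sum.elim e₀ (Sum.elim c x₀))
        (fun x y z => LE₀ x y z ∨ False ∨ LX₀ x y z)
        (fun k => Sum.elim e₁ (Sum.elim c x₁) (shiftLabel hn k))
        (fun x y z => LE₁ x y z ∨ False ∨ LX₁ x y z) P →
        (∃ i, ∀ x, P x (c i x)) → ∀ x y, x ≠ y → P x y := by
      rintro P hP ⟨i, hi⟩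
      have step : ∀ (i : ℕ) (h : i + 1 < n),
          ((∀ x, P x (c ⟨i, by omega⟩ x)) ↔ ∀ x, P x (c ⟨i + 1, h⟩ x)) := by
        intro i h
        refine forall_congr' fun x => ?_
        have := hP.pos (.inr (.inl ⟨i, by omega⟩)) x
        rw [sh i h] at this
        exact this
      have h0 : ∀ x, P x (c ⟨0, hn⟩ x) := by
        obtain ⟨i, hin⟩ := i
        induction i with
        | zero => exact hi
        | succ i ih => exact ih (by omega) ((step i hin).2 hi)
      have hall : ∀ (i : ℕ) (h : i < n), ∀ x, P x (c ⟨i, h⟩ x) := by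
        intro i
        induction i with
        | zero => exact fun _ => h0
        | succ i ih => exact fun h => (step i h).1 (ih (by omega))
      -- From the chain to the gadgets: the first `c` reaches `e₀ none`, hence the whole first
      -- gadget. That contains `e₁ none`, which reaches `x₀ none`, while the last `c` reaches `x₁
      -- none`.
      have hE' := hElink P ⟨hP.symm, fun x y z h => hP.pure₀ x y z (Or.inl h),
        fun x y z h => hP.pure₁ x y z (Or.inl h), fun d x => hP.pos (.inl (some d)) x⟩
        fun x => (hP.pos (.inl none) x).2 (h0 x)
      have hX' := hXlink P ⟨hP.symm, fun x y z h => hP.pure₀ x y z (Or.inr (Or.inr h)),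
        fun x y z h => hP.pure₁ x y z (Or.inr (Or.inr h)),
        fun d x => hP.pos (.inr (.inr (some d))) x⟩
        (fun x => (hP.pos (.inr (.inr none)) x).2
          (hE' _ _ ((hE.cov _ _).2 (Or.inl ⟨none, rfl⟩))))
        (fun x => by
          have := (hP.pos (.inr (.inl ⟨n - 1, by omega⟩)) x).1 (hall _ _ x)
          rw [sl] at this
          exact this)
      intro x y hxy
      rcases htot x y hxy with h | h | ⟨⟨i, hi⟩, rfl⟩
      · exact hE' x y h
      · exact hX' x y h
      · exact hall i hi x
    -- Two edges at a point with the same label are in the same component, and an edge can be read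
    -- from either end; so one edge spreads along the connected union of the two matchings of that
    -- label.
    have conn : ∀ P, Closed (Sum.elim e₀ (Sum.elim c x₀))
        (fun x y z => LE₀ x y z ∨ False ∨ LX₀ x y z)
        (fun k => Sum.elim e₁ (Sum.elim c x₁) (shiftLabel hn k))
        (fun x y z => LE₁ x y z ∨ False ∨ LX₁ x y z) P → ∀ j,
        ConnPair (Sum.elim e₀ (Sum.elim c x₀) j) (Sum.elim e₁ (Sum.elim c x₁) (shiftLabel hn j)) →
        P z₀ (Sum.elim e₀ (Sum.elim c x₀) j z₀) →
        ∀ x, P x (Sum.elim e₀ (Sum.elim c x₀) j x) := by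
      intro P hP j hj h x
      refine hj (fun x => P x (Sum.elim e₀ (Sum.elim c x₀) j x)) ?_ ?_ z₀ x h
      · intro y hy
        rw [s₀.invol]
        exact hP.symm _ _ hy
      · intro y hy
        rw [hP.pos] at hy ⊢
        rw [s₁.invol j y]
        exact hP.symm _ _ hy
    rcases hroot with h | ⟨i, hi, h⟩
    · refine ⟨z₀, e₀ none z₀, (hE.sys₀.ne none z₀).symm, fun P hP hP₀ => main P hP ⟨⟨0, hn⟩, ?_⟩⟩
      have := conn P hP (.inl none) h hP₀
      exact fun x => (hP.pos (.inl none) x).1 (this x)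
    · refine ⟨z₀, c ⟨i, by omega⟩ z₀, (hc.ne _ z₀).symm, fun P hP hP₀ =>
        main P hP ⟨⟨i, by omega⟩, ?_⟩⟩
      refine conn P hP (.inr (.inl ⟨i, by omega⟩)) ?_ hP₀
      rw [sh i hi]
      exact h
  · obtain ⟨a, b, c, hab, hac, hbc, h⟩ := habc
    refine ⟨a, b, c, hab, hac, hbc, fun z => ?_⟩
    have := h z
    tauto
end Join

/-! ### Perfect matchings on the cyclic group of order `2 * m`. -/

section Cyclic
variable {m : ℕ}

/-- The parity of an element of `ZMod (2 * m)`. -/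
def par : ZMod (2 * m) →+* ZMod 2 := ZMod.castHom (Dvd.intro m rfl) (ZMod 2)

theorem zmod_two_cases : ∀ a : ZMod 2, a = 0 ∨ a = 1 := by decide

theorem par_natCast (a : ℕ) : par (a : ZMod (2 * m)) = a := map_natCast _ _

theorem par_natCast_eq_zero {a : ℕ} : par (a : ZMod (2 * m)) = 0 ↔ a % 2 = 0 := by
  rw [par_natCast, ZMod.natCast_eq_zero_iff, Nat.dvd_iff_mod_eq_zero]

/-- The matching between even and odd elements given by translation by `g`. -/
def half (g x : ZMod (2 * m)) : ZMod (2 * m) := if par x = 0 then x + g else x - g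

/-- The difference of two elements, taken from the first if this is even, and from the second
otherwise. -/
def signedDiff (x y : ZMod (2 * m)) : ZMod (2 * m) := if par x = 0 then y - x else x - y

theorem half_eq_iff {g x y : ZMod (2 * m)} : half g x = y ↔ signedDiff x y = g := by
  unfold half signedDiff
  split_ifs
  · exact ⟨fun h => by rw [← h]; ring, fun h => by rw [← h]; ring⟩
  · exact ⟨fun h => by rw [← h]; ring, fun h => by rw [← h]; ring⟩

theorem signedDiff_half (g x : ZMod (2 * m)) : signedDiff x (half g x) = g := half_eq_iff.1 rfl

theorem signedDiff_eq_or (x y : ZMod (2 * m)) : signedDiff x y = y - x ∨ signedDiff x y = -(y - x) := by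
  unfold signedDiff
  split_ifs
  · exact Or.inl rfl
  · exact Or.inr (by ring)

theorem signedDiff_ne_zero {x y : ZMod (2 * m)} (h : x ≠ y) : signedDiff x y ≠ 0 := by
  unfold signedDiff
  split_ifs
  · exact sub_ne_zero.2 h.symm
  · exact sub_ne_zero.2 h

theorem par_half {g x : ZMod (2 * m)} (hg : par g = 1) : par (half g x) = par x + 1 := by
  unfold half
  split_ifs
  · rw [map_add, hg]
  · rw [map_sub, hg]
    have : ∀ a : ZMod 2, a - 1 = a + 1 := by decide
    exact this _

theorem half_invol {g : ZMod (2 * m)} (hg : par g = 1) (x : ZMod (2 * m)) :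
    half g (half g x) = x := by
  have h := par_half (x := x) hg
  rcases zmod_two_cases (par x) with hx | hx
  · have e : half g x = x + g := if_pos hx
    rw [hx] at h
    unfold half at h ⊢
    rw [if_pos hx] at h ⊢
    rw [if_neg (by rw [h]; decide)]
    ring
  · have hx' : ¬ par x = 0 := by rw [hx]; decide
    rw [hx] at h
    unfold half at h ⊢
    rw [if_neg hx'] at h ⊢
    rw [if_pos (by rw [h]; decide)]
    ring

theorem half_ne {g : ZMod (2 * m)} (hg : par g = 1) (x : ZMod (2 * m)) : half g x ≠ x := by
  intro h
  have := par_half (x := x) hg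
  rw [h] at this
  have h' : ∀ a : ZMod 2, a ≠ a + 1 := by decide
  exact h' _ this

theorem isSystem_half {g : ZMod (2 * m)} (hg : par g = 1) :
    IsSystem (fun _ : Unit => half g) fun _ _ _ => False where
  invol _ := half_invol hg
  ne _ := half_ne hg
  inj _ _ _ _ := rfl
  swap _ _ _ h := h
  rot _ _ _ h := h
  irrefl _ _ _ h := h.elim
  uniq _ _ _ _ h := h.elim
  disj _ _ _ _ h := h.elim

/-- Three matchings formed by the pairs with difference `d` and the matching `half g`; the pairs
with difference `d` are coloured by `c`. -/
def prism (d g : ZMod (2 * m)) (c : ZMod (2 * m) → ZMod 3) (i : ZMod 3) (x : ZMod (2 * m)) :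
    ZMod (2 * m) :=
  if c (if par x = 0 then x else x - g) = i then x + d
  else if c ((if par x = 0 then x else x - g) - d) = i then x - d else half g x

/-- Steps `d` form cycles on the even and on the odd elements, and `half g` joins these cycles by
rungs. Both cycles are coloured alike, so the two ends of a rung see the same two colours and the
rung takes the third. The condition `d ≠ -d` makes `x + d` and `x - d` different neighbours. -/
theorem isSystem_prism {d g : ZMod (2 * m)} {c : ZMod (2 * m) → ZMod 3} (hd : par d = 0)
    (hd2 : d ≠ -d) (hg : par g = 1) (hc : ∀ x, c x ≠ c (x + d)) :
    IsSystem (prism d g c) fun _ _ _ => False where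
  invol := by
    intro i x
    have hb : ∀ y, par y = par x → y - x = d ∨ y - x = -d →
        (if par y = 0 then y else y - g) = (if par x = 0 then x else x - g) + (y - x) := by
      intro y hy _
      rw [hy]
      split_ifs <;> ring
    have hpd : par (x + d) = par x := by rw [map_add, hd, add_zero]
    have hmd : par (x - d) = par x := by rw [map_sub, hd, sub_zero]
    have hbp := hb (x + d) hpd (Or.inl (by ring))
    have hbm := hb (x - d) hmd (Or.inr (by ring))
    rw [show x + d - x = d by ring] at hbp
    rw [show x - d - x = -d by ring] at hbm
    have hbh : (if par (half g x) = 0 then half g x else half g x - g) =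
        (if par x = 0 then x else x - g) := by
      rw [par_half hg]
      unfold half
      rcases zmod_two_cases (par x) with h | h
      · rw [h, if_neg (by decide), if_pos rfl, if_pos rfl]; ring
      · rw [h, if_pos (by decide), if_neg (by decide), if_neg (by decide)]
    by_cases h1 : c (if par x = 0 then x else x - g) = i
    · have e : prism d g c i x = x + d := if_pos h1
      rw [e]
      unfold prism
      rw [hbp, if_neg (by rw [← h1]; exact (hc _).symm), if_pos (by rw [add_sub_cancel_right, h1])]
      ring
    · by_cases h2 : c ((if par x = 0 then x else x - g) - d) = i
      · have e : prism d g c i x = x - d := by unfold prism; rw [if_neg h1, if_pos h2]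
        rw [e]
        unfold prism
        rw [hbm, if_pos (by rw [← sub_eq_add_neg, h2])]
        ring
      · have e : prism d g c i x = half g x := by unfold prism; rw [if_neg h1, if_neg h2]
        rw [e]
        unfold prism
        rw [hbh, if_neg h1, if_neg h2, half_invol hg]
  ne := by
    intro i x
    have hd0 : d ≠ 0 := by rintro rfl; simp at hd2
    unfold prism
    split_ifs
    · simpa using hd0
    · simpa [sub_eq_self] using hd0
    · exact half_ne hg x
    · simpa using hd0
    · simpa [sub_eq_self] using hd0
    · exact half_ne hg x
  inj := by
    intro i j x h
    have key : ∀ p q i j : ZMod 3, p ≠ q → p ≠ i → q ≠ i → p ≠ j → q ≠ j → i = j := by decide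
    have h3 : ∀ e : ZMod (2 * m), par e = 0 → x + e ≠ half g x := by
      intro e he h
      have := par_half (x := x) hg
      rw [← h, map_add, he] at this
      simp at this
    have h4 : x + d ≠ x - d := by
      intro h
      apply hd2
      rw [sub_eq_add_neg] at h
      exact add_left_cancel h
    have h5 : x - d ≠ half g x := by
      rw [sub_eq_add_neg]
      exact h3 _ (by rw [map_neg, hd, neg_zero])
    have h6 := h3 d hd
    have h7 := hc ((if par x = 0 then x else x - g) - d)
    rw [sub_add_cancel] at h7
    unfold prism at h
    generalize (if par x = 0 then x else x - g) = b at h h7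
    by_cases a1 : c b = i
    · rw [if_pos a1] at h
      by_cases a2 : c b = j
      · rw [← a1, a2]
      · rw [if_neg a2] at h
        split_ifs at h
        · exact absurd h h4
        · exact absurd h h6
    · rw [if_neg a1] at h
      by_cases a2 : c b = j
      · rw [if_pos a2] at h
        split_ifs at h
        · exact absurd h.symm h4
        · exact absurd h.symm h6
      · rw [if_neg a2] at h
        by_cases b1 : c (b - d) = i
        · rw [if_pos b1] at h
          by_cases b2 : c (b - d) = j
          · rw [← b1, b2]
          · rw [if_neg b2] at h
            exact absurd h h5
        · rw [if_neg b1] at h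
          by_cases b2 : c (b - d) = j
          · rw [if_pos b2] at h
            exact absurd h.symm h5
          · exact key _ _ _ _ h7 b1 a1 b2 a2
  swap _ _ _ h := h
  rot _ _ _ h := h
  irrefl _ _ _ h := h.elim
  uniq _ _ _ _ h := h.elim
  disj _ _ _ _ h := h.elim

theorem signedDiff_prism (d g : ZMod (2 * m)) (c : ZMod (2 * m) → ZMod 3) (i : ZMod 3)
    (x : ZMod (2 * m)) : signedDiff x (prism d g c i x) = d ∨ signedDiff x (prism d g c i x) = -d ∨
      signedDiff x (prism d g c i x) = g := by
  have h := signedDiff_half g x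
  have h1 := signedDiff_eq_or x (x + d)
  have h2 := signedDiff_eq_or x (x - d)
  rw [add_sub_cancel_left] at h1
  rw [sub_sub_cancel_left, neg_neg] at h2
  unfold prism
  generalize (if par x = 0 then x else x - g) = b
  split_ifs <;> tauto

theorem exists_prism_eq {d g : ZMod (2 * m)} {c : ZMod (2 * m) → ZMod 3}
    (hc : ∀ x, c x ≠ c (x + d)) {x y : ZMod (2 * m)}
    (h : signedDiff x y = d ∨ signedDiff x y = -d ∨ signedDiff x y = g) : ∃ i, prism d g c i x = y := by
  set b := (if par x = 0 then x else x - g) with hb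
  have h7 := hc (b - d)
  rw [sub_add_cancel] at h7
  have key : ∀ p q : ZMod 3, p ≠ q → p ≠ -(p + q) ∧ q ≠ -(p + q) := by decide
  have e1 : prism d g c (c b) x = x + d := by unfold prism; rw [← hb, if_pos rfl]
  have e2 : prism d g c (c (b - d)) x = x - d := by
    unfold prism; rw [← hb, if_neg h7.symm, if_pos rfl]
  -- The three colours sum to zero in `ZMod 3`, so `-(p + q)` is the colour different from `p` and
  -- `q`.
  have e3 : prism d g c (-(c (b - d) + c b)) x = half g x := by
    unfold prism; rw [← hb, if_neg (key _ _ h7).2, if_neg (key _ _ h7).1]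
  have hs := signedDiff_eq_or x y
  rcases h with h | h | h
  · rw [h] at hs
    rcases hs with hs | hs
    · exact ⟨_, e1.trans (by rw [hs]; ring)⟩
    · exact ⟨_, e2.trans (by rw [hs]; ring)⟩
  · rw [h] at hs
    rcases hs with hs | hs
    · exact ⟨_, e2.trans (by rw [sub_eq_add_neg, hs]; ring)⟩
    · exact ⟨_, e1.trans (by rw [neg_inj.1 hs]; ring)⟩
  · exact ⟨_, e3.trans (half_eq_iff.2 h)⟩

/-- Cut into intervals of length `d` coloured 0 and 1 alternately, and give the last `d` residues
colour 2. Only these wrap around, and they land below `d`, where the colour is 0 because `d < 2 * m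
- d`. -/
theorem exists_colouring {d : ℕ} (hd : 0 < d) (hdm : d < m) :
    ∃ c : ZMod (2 * m) → ZMod 3, ∀ x, c x ≠ c (x + d) := by
  have : NeZero (2 * m) := ⟨by omega⟩
  refine ⟨fun x => if 2 * m - d ≤ x.val then 2 else if x.val / d % 2 = 0 then 0 else 1, fun x => ?_⟩
  have hx := ZMod.val_lt x
  have hv : (x + d).val = (x.val + d) % (2 * m) := by
    rw [ZMod.val_add, ZMod.val_natCast, Nat.mod_eq_of_lt (a := d) (by omega)]
  have h01 : (0 : ZMod 3) ≠ 1 := by decide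
  have h02 : (0 : ZMod 3) ≠ 2 := by decide
  have h12 : (1 : ZMod 3) ≠ 2 := by decide
  simp only [hv]
  by_cases h : 2 * m - d ≤ x.val
  · rw [if_pos h, show (x.val + d) % (2 * m) = x.val + d - 2 * m by
      rw [Nat.mod_eq_sub_mod (by omega), Nat.mod_eq_of_lt (by omega)], if_neg (by omega),
      Nat.div_eq_of_lt (by omega), if_pos rfl]
    exact h02.symm
  · rw [if_neg h, Nat.mod_eq_of_lt (show x.val + d < 2 * m by omega), Nat.add_div_right _ hd]
    split_ifs <;> first | omega | assumption | exact h01.symm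

theorem natCast_ne_neg {a : ℕ} (h0 : 0 < a) (h : a < m) :
    (a : ZMod (2 * m)) ≠ -(a : ZMod (2 * m)) := by
  intro e
  have h2 : ((2 * a : ℕ) : ZMod (2 * m)) = 0 := by
    rw [show 2 * a = a + a by ring, Nat.cast_add]
    exact add_eq_zero_iff_eq_neg.2 e
  rw [ZMod.natCast_eq_zero_iff] at h2
  have := Nat.le_of_dvd (by omega) h2
  omega

end Cyclic

/-! ### Classes of signed differences that split into perfect matchings. -/

section Keys
variable {m : ℕ}

/-- The signed difference of two elements as an integer of least absolute value. -/
def key (x y : ZMod (2 * m)) : ℤ := (signedDiff x y).valMinAbs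

theorem intCast_key (x y : ZMod (2 * m)) : ((key x y : ℤ) : ZMod (2 * m)) = signedDiff x y :=
  ZMod.coe_valMinAbs _

theorem valMinAbs_bounds (hm : 0 < m) (x : ZMod (2 * m)) :
    -(m : ℤ) < x.valMinAbs ∧ x.valMinAbs ≤ m := by
  have : NeZero (2 * m) := ⟨by omega⟩
  have := ZMod.valMinAbs_mem_Ioc x
  rw [Set.mem_Ioc] at this
  push_cast at this
  omega

theorem valMinAbs_intCast {t : ℤ} (h1 : -(m : ℤ) < t) (h2 : t ≤ m) :
    ((t : ZMod (2 * m))).valMinAbs = t := by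
  have : NeZero (2 * m) := ⟨by omega⟩
  rw [ZMod.valMinAbs_spec]
  refine ⟨rfl, ?_⟩
  rw [Set.mem_Ioc]
  push_cast
  omega

theorem intCast_eq_iff {s t : ℤ} (hs1 : -(m : ℤ) < s) (hs2 : s ≤ m) (ht1 : -(m : ℤ) < t)
    (ht2 : t ≤ m) : (s : ZMod (2 * m)) = t ↔ s = t := by
  constructor
  · intro h
    rw [← valMinAbs_intCast hs1 hs2, h, valMinAbs_intCast ht1 ht2]
  · rintro rfl; rfl

theorem eq_intCast_iff {t : ℤ} (h1 : -(m : ℤ) < t) (h2 : t ≤ m) {x : ZMod (2 * m)} :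
    x = t ↔ x.valMinAbs = t := by
  constructor
  · rintro rfl
    exact valMinAbs_intCast h1 h2
  · rintro rfl
    exact (ZMod.coe_valMinAbs x).symm

theorem par_intCast_eq_zero {t : ℤ} : par (t : ZMod (2 * m)) = 0 ↔ t % 2 = 0 := by
  rw [map_intCast, ZMod.intCast_zmod_eq_zero_iff_dvd]
  omega

theorem par_intCast_eq_one {t : ℤ} : par (t : ZMod (2 * m)) = 1 ↔ t % 2 = 1 := by
  have h := par_intCast_eq_zero (m := m) (t := t)
  rcases zmod_two_cases (par (t : ZMod (2 * m))) with e | e <;> rw [e] at h ⊢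
  · have := h.1 rfl
    exact ⟨fun h' => absurd h' (by decide), by omega⟩
  · have : ¬ t % 2 = 0 := fun h' => absurd (h.2 h') (by decide)
    exact ⟨by omega, fun _ => rfl⟩

theorem intCast_ne_neg {t : ℤ} (h0 : 0 < t) (h : t < m) :
    (t : ZMod (2 * m)) ≠ -(t : ZMod (2 * m)) := by
  rw [← Int.cast_neg, Ne, intCast_eq_iff (by omega) (by omega) (by omega) (by omega)]
  omega

/-- The pairs with signed difference in `K` can be partitioned into perfect matchings. -/
def HasMatchings (K : Set (ZMod (2 * m))) : Prop :=
  ∃ (J : Type) (_ : Fintype J) (f : J → ZMod (2 * m) → ZMod (2 * m)),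
    IsSystem f (fun _ _ _ => False) ∧ ∀ x y, (∃ j, f j x = y) ↔ signedDiff x y ∈ K

theorem HasMatchings.iUnion {I : Type} [Fintype I] {K : I → Set (ZMod (2 * m))}
    (h : ∀ i, HasMatchings (K i)) (hd : ∀ i j t, t ∈ K i → t ∈ K j → i = j) :
    HasMatchings (⋃ i, K i) := by
  choose J hJ f hf hK using h
  refine ⟨Σ i, J i, inferInstance, fun s => f s.1 s.2, ⟨?_, ?_, ?_, ?_, ?_, ?_, ?_, ?_⟩, ?_⟩
  · rintro ⟨i, j⟩ x
    exact (hf i).invol j x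
  · rintro ⟨i, j⟩ x
    exact (hf i).ne j x
  · rintro ⟨i, j⟩ ⟨i', j'⟩ x h
    have e := hd i i' _ ((hK i x _).1 ⟨j, rfl⟩) ((hK i' x _).1 ⟨j', h.symm⟩)
    subst e
    rw [(hf i).inj j j' x h]
  · exact fun _ _ _ h => h
  · exact fun _ _ _ h => h
  · exact fun _ _ _ h => h.elim
  · exact fun _ _ _ _ h => h.elim
  · exact fun _ _ _ _ h => h.elim
  · intro x y
    rw [Set.mem_iUnion, Sigma.exists]
    exact exists_congr fun i => hK i x y

theorem hasMatchings_singleton {g : ZMod (2 * m)} (hg : par g = 1) : HasMatchings {g} :=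
  ⟨Unit, inferInstance, _, isSystem_half hg, fun x y => by
    rw [Set.mem_singleton_iff, ← half_eq_iff]
    exact ⟨fun ⟨_, h⟩ => h, fun h => ⟨(), h⟩⟩⟩

theorem hasMatchings_prism {d : ℕ} (h0 : 0 < d) (hd : d < m) (h2 : d % 2 = 0) {g : ZMod (2 * m)}
    (hg : par g = 1) : HasMatchings {(d : ZMod (2 * m)), -(d : ZMod (2 * m)), g} := by
  obtain ⟨c, hc⟩ := exists_colouring h0 hd
  refine ⟨ZMod 3, inferInstance, _, isSystem_prism (par_natCast_eq_zero.2 h2) (natCast_ne_neg h0 hd)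
    hg hc, fun x y => ⟨?_, exists_prism_eq hc⟩⟩
  rintro ⟨i, rfl⟩
  exact signedDiff_prism _ _ _ _ _

theorem natCast_add_self : (m : ZMod (2 * m)) + m = 0 := by
  rw [← Nat.cast_add, ← two_mul]
  exact ZMod.natCast_self _

theorem neg_natCast_self : -(m : ZMod (2 * m)) = m := neg_eq_of_add_eq_zero_left natCast_add_self

theorem natCast_self_ne_zero (hm : 0 < m) : (m : ZMod (2 * m)) ≠ 0 := by
  rw [Ne, ZMod.natCast_eq_zero_iff]
  intro h
  have := Nat.le_of_dvd hm h
  omega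

theorem signedDiff_eq_natCast_self {x y : ZMod (2 * m)} : signedDiff x y = m ↔ x + m = y := by
  unfold signedDiff
  split_ifs
  · rw [sub_eq_iff_eq_add, add_comm, eq_comm]
  · rw [sub_eq_iff_eq_add, add_comm]
    constructor
    · rintro rfl
      rw [add_assoc, natCast_add_self, add_zero]
    · rintro rfl
      rw [add_assoc, natCast_add_self, add_zero]

theorem hasMatchings_natCast_self (hm : 0 < m) : HasMatchings {(m : ZMod (2 * m))} := by
  refine ⟨Unit, inferInstance, fun _ x => x + m, ⟨?_, ?_, ?_, ?_, ?_, ?_, ?_, ?_⟩, ?_⟩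
  · intro _ x
    rw [add_assoc, natCast_add_self, add_zero]
  · intro _ x h
    exact natCast_self_ne_zero hm (by simpa using h)
  · intro _ _ _ _; rfl
  · exact fun _ _ _ h => h
  · exact fun _ _ _ h => h
  · exact fun _ _ _ h => h.elim
  · exact fun _ _ _ _ h => h.elim
  · exact fun _ _ _ _ h => h.elim
  · intro x y
    rw [Set.mem_singleton_iff, signedDiff_eq_natCast_self]
    exact ⟨fun ⟨_, h⟩ => h, fun h => ⟨(), h⟩⟩

/-- The pairs with signed difference in `W` can be partitioned into perfect matchings, if the even
differences can be assigned different odd ones. -/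
theorem exists_matchings (hm : 0 < m) {W : ℤ → Prop} (hW0 : ¬ W 0) {φ : ℤ → ℤ}
    (hsymm : ∀ d : ℤ, d % 2 = 0 → 0 < d → d < m → (W d ↔ W (-d)))
    (hφ : ∀ d : ℤ, d % 2 = 0 → 0 < d → d < m → W d →
      φ d % 2 = 1 ∧ -(m : ℤ) < φ d ∧ φ d ≤ m ∧ W (φ d))
    (hφi : ∀ d d' : ℤ, d % 2 = 0 → 0 < d → d < m → W d → d' % 2 = 0 → 0 < d' → d' < m → W d' →
      φ d = φ d' → d = d') :
    ∃ (J : Type) (_ : Fintype J) (f : J → ZMod (2 * m) → ZMod (2 * m)),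
      IsSystem f (fun _ _ _ => False) ∧ ∀ x y, (∃ j, f j x = y) ↔ W (key x y) := by
  classical
  let ev : ℤ → Prop := fun d => d % 2 = 0 ∧ 0 < d ∧ d < m ∧ W d
  let od : ℤ → Prop := fun g => g % 2 = 1 ∧ W g ∧ ∀ d, ev d → φ d ≠ g
  -- For even `m` the difference `m` needs no odd partner: `x ↦ x + m` is already a perfect
  -- matching.
  let mid : ℤ → Prop := fun t => t = m ∧ t % 2 = 0 ∧ W t
  let I := {t : Finset.Icc (-(m : ℤ)) m // -(m : ℤ) < t.1 ∧ (ev t ∨ od t ∨ mid t)}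
  -- Each even `d` takes `-d` and the odd `φ d` with it into a prism; every other class is a single
  -- difference.
  let K : I → Set ℤ := fun i => if ev i.1 then {i.1.1, -i.1.1, φ i.1} else {i.1.1}
  have hmod : ∀ t : ℤ, t % 2 = 0 → (-t) % 2 = 0 := by intro t h; omega
  have hKb : ∀ i t, t ∈ K i → -(m : ℤ) < t ∧ t ≤ m := by
    rintro ⟨⟨i, hi⟩, hi1, hi2⟩ t ht
    rw [Finset.mem_Icc] at hi
    simp only [K] at ht
    split_ifs at ht with h
    · have := hφ _ h.1 h.2.1 h.2.2.1 h.2.2.2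
      obtain ⟨h1, h2, h3, h4⟩ := h
      rcases ht with rfl | rfl | rfl
      · omega
      · omega
      · exact ⟨this.2.1, this.2.2.1⟩
    · rw [Set.mem_singleton_iff] at ht
      subst ht
      exact ⟨hi1, hi.2⟩
  have hd : ∀ i j t, t ∈ K i → t ∈ K j → i = j := by
    rintro ⟨⟨i, hi⟩, hi1, hi2⟩ ⟨⟨j, hj⟩, hj1, hj2⟩ t hti htj
    have : i = j := by
      simp only [K] at hti htj
      split_ifs at hti htj with h h' h'
      · obtain ⟨a1, a2, a3, a4⟩ := h
        obtain ⟨b1, b2, b3, b4⟩ := h'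
        have A := hφ _ a1 a2 a3 a4
        have B := hφ _ b1 b2 b3 b4
        simp only [Set.mem_insert_iff, Set.mem_singleton_iff] at hti htj
        by_cases ht : t % 2 = 0
        · omega
        · have e1 : t = φ i := by omega
          have e2 : t = φ j := by omega
          exact hφi _ _ a1 a2 a3 a4 b1 b2 b3 b4 (e1.symm.trans e2)
      · have A := hφ _ h.1 h.2.1 h.2.2.1 h.2.2.2
        rw [Set.mem_singleton_iff] at htj
        simp only [Set.mem_insert_iff, Set.mem_singleton_iff] at hti
        obtain ⟨a1, a2, a3, a4⟩ := id h
        rcases hj2 with hj2 | ⟨c1, c2, c3⟩ | ⟨c1, c2, c3⟩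
        · exact absurd hj2 h'
        · have := c3 i h
          simp only at *
          omega
        · simp only at *
          omega
      · have A := hφ _ h'.1 h'.2.1 h'.2.2.1 h'.2.2.2
        rw [Set.mem_singleton_iff] at hti
        simp only [Set.mem_insert_iff, Set.mem_singleton_iff] at htj
        obtain ⟨a1, a2, a3, a4⟩ := id h'
        rcases hi2 with hi2 | ⟨c1, c2, c3⟩ | ⟨c1, c2, c3⟩
        · exact absurd hi2 h
        · have := c3 j h'
          simp only at *
          omega
        · simp only at *
          omega
      · rw [Set.mem_singleton_iff] at hti htj
        exact hti.symm.trans htj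
    subst this
    rfl
  have key' : HasMatchings (⋃ i, (Int.cast '' K i : Set (ZMod (2 * m)))) := by
    refine HasMatchings.iUnion ?_ ?_
    · rintro ⟨⟨i, hi⟩, hi1, hi2⟩
      simp only [K]
      split_ifs with h
      · obtain ⟨a1, a2, a3, a4⟩ := id h
        have A := hφ _ a1 a2 a3 a4
        have := hasMatchings_prism (m := m) (d := i.toNat) (by omega) (by omega) (by omega)
          (par_intCast_eq_one.2 A.1)
        have e : ((i.toNat : ℕ) : ZMod (2 * m)) = (i : ℤ) := by
          conv_rhs => rw [← Int.toNat_of_nonneg a2.le]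
          rw [Int.cast_natCast]
        rw [e] at this
        rw [Set.image_insert_eq, Set.image_insert_eq, Set.image_singleton, Int.cast_neg]
        exact this
      · rw [Set.image_singleton]
        rcases hi2 with hi2 | ⟨c1, c2, c3⟩ | ⟨c1, c2, c3⟩
        · exact absurd hi2 h
        · exact hasMatchings_singleton (par_intCast_eq_one.2 c1)
        · simp only at c1
          rw [c1, Int.cast_natCast]
          exact hasMatchings_natCast_self hm
    · rintro i j _ ⟨t, ht, rfl⟩ ⟨t', ht', e⟩
      have b := hKb i t ht
      have b' := hKb j t' ht'
      rw [intCast_eq_iff b'.1 b'.2 b.1 b.2] at e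
      subst e
      exact hd i j _ ht ht'
  obtain ⟨J, hJ, f, hf, hK⟩ := key'
  refine ⟨J, hJ, f, hf, fun x y => ?_⟩
  rw [hK, Set.mem_iUnion]
  have hb := valMinAbs_bounds hm (signedDiff x y)
  constructor
  · rintro ⟨i, t, ht, e⟩
    have b := hKb i t ht
    have e' : key x y = t := (eq_intCast_iff b.1 b.2).1 e.symm
    rw [e']
    obtain ⟨⟨i, hi⟩, hi1, hi2⟩ := i
    simp only [K] at ht
    split_ifs at ht with h
    · obtain ⟨a1, a2, a3, a4⟩ := h
      have := hφ _ a1 a2 a3 a4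
      rcases ht with rfl | rfl | rfl
      · exact a4
      · exact (hsymm _ a1 a2 a3).1 a4
      · exact this.2.2.2
    · rw [Set.mem_singleton_iff] at ht
      subst ht
      rcases hi2 with hi2 | ⟨c1, c2, c3⟩ | ⟨c1, c2, c3⟩
      exacts [absurd hi2 h, c2, c3]
  · intro h
    obtain ⟨t, ht⟩ : ∃ t, t = key x y := ⟨_, rfl⟩
    have htb : -(m : ℤ) < t ∧ t ≤ m := by rw [ht]; exact hb
    have hs : (t : ZMod (2 * m)) = signedDiff x y := by rw [ht]; exact intCast_key x y
    rw [← ht] at h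
    rw [← hs]
    have hne : t ≠ 0 := by rintro rfl; exact hW0 h
    suffices ∃ i, t ∈ K i from this.imp fun i hi => ⟨t, hi, rfl⟩
    by_cases h2 : t % 2 = 0
    · rcases lt_trichotomy t 0 with h0 | h0 | h0
      · have hev : ev (-t) := ⟨hmod t h2, by omega, by omega, by
          rw [hsymm _ (hmod t h2) (by omega) (by omega), neg_neg]; exact h⟩
        refine ⟨⟨⟨-t, Finset.mem_Icc.2 (by omega)⟩, ?_, Or.inl hev⟩, ?_⟩
        · change -(m : ℤ) < -t
          omega
        · simp only [K]
          rw [if_pos hev]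
          simp
      · exact absurd h0 hne
      · rcases htb.2.lt_or_eq with hlt | heq
        · have hev : ev t := ⟨h2, h0, hlt, h⟩
          refine ⟨⟨⟨t, Finset.mem_Icc.2 (by omega)⟩, htb.1, Or.inl hev⟩, ?_⟩
          simp only [K]
          rw [if_pos hev]
          simp
        · have hev : ¬ ev t := fun h => by have := h.2.2.1; omega
          refine ⟨⟨⟨t, Finset.mem_Icc.2 (by omega)⟩, htb.1, Or.inr (Or.inr ⟨heq, h2, h⟩)⟩, ?_⟩
          simp only [K]
          rw [if_neg hev]
          simp
    · by_cases hi : ∃ d, ev d ∧ φ d = t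
      · obtain ⟨d, hev, hd⟩ := hi
        obtain ⟨a1, a2, a3, a4⟩ := id hev
        refine ⟨⟨⟨d, Finset.mem_Icc.2 (by omega)⟩, ?_, Or.inl hev⟩, ?_⟩
        · change -(m : ℤ) < d
          omega
        · simp only [K]
          rw [if_pos hev, hd]
          simp
      · push Not at hi
        have hev : ¬ ev t := fun h => h2 h.1
        refine ⟨⟨⟨t, Finset.mem_Icc.2 (by omega)⟩, htb.1, Or.inr (Or.inl ⟨show t % 2 = 1 by omega, h, hi⟩)⟩, ?_⟩
        simp only [K]
        rw [if_neg hev]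
        simp

end Keys

/-! ### Assembling a linked gadget, a split gadget and leftover matchings. -/

section Cyclic
variable {m : ℕ}

/-- There is a gadget on the pairs with signed difference in `W`, with `N` pure neighbours of each
point, which is linked as soon as the matching `half β` is; pure pairs satisfy `R`. -/
def HasLinkedGadget (m N : ℕ) (β : ZMod (2 * m)) (W : ℤ → Prop)
    (R : ZMod (2 * m) → ZMod (2 * m) → Prop) : Prop :=
  ∃ (D : Type) (_ : Fintype D) (f₀ f₁ : Option D → ZMod (2 * m) → ZMod (2 * m))
    (L₀ L₁ : ZMod (2 * m) → ZMod (2 * m) → ZMod (2 * m) → Prop),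
    Gadget f₀ f₁ L₀ L₁ ∧ f₀ none = half β ∧
    (∀ P, Closed (fun d => f₀ (some d)) L₀ (fun d => f₁ (some d)) L₁ P →
      (∀ x, P x (half β x)) → ∀ x y, Covers f₀ L₀ x y → P x y) ∧
    (∀ x y, Covers f₀ L₀ x y ↔ W (key x y)) ∧
    (∃ S : Finset (ZMod (2 * m)), S.card = N ∧ ∀ y, y ∈ S ↔ ∃ z, L₀ 0 y z) ∧
    ∀ x y z, L₀ x y z ∨ L₁ x y z → R x y

/-- There is a gadget which, together with the matchings `q`, contains the pairs with signed
difference in `W`, with `N` pure neighbours of each point, and which is linked as soon as its two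
distinguished matchings are; pure pairs satisfy `R`. -/
def HasSplitGadget (m N : ℕ) {p : ℕ} (q : Fin p → ZMod (2 * m) → ZMod (2 * m)) (W : ℤ → Prop)
    (R : ZMod (2 * m) → ZMod (2 * m) → Prop) : Prop :=
  ∃ (D : Type) (_ : Fintype D) (f₀ f₁ : Option D → ZMod (2 * m) → ZMod (2 * m))
    (L₀ L₁ : ZMod (2 * m) → ZMod (2 * m) → ZMod (2 * m) → Prop),
    Gadget f₀ f₁ L₀ L₁ ∧ IsSystem q (fun _ _ _ => False) ∧
    (∀ P, Closed (fun d => f₀ (some d)) L₀ (fun d => f₁ (some d)) L₁ P →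
      (∀ x, P x (f₀ none x)) → (∀ x, P x (f₁ none x)) → ∀ x y, Covers f₀ L₀ x y → P x y) ∧
    (∀ i x, ¬ Covers f₀ L₀ x (q i x)) ∧
    (∀ x y, (Covers f₀ L₀ x y ∨ ∃ i, q i x = y) ↔ W (key x y)) ∧
    (∃ S : Finset (ZMod (2 * m)), S.card = N ∧ ∀ y, y ∈ S ↔ ∃ z, L₀ 0 y z) ∧
    ∀ x y z, L₀ x y z ∨ L₁ x y z → R x y

theorem key_ne_zero {x y : ZMod (2 * m)} (h : x ≠ y) : key x y ≠ 0 := by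
  intro h0
  have := intCast_key x y
  rw [h0, Int.cast_zero] at this
  exact signedDiff_ne_zero h this.symm

theorem IsSystem.exists_fin {Z J : Type} [Fintype J] {p : ℕ} {q : Fin p → Z → Z} {f : J → Z → Z}
    {L : Z → Z → Z → Prop} (h : IsSystem (Sum.elim q f) L) :
    ∃ (n : ℕ) (c : Fin n → Z → Z) (hn : p ≤ n), IsSystem c L ∧
      (∀ i (h : i < p), c ⟨i, h.trans_le hn⟩ = q ⟨i, h⟩) ∧
      ∀ x y, (∃ i, c i x = y) ↔ (∃ i, q i x = y) ∨ ∃ j, f j x = y := by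
  let σ : Fin (p + Fintype.card J) ≃ Fin p ⊕ J :=
    finSumFinEquiv.symm.trans (Equiv.sumCongr (Equiv.refl _) (Fintype.equivFin J).symm)
  refine ⟨p + Fintype.card J, fun i => Sum.elim q f (σ i), Nat.le_add_right _ _,
    h.reindex σ.injective, ?_, ?_⟩
  · intro i hi
    have e : σ ⟨i, by omega⟩ = Sum.inl ⟨i, hi⟩ := by
      rw [← Equiv.eq_symm_apply]
      rfl
    change Sum.elim q f (σ ⟨i, by omega⟩) = _
    rw [e]
    rfl
  · intro x y
    rw [← σ.surjective.exists (p := fun s => Sum.elim q f s x = y), Sum.exists]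
    rfl

/-- Differences in `W` go to the linked gadget, those in `V` to the split gadget and its matchings
`q`, and the rest to matchings through `φ`. The matchings `q` are put first in the chain, so that
`hroot` speaks of one label. `hsymm` is needed because for an even difference the sign of `key`
depends on the order of the two points. -/
theorem exists_tts_of_cyclic {α : Type*} [DecidableEq α] [Infinite α]
    {u : ℕ} {U : Finset α} {T : Finset (Finset α)} (hT : IsTTS U T u)
    (hbip : (blockIntersectionGraph 2 T).IsBipartite)
    (hconn : (blockIntersectionGraph 2 T).Connected) (hm : 0 < m)
    {N M p : ℕ} {β : ZMod (2 * m)} {W V : ℤ → Prop} {R S : ZMod (2 * m) → ZMod (2 * m) → Prop}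
    {q : Fin p → ZMod (2 * m) → ZMod (2 * m)}
    (hE : HasLinkedGadget m N β W R) (hX : HasSplitGadget m M q V S)
    (hWV : ∀ t, t ≠ 0 → W t → ¬ V t) (φ : ℤ → ℤ)
    (hsymm : ∀ d : ℤ, d % 2 = 0 → 0 < d → d < m → (W d ∨ V d ↔ W (-d) ∨ V (-d)))
    (hφ : ∀ d : ℤ, d % 2 = 0 → 0 < d → d < m → ¬ W d → ¬ V d →
      φ d % 2 = 1 ∧ -(m : ℤ) < φ d ∧ φ d ≤ m ∧ ¬ W (φ d) ∧ ¬ V (φ d))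
    (hφi : ∀ d d' : ℤ, d % 2 = 0 → 0 < d → d < m → ¬ W d → ¬ V d → d' % 2 = 0 → 0 < d' →
      d' < m → ¬ W d' → ¬ V d' → φ d = φ d' → d = d')
    (hroot : (∃ h : 0 < p, ConnPair (half β) (q ⟨0, h⟩)) ∨
      ∃ h : 1 < p, ConnPair (q ⟨0, by omega⟩) (q ⟨1, h⟩))
    (hu : u + N + M + 1 = 2 * m)
    (habc : ∃ a b c : ZMod (2 * m), a ≠ b ∧ a ≠ c ∧ b ≠ c ∧
      ¬ R a b ∧ ¬ R a c ∧ ¬ R b c ∧ ¬ S a b ∧ ¬ S a c ∧ ¬ S b c) :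
    ∃ (V : Finset α) (T' : Finset (Finset α)),
      IsTTS V T' (u + 2 * m) ∧ U ⊂ V ∧ T ⊂ T' ∧
      (blockIntersectionGraph 2 T').IsBipartite ∧
      Nat.card (blockIntersectionGraph 2 T').ConnectedComponent = 2 ∧
      ∃ a ∈ V \ U, ∃ b ∈ V \ U, ∃ c ∈ V \ U, a ≠ b ∧ a ≠ c ∧ b ≠ c ∧
        ∀ B ∈ T', Disjoint B U → (B ∩ {a, b, c}).card ≤ 1 := by
  classical
  have : NeZero (2 * m) := ⟨by omega⟩
  obtain ⟨D, _, e₀, e₁, LE₀, LE₁, hE, hβ, hElink, hW, ⟨SE, hSEc, hSE⟩, hR⟩ := hE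
  obtain ⟨E, _, x₀, x₁, LX₀, LX₁, hX, hq, hXlink, hqX, hV, ⟨SX, hSXc, hSX⟩, hS⟩ := hX
  obtain ⟨J, _, f, hf, hfK⟩ := exists_matchings hm (W := fun t => t ≠ 0 ∧ ¬ W t ∧ ¬ V t)
    (φ := φ) (by simp)
    (by
      intro d h1 h2 h3
      have := hsymm d h1 h2 h3
      have : d ≠ 0 := by omega
      simp only [ne_eq, neg_eq_zero]
      tauto)
    (by
      rintro d h1 h2 h3 ⟨_, h4, h5⟩
      obtain ⟨a1, a2, a3, a4, a5⟩ := hφ d h1 h2 h3 h4 h5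
      exact ⟨a1, a2, a3, by omega, a4, a5⟩)
    (by
      rintro d d' h1 h2 h3 ⟨_, h4, h5⟩ h1' h2' h3' ⟨_, h4', h5'⟩
      exact hφi d d' h1 h2 h3 h4 h5 h1' h2' h3' h4' h5')
  have hcq : ∀ x y, Covers q (fun _ _ _ => False) x y ↔ ∃ i, q i x = y := by
    intro x y; simp [Covers]
  have hcf : ∀ x y, Covers f (fun _ _ _ => False) x y ↔ ∃ i, f i x = y := by
    intro x y; simp [Covers]
  have hqf := hq.sumElim hf (by
    intro x y h h'
    rw [hcq] at h
    rw [hcf, hfK] at h'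
    exact h'.2.2 ((hV x y).1 (Or.inr h)))
  have hqf' : IsSystem (Sum.elim q f) fun _ _ _ => False := by simpa using hqf
  obtain ⟨n, c, hn, hc, hcp, hcov⟩ := hqf'.exists_fin
  have hp : 0 < p := by rcases hroot with ⟨h, _⟩ | ⟨h, _⟩ <;> omega
  have hcE : ∀ x y, (∃ i, c i x = y) → ¬ Covers e₀ LE₀ x y := by
    intro x y h hE'
    rw [hW] at hE'
    rcases (hcov x y).1 h with h | h
    · refine hWV _ (key_ne_zero ?_) hE' ((hV x y).1 (Or.inr h))
      obtain ⟨i, rfl⟩ := h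
      exact (hq.ne i x).symm
    · exact ((hfK x y).1 h).2.1 hE'
  have hEX : ∀ x y, Covers e₀ LE₀ x y → ¬ Covers x₀ LX₀ x y := by
    intro x y h h'
    rw [hW] at h
    by_cases hxy : x = y
    · subst hxy
      rcases h' with ⟨j, h'⟩ | ⟨z, h'⟩
      · exact hX.sys₀.ne j x h'
      · exact hX.sys₀.irrefl _ _ _ h' rfl
    · exact hWV _ (key_ne_zero hxy) h ((hV x y).1 (Or.inl h'))
  have hcX : ∀ i x, ¬ Covers x₀ LX₀ x (c i x) := by
    intro i x h
    rcases (hcov x (c i x)).1 ⟨i, rfl⟩ with ⟨j, hj⟩ | hj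
    · rw [← hj] at h
      exact hqX j x h
    · exact ((hfK _ _).1 hj).2.2 ((hV _ _).1 (Or.inl h))
  have htot : ∀ x y, x ≠ y → Covers e₀ LE₀ x y ∨ Covers x₀ LX₀ x y ∨ ∃ i, c i x = y := by
    intro x y hxy
    by_cases h1 : W (key x y)
    · exact Or.inl ((hW x y).2 h1)
    · by_cases h2 : V (key x y)
      · rcases (hV x y).2 h2 with h | h
        · exact Or.inr (Or.inl h)
        · exact Or.inr (Or.inr ((hcov x y).2 (Or.inl h)))
      · exact Or.inr (Or.inr ((hcov x y).2 (Or.inr ((hfK x y).2 ⟨key_ne_zero hxy, h1, h2⟩))))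
  have hn0 : 0 < n := by omega
  have hroot' : ConnPair (e₀ none) (c ⟨0, hn0⟩) ∨
      ∃ (i : ℕ) (h : i + 1 < n), ConnPair (c ⟨i, by omega⟩) (c ⟨i + 1, h⟩) := by
    rw [hβ]
    rcases hroot with ⟨h, hr⟩ | ⟨h, hr⟩
    · left
      rw [hcp 0 h]
      exact hr
    · right
      refine ⟨0, by omega, ?_⟩
      rw [hcp 0 (by omega), hcp (0 + 1) h]
      exact hr
  have hSS : ∀ y, y ∈ SE ∪ SX ↔ ∃ z, LE₀ 0 y z ∨ LX₀ 0 y z := by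
    intro y
    rw [mem_union, hSE, hSX, ← exists_or]
  have hcard : u + (SE ∪ SX).card + 1 = Fintype.card (ZMod (2 * m)) := by
    have hdis : Disjoint SE SX := by
      rw [Finset.disjoint_left]
      intro y h h'
      obtain ⟨z, h⟩ := (hSE y).1 h
      obtain ⟨z', h'⟩ := (hSX y).1 h'
      exact hWV _ (key_ne_zero (hE.sys₀.irrefl _ _ _ h)) ((hW 0 y).1 (Or.inr ⟨z, h⟩))
        ((hV 0 y).1 (Or.inl (Or.inr ⟨z', h'⟩)))
    rw [card_union_of_disjoint hdis, hSEc, hSXc, ZMod.card]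
    omega
  rw [← hβ] at hElink
  have main := exists_tts_of_gadgets hT hbip hconn hE hX hElink hXlink hn0 hc hEX
    (fun i x => hcE x _ ⟨i, rfl⟩) hcX htot hroot' 0 (SE ∪ SX) hSS hcard ?_
  · rw [ZMod.card] at main
    exact main
  · obtain ⟨a, b, c, h1, h2, h3, r1, r2, r3, s1, s2, s3⟩ := habc
    exact ⟨a, b, c, h1, h2, h3, fun z =>
      ⟨fun h => r1 (hR _ _ _ (Or.inl h)), fun h => r2 (hR _ _ _ (Or.inl h)),
       fun h => r3 (hR _ _ _ (Or.inl h)), fun h => r1 (hR _ _ _ (Or.inr h)),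
       fun h => r2 (hR _ _ _ (Or.inr h)), fun h => r3 (hR _ _ _ (Or.inr h)),
       fun h => s1 (hS _ _ _ (Or.inl h)), fun h => s2 (hS _ _ _ (Or.inl h)),
       fun h => s3 (hS _ _ _ (Or.inl h)), fun h => s1 (hS _ _ _ (Or.inr h)),
       fun h => s2 (hS _ _ _ (Or.inr h)), fun h => s3 (hS _ _ _ (Or.inr h))⟩⟩

end Cyclic

/-! ### Systems given by finite tables of steps. -/

section Table
variable {Z G S D K : Type} [AddCommGroup Z] [AddCommGroup G]

/-- The map which translates each element by a step depending on its class. -/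
def tableMap (ρ : Z →+ G) (val : S → Z) (τ : G → S) (x : Z) : Z := x + val (τ (ρ x))

/-- The triples described by a table of pairs of steps. -/
def tableTriple (ρ : Z →+ G) (val : S → Z) (T : G → S → Option S) (x y z : Z) : Prop :=
  ∃ s t, T (ρ x) s = some t ∧ x + val s = y ∧ x + val t = z

/-- A set of steps at each class is reached if it can be obtained in a bounded number of moves. -/
def tableReach (res : S → G) (neg : S → S) (T₀ T₁ : G → S → Option S) (start : G → S → Bool) :
    ℕ → G → S → Bool
  | 0, g, s => start g s
  | n + 1, g, s => tableReach res neg T₀ T₁ start n g s ||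
      tableReach res neg T₀ T₁ start n (g + res s) (neg s) ||
      (T₀ g s).elim false (tableReach res neg T₀ T₁ start n g) ||
      (T₁ g s).elim false (tableReach res neg T₀ T₁ start n g)

variable {ρ : Z →+ G} {val : S → Z} {res : S → G} {neg : S → S} {sub : S → S → S}

/-- What happens at `x` depends only on the class `ρ x`, so the axioms of a system become conditions
on the table. For the tables modulo 6 and 3 most of them are finite checks independent of `m`. -/
theorem isSystem_table (hval : val.Injective) (hres : ∀ s, ρ (val s) = res s)
    (hne : ∀ s, val s ≠ 0) (hneg : ∀ s, val (neg s) = -val s)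
    {τ : D → G → S} {T : G → S → Option S}
    (hsub : ∀ g s t, T g s = some t → val (sub t s) = val t - val s)
    (hτ : ∀ d g, τ d (g + res (τ d g)) = neg (τ d g)) (hτi : ∀ d e g, τ d g = τ e g → d = e)
    (hrot : ∀ g s t, T g s = some t → T g t = some s)
    (hswap : ∀ g s t, T g s = some t → T (g + res s) (neg s) = some (sub t s))
    (hdisj : ∀ d g t, T g (τ d g) ≠ some t) :
    IsSystem (fun d => tableMap ρ val (τ d)) (tableTriple ρ val T) where
  invol d x := by
    unfold tableMap
    rw [map_add, hres, hτ, hneg, add_neg_cancel_right]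
  ne d x h := hne _ (by unfold tableMap at h; exact add_eq_left.1 h)
  inj d e x h := hτi _ _ _ (hval (add_left_cancel h))
  swap := by
    rintro x _ _ ⟨s, t, h, rfl, rfl⟩
    refine ⟨neg s, sub t s, ?_, ?_, ?_⟩
    · rw [map_add, hres]; exact hswap _ _ _ h
    · rw [hneg, add_neg_cancel_right]
    · rw [hsub _ _ _ h]; abel
  rot := by
    rintro x _ _ ⟨s, t, h, rfl, rfl⟩
    exact ⟨t, s, hrot _ _ _ h, rfl, rfl⟩
  irrefl := by
    rintro x _ _ ⟨s, t, h, h1, rfl⟩ rfl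
    exact hne _ (add_eq_left.1 h1)
  uniq := by
    rintro x _ _ _ ⟨s, t, h, rfl, rfl⟩ ⟨s', t', h', h1, rfl⟩
    have := hval (add_left_cancel h1)
    subst this
    rw [h, Option.some.injEq] at h'
    rw [h']
  disj := by
    rintro d x _ _ ⟨s, t, h, rfl, rfl⟩ h1
    have := hval (add_left_cancel h1)
    exact hdisj d _ t (by rw [this]; exact h)

theorem covers_table (hval : val.Injective) {τ : D → G → S} {T : G → S → Option S} {x : Z} {s : S} :
    Covers (fun d => tableMap ρ val (τ d)) (tableTriple ρ val T) x (x + val s) ↔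
      (∃ d, τ d (ρ x) = s) ∨ T (ρ x) s ≠ none := by
  unfold Covers
  refine or_congr (exists_congr fun d => ?_) ?_
  · unfold tableMap
    rw [add_right_inj, hval.eq_iff]
  · rw [Option.ne_none_iff_exists']
    constructor
    · rintro ⟨_, s', t, h, h1, rfl⟩
      have := hval (add_left_cancel h1)
      subst this
      exact ⟨t, h⟩
    · rintro ⟨t, h⟩
      exact ⟨_, s, t, h, rfl, rfl⟩

theorem exists_step_of_covers {τ : D → G → S} {T : G → S → Option S} {x y : Z}
    (h : Covers (fun d => tableMap ρ val (τ d)) (tableTriple ρ val T) x y) :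
    ∃ s, x + val s = y := by
  rcases h with ⟨d, rfl⟩ | ⟨z, s, t, h, rfl, rfl⟩
  · exact ⟨_, rfl⟩
  · exact ⟨s, rfl⟩

theorem gadget_table (hval : val.Injective) {τ₀ τ₁ : Option D → G → S} {T₀ T₁ : G → S → Option S}
    (h₀ : IsSystem (fun d => tableMap ρ val (τ₀ d)) (tableTriple ρ val T₀))
    (h₁ : IsSystem (fun d => tableMap ρ val (τ₁ d)) (tableTriple ρ val T₁))
    (hcov : ∀ g s, ((∃ d, τ₀ d g = s) ∨ T₀ g s ≠ none) ↔ ((∃ d, τ₁ d g = s) ∨ T₁ g s ≠ none))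
    (hne : ∀ d g, τ₀ (some d) g ≠ τ₁ (some d) g)
    (hdisj : ∀ g s, T₀ g s = T₁ g s → T₀ g s = none) :
    Gadget (fun d => tableMap ρ val (τ₀ d)) (fun d => tableMap ρ val (τ₁ d))
      (tableTriple ρ val T₀) (tableTriple ρ val T₁) where
  sys₀ := h₀
  sys₁ := h₁
  cov x y := by
    constructor
    · intro h
      obtain ⟨s, rfl⟩ := exists_step_of_covers h
      rw [covers_table hval] at h ⊢
      exact (hcov _ _).1 h
    · intro h
      obtain ⟨s, rfl⟩ := exists_step_of_covers h
      rw [covers_table hval] at h ⊢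
      exact (hcov _ _).2 h
  ne d x h := hne d _ (hval (add_left_cancel h))
  disj := by
    rintro x _ _ ⟨s, t, h, rfl, rfl⟩ ⟨s', t', h', h1, h2⟩
    have e := hval (add_left_cancel h1)
    have e' := hval (add_left_cancel h2)
    subst e
    subst e'
    have := hdisj _ _ (h.trans h'.symm)
    rw [h] at this
    exact absurd this (Option.some_ne_none _)

/-- `tableReach` imitates the closure rules of `Closed` on (class, step) pairs: reverse a step, or
move to another pair of a triple. The rule `pos` is not needed. -/
theorem link_table (hval : val.Injective) (hres : ∀ s, ρ (val s) = res s)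
    (hneg : ∀ s, val (neg s) = -val s) {τ₀ τ₁ : Option D → G → S} {T₀ T₁ : G → S → Option S}
    (hrot₀ : ∀ g s t, T₀ g s = some t → T₀ g t = some s)
    (hrot₁ : ∀ g s t, T₁ g s = some t → T₁ g t = some s) {start : G → S → Bool}
    (hstart : ∀ g s, start g s = true → s = τ₀ none g ∨ s = τ₁ none g) {n : ℕ}
    (hn : ∀ g s, ((∃ d, τ₀ d g = s) ∨ T₀ g s ≠ none) →
      tableReach res neg T₀ T₁ start n g s = true)
    {P : Z → Z → Prop} (hP : Closed (fun d => tableMap ρ val (τ₀ (some d))) (tableTriple ρ val T₀)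
      (fun d => tableMap ρ val (τ₁ (some d))) (tableTriple ρ val T₁) P)
    (hP₀ : ∀ x, P x (tableMap ρ val (τ₀ none) x)) (hP₁ : ∀ x, P x (tableMap ρ val (τ₁ none) x))
    {x y : Z}
    (hxy : Covers (fun d => tableMap ρ val (τ₀ d)) (tableTriple ρ val T₀) x y) : P x y := by
  have key : ∀ n x s, tableReach res neg T₀ T₁ start n (ρ x) s = true → P x (x + val s) := by
    intro n
    induction n with
    | zero =>
      intro x s h
      rcases hstart _ _ h with rfl | rfl
      · exact hP₀ x
      · exact hP₁ x
    | succ n ih =>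
      intro x s h
      simp only [tableReach, Bool.or_eq_true] at h
      rcases h with ((h | h) | h) | h
      · exact ih x s h
      · have := ih (x + val s) (neg s) (by rw [map_add, hres]; exact h)
        rw [hneg, add_neg_cancel_right] at this
        exact hP.symm _ _ this
      · rcases e : T₀ (ρ x) s with _ | t
        · rw [e] at h; exact absurd h (by simp)
        · rw [e] at h
          exact hP.pure₀ _ _ _ ⟨t, s, hrot₀ _ _ _ e, rfl, rfl⟩ (ih x t h)
      · rcases e : T₁ (ρ x) s with _ | t
        · rw [e] at h; exact absurd h (by simp)
        · rw [e] at h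
          exact hP.pure₁ _ _ _ ⟨t, s, hrot₁ _ _ _ e, rfl, rfl⟩ (ih x t h)
  obtain ⟨s, rfl⟩ := exists_step_of_covers hxy
  rw [covers_table hval] at hxy
  exact key n x s (hn _ _ hxy)

theorem exists_neighbours_table [Fintype S] (hval : val.Injective) {T : G → S → Option S} :
    ∃ A : Finset Z, A.card = (univ.filter fun s => (T 0 s).isSome).card ∧
      ∀ y, y ∈ A ↔ ∃ z, tableTriple ρ val T 0 y z := by
  refine ⟨(univ.filter fun s => (T 0 s).isSome).map ⟨val, hval⟩, card_map _, fun y => ?_⟩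
  simp only [mem_map, mem_filter, mem_univ, true_and, Function.Embedding.coeFn_mk, tableTriple,
    map_zero, zero_add, Option.isSome_iff_exists]
  constructor
  · rintro ⟨s, ⟨t, h⟩, rfl⟩
    exact ⟨_, s, t, h, rfl, rfl⟩
  · rintro ⟨_, s, t, h, rfl, rfl⟩
    exact ⟨s, ⟨t, h⟩, rfl⟩

end Table

/-! ### Split gadgets with zero, two or four pure neighbours at each point. -/

section Split
variable {m : ℕ}

/-- Without triples, `half g` serves as the distinguished matching on both sides and merely ends the
chain; the shift of labels prevents it from meeting itself. -/
theorem hasSplitGadget_zero {c g : ℤ} (hc : c % 2 = 1) (hg : g % 2 = 1) (hcg : c ≠ g)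
    (hc1 : -(m : ℤ) < c) (hc2 : c ≤ m) (hg1 : -(m : ℤ) < g) (hg2 : g ≤ m) :
    HasSplitGadget m 0 (fun _ : Fin 1 => half (c : ZMod (2 * m))) (fun t => t = c ∨ t = g)
      fun _ _ => False := by
  have hs := isSystem_half (par_intCast_eq_one (m := m).2 hg)
  have hs' := isSystem_half (par_intCast_eq_one (m := m).2 hc)
  have hk : ∀ x y : ZMod (2 * m), ∀ t : ℤ, -(m : ℤ) < t → t ≤ m →
      (half (t : ZMod (2 * m)) x = y ↔ key x y = t) := by
    intro x y t h1 h2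
    rw [half_eq_iff, eq_intCast_iff h1 h2]
    rfl
  have hcov : ∀ x y, Covers (fun _ : Option Empty => half (g : ZMod (2 * m)))
      (fun _ _ _ => False) x y ↔ key x y = g := by
    intro x y
    rw [← hk x y g hg1 hg2]
    simp [Covers]
  refine ⟨Empty, inferInstance, fun _ => half g, fun _ => half g, fun _ _ _ => False,
    fun _ _ _ => False, ⟨?_, ?_, ?_, ?_, ?_⟩, ?_, ?_, ?_, ?_, ?_, ?_⟩
  · exact hs.reindex (σ := fun _ : Option Empty => ()) (by rintro (_ | ⟨⟨⟩⟩) (_ | ⟨⟨⟩⟩) _; rfl)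
  · exact hs.reindex (σ := fun _ : Option Empty => ()) (by rintro (_ | ⟨⟨⟩⟩) (_ | ⟨⟨⟩⟩) _; rfl)
  · exact fun _ _ => Iff.rfl
  · rintro ⟨⟩
  · exact fun _ _ _ h => h.elim
  · exact hs'.reindex (σ := fun _ : Fin 1 => ()) fun _ _ _ => Subsingleton.elim _ _
  · rintro P - h - x y (⟨_, rfl⟩ | ⟨_, ⟨⟩⟩)
    exact h x
  · intro _ x h
    rw [hcov, (hk x _ c hc1 hc2).1 rfl] at h
    exact hcg h
  · intro x y
    rw [hcov, or_comm]
    refine or_congr_left ?_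
    rw [← hk x y c hc1 hc2]
    exact ⟨fun ⟨_, h⟩ => h, fun h => ⟨0, h⟩⟩
  · exact ⟨∅, rfl, by simp⟩
  · simp

end Split

/-- The differences of the steps `a, b, c, -a, -b, -c`, for `c = a + b`, within a triple. -/
def hexSub : Fin 6 → Fin 6 → Fin 6 :=
  ![![0, 0, 4, 0, 2, 0], ![0, 0, 3, 2, 0, 0], ![1, 0, 0, 0, 0, 0],
    ![0, 5, 0, 0, 0, 1], ![5, 0, 0, 0, 0, 0], ![0, 0, 0, 4, 3, 0]]

/-- The residues of the steps `a, b, c, -a, -b, -c` modulo 6. -/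
def hexRes : Fin 6 → ZMod 6 := ![1, 4, 5, 5, 2, 1]

/-- The negatives of the steps `a, b, c, -a, -b, -c`. -/
def hexNeg : Fin 6 → Fin 6 := ![3, 4, 5, 0, 1, 2]

/-- The triples `{x, x + a, x + c}` for `x` divisible by 3. -/
def hexT₀ : ZMod 6 → Fin 6 → Option (Fin 6) := fun g => (![
  ![some 2, none, some 0, none, none, none], ![none, some 3, none, some 1, none, none],
  ![none, none, none, none, some 5, some 4], ![some 2, none, some 0, none, none, none],
  ![none, some 3, none, some 1, none, none], ![none, none, none, none, some 5, some 4]] :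
  Fin 6 → Fin 6 → Option (Fin 6)) g

/-- The triples `{x, x + b, x + c}` for `x` congruent to 1 modulo 3. -/
def hexT₁ : ZMod 6 → Fin 6 → Option (Fin 6) := fun g => (![
  ![none, none, none, some 5, none, some 3], ![none, some 2, some 1, none, none, none],
  ![some 4, none, none, none, some 0, none], ![none, none, none, some 5, none, some 3],
  ![none, some 2, some 1, none, none, none], ![some 4, none, none, none, some 0, none]] :
  Fin 6 → Fin 6 → Option (Fin 6)) g

/-- Two matchings which complete `hexT₀`. -/
def hexF₀ : Option Unit → ZMod 6 → Fin 6
  | none => fun g => (![5, 2, 0, 3, 0, 3] : Fin 6 → Fin 6) g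
  | some _ => fun g => (![3, 0, 3, 5, 2, 0] : Fin 6 → Fin 6) g

/-- Two matchings which complete `hexT₁` on the same pairs. -/
def hexF₁ : Option Unit → ZMod 6 → Fin 6
  | none => fun g => (![2, 0, 3, 0, 3, 5] : Fin 6 → Fin 6) g
  | some _ => fun g => (![0, 3, 5, 2, 0, 3] : Fin 6 → Fin 6) g

/-- The matchings of the remaining pairs with difference `a`, `b` or `c`. -/
def hexQ : Fin 2 → ZMod 6 → Fin 6 := fun i g =>
  (![![1, 5, 2, 4, 4, 1], ![4, 4, 1, 1, 5, 2]] : Fin 2 → Fin 6 → Fin 6) i g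

/-- The differences of the steps `a, b, c, -a, -b, -c, m`, for `c = a + b`, within a triple. -/
def heptSub : Fin 7 → Fin 7 → Fin 7 :=
  ![![0, 0, 4, 0, 2, 0, 0], ![0, 0, 3, 2, 0, 0, 0], ![1, 0, 0, 0, 0, 0, 0],
    ![0, 5, 0, 0, 0, 1, 0], ![5, 0, 0, 0, 0, 0, 0], ![0, 0, 0, 4, 3, 0, 0], ![0, 0, 0, 0, 0, 0, 0]]

/-- The residues of the steps modulo 3. -/
def heptRes : Fin 7 → ZMod 3 := ![1, 1, 2, 2, 2, 1, 0]

/-- The negatives of the steps `a, b, c, -a, -b, -c, m`. -/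
def heptNeg : Fin 7 → Fin 7 := ![3, 4, 5, 0, 1, 2, 6]

/-- The triples `{x, x + a, x + c}` for `x` congruent to 0 or 1 modulo 3. -/
def heptT₀ : ZMod 3 → Fin 7 → Option (Fin 7) := fun g => (![
  ![some 2, none, some 0, none, some 5, some 4, none],
  ![some 2, some 3, some 0, some 1, none, none, none],
  ![none, some 3, none, some 1, some 5, some 4, none]] : Fin 3 → Fin 7 → Option (Fin 7)) g

/-- The triples `{x, x + b, x + c}` for `x` congruent to 1 or 2 modulo 3. -/
def heptT₁ : ZMod 3 → Fin 7 → Option (Fin 7) := fun g => (![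
  ![some 4, none, none, some 5, some 0, some 3, none],
  ![none, some 2, some 1, some 5, none, some 3, none],
  ![some 4, some 2, some 1, none, some 0, none, none]] : Fin 3 → Fin 7 → Option (Fin 7)) g

/-- Two matchings which complete `heptT₀`. -/
def heptF₀ : Option Unit → ZMod 3 → Fin 7
  | none => fun g => (![6, 5, 2] : Fin 3 → Fin 7) g
  | some _ => fun g => (![3, 6, 0] : Fin 3 → Fin 7) g

/-- Two matchings which complete `heptT₁` on the same pairs. -/
def heptF₁ : Option Unit → ZMod 3 → Fin 7
  | none => fun g => (![2, 6, 5] : Fin 3 → Fin 7) g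
  | some _ => fun g => (![6, 0, 3] : Fin 3 → Fin 7) g

/-- The matching of the remaining pairs. -/
def heptQ : Unit → ZMod 3 → Fin 7 := fun _ g => (![1, 4, 6] : Fin 3 → Fin 7) g

section Split
variable {m : ℕ}

theorem key_eq_or {x y : ZMod (2 * m)} {t : ℤ} (h1 : -(m : ℤ) < t) (h2 : t < m)
    (h : x + (t : ZMod (2 * m)) = y) : key x y = t ∨ key x y = -t := by
  have hs := signedDiff_eq_or x y
  rw [← h, add_sub_cancel_left] at hs
  unfold key
  rw [← h, ← eq_intCast_iff (by omega) (by omega), ← eq_intCast_iff (by omega) (by omega)]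
  push_cast
  exact hs

theorem eq_add_or_of_key {x y : ZMod (2 * m)} {t : ℤ} (h : key x y = t) :
    x + (t : ZMod (2 * m)) = y ∨ x + ((-t : ℤ) : ZMod (2 * m)) = y := by
  subst h
  push_cast
  rw [intCast_key]
  rcases signedDiff_eq_or x y with h | h <;> rw [h]
  · left; ring
  · right; ring

/-- Here `Y` is a set which every orbit of the two matchings meets; following them leads from `x` in
`Y` to `x + d`, and any two points of `Y` differ by a multiple of `d`. -/
theorem connPair_of_cycle {f g : ZMod (2 * m) → ZMod (2 * m)} (hf : ∀ x, f (f x) = x)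
    (hg : ∀ x, g (g x) = x) (hm : 0 < m) (Y : Set (ZMod (2 * m))) {d : ℤ}
    (hY : ∀ x ∈ Y, ∀ y ∈ Y, ∃ k : ℤ, y = x + (k * d : ℤ))
    (hstep : ∀ Q : ZMod (2 * m) → Prop, (∀ x, Q x → Q (f x)) → (∀ x, Q x → Q (g x)) →
      ∀ x ∈ Y, Q x → Q (x + d))
    (hall : ∀ Q : ZMod (2 * m) → Prop, (∀ x, Q x ↔ Q (f x)) → (∀ x, Q x ↔ Q (g x)) →
      ∀ x, ∃ y ∈ Y, Q y ↔ Q x)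
    (hYd : ∀ x ∈ Y, x + d ∈ Y) : ConnPair f g := by
  have : NeZero (2 * m) := ⟨by omega⟩
  intro Q h1 h2 x y hx
  have h1' : ∀ x, Q x ↔ Q (f x) := fun x => ⟨h1 x, fun h => by rw [← hf x]; exact h1 _ h⟩
  have h2' : ∀ x, Q x ↔ Q (g x) := fun x => ⟨h2 x, fun h => by rw [← hg x]; exact h2 _ h⟩
  obtain ⟨x', hx', ex⟩ := hall Q h1' h2' x
  obtain ⟨y', hy', ey⟩ := hall Q h1' h2' y
  rw [← ey]
  have hQ : ∀ n : ℕ, x' + ((n * d : ℤ) : ZMod (2 * m)) ∈ Y ∧ Q (x' + ((n * d : ℤ) : ZMod (2 * m))) := by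
    intro n
    induction n with
    | zero => simpa using ⟨hx', ex.2 hx⟩
    | succ n ih =>
      have e : x' + (((n + 1 : ℕ) * d : ℤ) : ZMod (2 * m)) =
          x' + ((n * d : ℤ) : ZMod (2 * m)) + d := by push_cast; ring
      rw [e]
      exact ⟨hYd _ ih.1, hstep Q h1 h2 _ ih.1 ih.2⟩
  obtain ⟨k, hk⟩ := hY x' hx' y' hy'
  -- A possibly negative multiplier is replaced by its residue modulo `2 * m`, as only nonnegative
  -- numbers of steps were taken.
  have := (hQ ((k : ZMod (2 * m)).val)).2
  have e : ((((k : ZMod (2 * m)).val * d : ℤ)) : ZMod (2 * m)) = ((k * d : ℤ) : ZMod (2 * m)) := by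
    push_cast
    rw [ZMod.natCast_zmod_val]
  rw [e, ← hk] at this
  exact this

/-- The residue class modulo a divisor of `2 * m`. -/
def residue {n : ℕ} (h : n ∣ 2 * m) : ZMod (2 * m) →+* ZMod n := ZMod.castHom h (ZMod n)

theorem residue_intCast {n : ℕ} (h : n ∣ 2 * m) {t : ℤ} {r : ℕ} (ht : t % n = r) :
    residue h (t : ZMod (2 * m)) = r := by
  rw [map_intCast, ← Int.cast_natCast, ZMod.intCast_eq_intCast_iff, Int.ModEq, ← ht, Int.emod_emod]

/-- The differences `a`, `b`, `a + b` give degree 6: two neighbours in triples, two matchings of the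
gadget and two common matchings `q`. The congruences fix the residues of the steps modulo 6, so that
the table applies. The three exclusions at the end are edges that lie in matchings on both sides;
they serve to choose `a, b, c` in the theorem. -/
theorem hasSplitGadget_one {a b : ℤ} (h6 : 6 ∣ 2 * m) (hm : 0 < m) (ha : a % 6 = 1) (hb : b % 6 = 4)
    (ha1 : -(m : ℤ) < a) (ha2 : a < m) (hb1 : -(m : ℤ) < b) (hb2 : b < m)
    (hc1 : -(m : ℤ) < a + b) (hc2 : a + b < m) (hac : 2 * a + b ≠ 0)
    {e : ℤ} (he : e = 3 ∨ e = -3) (hba : ((b - a : ℤ) : ZMod (2 * m)) = e) :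
    ∃ q : Fin 2 → ZMod (2 * m) → ZMod (2 * m), ConnPair (q 0) (q 1) ∧
      HasSplitGadget m 2 q
        (fun t => t = a ∨ t = b ∨ t = a + b ∨ t = -a ∨ t = -b ∨ t = -(a + b))
        fun x y => (∃ t : ℤ, x + (t : ZMod (2 * m)) = y ∧
          (t = a ∨ t = b ∨ t = a + b ∨ t = -a ∨ t = -b ∨ t = -(a + b))) ∧
          ¬ (y = x + (b : ZMod (2 * m)) ∧ residue h6 x = 0) ∧
          ¬ (y = x + (a : ZMod (2 * m)) ∧ residue h6 x = 1) ∧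
          ¬ (y = x + ((a + b : ℤ) : ZMod (2 * m)) ∧ residue h6 x = 2) := by
  let w : Fin 6 → ℤ := ![a, b, a + b, -a, -b, -(a + b)]
  let val : Fin 6 → ZMod (2 * m) := fun s => (w s : ℤ)
  let ρ : ZMod (2 * m) →+ ZMod 6 := (residue h6).toAddMonoidHom
  have hwb : ∀ s, -(m : ℤ) < w s ∧ w s < m := by
    intro s
    fin_cases s <;> simp [w] <;> omega
  have hw : ∀ s t, w s = w t → s = t := by
    intro s t
    fin_cases s <;> fin_cases t <;> simp [w] <;> omega
  have hval : val.Injective := fun s t h => hw s t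
    ((intCast_eq_iff (hwb s).1 (hwb s).2.le (hwb t).1 (hwb t).2.le).1 h)
  have hres : ∀ s, ρ (val s) = hexRes s := by
    intro s
    fin_cases s
    · exact residue_intCast h6 (r := 1) ha
    · exact residue_intCast h6 (r := 4) hb
    · exact residue_intCast h6 (r := 5) (by simp [w]; omega)
    · exact residue_intCast h6 (r := 5) (by simp [w]; omega)
    · exact residue_intCast h6 (r := 2) (by simp [w]; omega)
    · exact residue_intCast h6 (r := 1) (by simp [w]; omega)
  have hw0 : ∀ s, w s ≠ 0 := by
    intro s
    fin_cases s <;> simp [w] <;> omega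
  have hne : ∀ s, val s ≠ 0 := by
    intro s h
    have := (intCast_eq_iff (m := m) (hwb s).1 (hwb s).2.le (t := 0) (by omega) (by omega)).1
      (by rw [Int.cast_zero]; exact h)
    exact hw0 s this
  have hneg : ∀ s, val (hexNeg s) = -val s := by
    intro s
    simp only [val]
    rw [← Int.cast_neg]
    congr 1
    fin_cases s <;> simp [w, hexNeg]
  have hsub₀ : ∀ g s t, hexT₀ g s = some t → val (hexSub t s) = val t - val s := by
    have key : ∀ g s t, hexT₀ g s = some t → w (hexSub t s) = w t - w s := by
      have h : ∀ g s t, hexT₀ g s = some t → (s = 0 ∧ t = 2) ∨ (s = 2 ∧ t = 0) ∨ (s = 1 ∧ t = 3) ∨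
        (s = 3 ∧ t = 1) ∨ (s = 4 ∧ t = 5) ∨ (s = 5 ∧ t = 4) := by decide
      intro g s t hT
      rcases h g s t hT with ⟨rfl, rfl⟩ | ⟨rfl, rfl⟩ | ⟨rfl, rfl⟩ | ⟨rfl, rfl⟩ | ⟨rfl, rfl⟩ |
        ⟨rfl, rfl⟩ <;> (simp [w, hexSub]; try ring)
    intro g s t hT
    simp only [val]
    rw [← Int.cast_sub, key g s t hT]
  have hsub₁ : ∀ g s t, hexT₁ g s = some t → val (hexSub t s) = val t - val s := by
    have key : ∀ g s t, hexT₁ g s = some t → w (hexSub t s) = w t - w s := by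
      have h : ∀ g s t, hexT₁ g s = some t → (s = 1 ∧ t = 2) ∨ (s = 2 ∧ t = 1) ∨ (s = 0 ∧ t = 4) ∨
        (s = 4 ∧ t = 0) ∨ (s = 3 ∧ t = 5) ∨ (s = 5 ∧ t = 3) := by decide
      intro g s t hT
      rcases h g s t hT with ⟨rfl, rfl⟩ | ⟨rfl, rfl⟩ | ⟨rfl, rfl⟩ | ⟨rfl, rfl⟩ | ⟨rfl, rfl⟩ |
        ⟨rfl, rfl⟩ <;> (simp [w, hexSub]; try ring)
    intro g s t hT
    simp only [val]
    rw [← Int.cast_sub, key g s t hT]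
  have sys₀ : IsSystem (fun d => tableMap ρ val (hexF₀ d)) (tableTriple ρ val hexT₀) :=
    isSystem_table hval hres hne hneg hsub₀ (by decide) (by decide) (by decide) (by decide)
      (by decide)
  have sys₁ : IsSystem (fun d => tableMap ρ val (hexF₁ d)) (tableTriple ρ val hexT₁) :=
    isSystem_table hval hres hne hneg hsub₁ (by decide) (by decide) (by decide) (by decide)
      (by decide)
  have sysq : IsSystem (fun d => tableMap ρ val (hexQ d)) (tableTriple ρ val fun _ _ => none) :=
    isSystem_table (sub := hexSub) hval hres hne hneg (by simp) (by decide) (by decide) (by simp)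
      (by simp) (by simp)
  have hnone : tableTriple ρ val (fun _ _ => none) = fun _ _ _ => False := by
    funext x y z
    simp [tableTriple]
  refine ⟨fun i => tableMap ρ val (hexQ i), ?_, Unit, inferInstance, _, _, _, _,
    gadget_table hval sys₀ sys₁ (by decide) (by decide) (by decide), ?_, ?_, ?_, ?_, ?_, ?_⟩
  · have hstep : ∀ i x g, ρ x = g → tableMap ρ val (hexQ i) x = x + val (hexQ i g) ∧
        ρ (tableMap ρ val (hexQ i) x) = g + hexRes (hexQ i g) := by
      rintro i x _ rfl
      refine ⟨rfl, ?_⟩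
      unfold tableMap
      rw [map_add, hres]
    -- Six alternating steps visit all residues modulo 6 once and return to residue 0 after a
    -- translation by `2 * e = 6` or `-6`, which generates that residue class.
    refine connPair_of_cycle (sysq.invol 0) (sysq.invol 1) hm {x | ρ x = 0} (d := 2 * e) ?_ ?_ ?_ ?_
    · intro x hx y hy
      have h0 : residue h6 (((y - x).valMinAbs : ℤ) : ZMod (2 * m)) = 0 := by
        rw [ZMod.coe_valMinAbs, map_sub]
        change ρ y - ρ x = 0
        rw [hx, hy, sub_zero]
      rw [map_intCast, ZMod.intCast_zmod_eq_zero_iff_dvd] at h0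
      obtain ⟨k, hk⟩ := h0
      have e1 : y = x + (((y - x).valMinAbs : ℤ) : ZMod (2 * m)) := by
        rw [ZMod.coe_valMinAbs]; ring
      rcases he with rfl | rfl
      · exact ⟨k, by rw [show k * (2 * 3) = (6 : ℕ) * k by push_cast; ring, ← hk]; exact e1⟩
      · exact ⟨-k, by rw [show -k * (2 * -3) = (6 : ℕ) * k by push_cast; ring, ← hk]; exact e1⟩
    · intro Q h0 h1 x hx hQ
      beta_reduce at h0 h1
      obtain ⟨e0, r0⟩ := hstep 0 x 0 hx
      obtain ⟨e1, r1⟩ := hstep 1 _ _ r0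
      obtain ⟨e2, r2⟩ := hstep 0 _ _ r1
      obtain ⟨e3, r3⟩ := hstep 1 _ _ r2
      obtain ⟨e4, r4⟩ := hstep 0 _ _ r3
      obtain ⟨e5, r5⟩ := hstep 1 _ _ r4
      have := h1 _ (h0 _ (h1 _ (h0 _ (h1 _ (h0 _ hQ)))))
      rw [e5, e4, e3, e2, e1, e0] at this
      -- The six steps are four times `b` and twice `-(a + b)`, in total `2 * (b - a)`.
      have E : x + ((2 * e : ℤ) : ZMod (2 * m)) =
          x + val 1 + val 5 + val 1 + val 1 + val 5 + val 1 := by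
        rw [Int.cast_mul, ← hba]
        simp only [val, w]
        simp
        ring
      rw [E]
      exact this
    · intro Q h0 h1
      have c0 : ∀ x, ρ x = 0 → ∃ y, ρ y = 0 ∧ (Q y ↔ Q x) := fun x hx => ⟨x, hx, Iff.rfl⟩
      have c4 : ∀ x, ρ x = 4 → ∃ y, ρ y = 0 ∧ (Q y ↔ Q x) := fun x hx =>
        (c0 _ (hstep 0 x 4 hx).2).imp fun y hy => ⟨hy.1, hy.2.trans (h0 x).symm⟩
      have c2 : ∀ x, ρ x = 2 → ∃ y, ρ y = 0 ∧ (Q y ↔ Q x) := fun x hx =>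
        (c0 _ (hstep 1 x 2 hx).2).imp fun y hy => ⟨hy.1, hy.2.trans (h1 x).symm⟩
      have c5 : ∀ x, ρ x = 5 → ∃ y, ρ y = 0 ∧ (Q y ↔ Q x) := fun x hx =>
        (c4 _ (hstep 1 x 5 hx).2).imp fun y hy => ⟨hy.1, hy.2.trans (h1 x).symm⟩
      have c3 : ∀ x, ρ x = 3 → ∃ y, ρ y = 0 ∧ (Q y ↔ Q x) := fun x hx =>
        (c5 _ (hstep 0 x 3 hx).2).imp fun y hy => ⟨hy.1, hy.2.trans (h0 x).symm⟩
      have c1 : ∀ x, ρ x = 1 → ∃ y, ρ y = 0 ∧ (Q y ↔ Q x) := fun x hx =>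
        (c2 _ (hstep 0 x 1 hx).2).imp fun y hy => ⟨hy.1, hy.2.trans (h0 x).symm⟩
      intro x
      have hx : ∀ g : ZMod 6, g = 0 ∨ g = 1 ∨ g = 2 ∨ g = 3 ∨ g = 4 ∨ g = 5 := by decide
      rcases hx (ρ x) with h | h | h | h | h | h
      exacts [c0 x h, c1 x h, c2 x h, c3 x h, c4 x h, c5 x h]
    · intro x hx
      have : ρ ((2 * e : ℤ) : ZMod (2 * m)) = (0 : ℕ) := residue_intCast h6 (by omega)
      change ρ x = 0 at hx
      change ρ _ = 0
      rw [map_add, hx, this, Nat.cast_zero, add_zero]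
  · rw [← hnone]; exact sysq
  · intro P hP hP₀ hP₁ x y hxy
    exact link_table (start := fun g s => decide (s = hexF₀ none g ∨ s = hexF₁ none g)) (n := 2)
      hval hres hneg (by decide) (by decide) (by simp) (by decide) hP hP₀ hP₁ hxy
  · intro i x h
    have hd : ∀ i g, ¬ ((∃ d, hexF₀ d g = hexQ i g) ∨ hexT₀ g (hexQ i g) ≠ none) := by decide
    exact hd _ _ ((covers_table hval).1 h)
  · intro x y
    constructor
    · intro h
      have : ∃ s, x + val s = y := by
        rcases h with h | ⟨i, rfl⟩
        · exact exists_step_of_covers h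
        · exact ⟨_, rfl⟩
      obtain ⟨s, hs⟩ := this
      have := key_eq_or (hwb s).1 (hwb s).2 hs
      revert this
      fin_cases s <;> simp [w] <;> omega
    · intro h
      have : ∃ s, x + val s = y := by
        rcases h with h | h | h | h | h | h
        · rcases eq_add_or_of_key h with h | h
          exacts [⟨0, h⟩, ⟨3, h⟩]
        · rcases eq_add_or_of_key h with h | h
          exacts [⟨1, h⟩, ⟨4, h⟩]
        · rcases eq_add_or_of_key h with h | h
          exacts [⟨2, h⟩, ⟨5, h⟩]
        · rcases eq_add_or_of_key h with h | h
          exacts [⟨3, h⟩, ⟨0, by rw [neg_neg] at h; exact h⟩]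
        · rcases eq_add_or_of_key h with h | h
          exacts [⟨4, h⟩, ⟨1, by rw [neg_neg] at h; exact h⟩]
        · rcases eq_add_or_of_key h with h | h
          exacts [⟨5, h⟩, ⟨2, by rw [neg_neg] at h; exact h⟩]
      obtain ⟨s, rfl⟩ := this
      rw [covers_table hval]
      have h : ∀ g s, ((∃ d, hexF₀ d g = s) ∨ hexT₀ g s ≠ none) ∨ ∃ i, hexQ i g = s := by decide
      refine (h (ρ x) s).imp id ?_
      rintro ⟨i, hi⟩
      exact ⟨i, by rw [← hi]; rfl⟩
  · obtain ⟨A, hA, hA'⟩ := exists_neighbours_table (ρ := ρ) hval (T := hexT₀)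
    exact ⟨A, hA.trans (by decide), hA'⟩
  · have h : ∀ x y z, tableTriple ρ val hexT₀ x y z ∨ tableTriple ρ val hexT₁ x y z →
        ∃ s, x + val s = y ∧ (hexT₀ (ρ x) s ≠ none ∨ hexT₁ (ρ x) s ≠ none) := by
      rintro x y z (⟨s, t, h, rfl, rfl⟩ | ⟨s, t, h, rfl, rfl⟩)
      · exact ⟨s, rfl, Or.inl (by rw [h]; exact Option.some_ne_none _)⟩
      · exact ⟨s, rfl, Or.inr (by rw [h]; exact Option.some_ne_none _)⟩
    have hT : ∀ g, (hexT₀ g 1 ≠ none ∨ hexT₁ g 1 ≠ none → g ≠ 0) ∧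
      (hexT₀ g 0 ≠ none ∨ hexT₁ g 0 ≠ none → g ≠ 1) ∧
      (hexT₀ g 2 ≠ none ∨ hexT₁ g 2 ≠ none → g ≠ 2) := by decide
    intro x y z H
    obtain ⟨s, rfl, hs⟩ := h x y z H
    refine ⟨⟨w s, rfl, ?_⟩, ?_, ?_, ?_⟩
    · fin_cases s <;> simp [w]
    · rintro ⟨h1, h2⟩
      have := hval (a₂ := 1) (add_left_cancel h1)
      subst this
      exact (hT _).1 hs h2
    · rintro ⟨h1, h2⟩
      have := hval (a₂ := 0) (add_left_cancel h1)
      subst this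
      exact (hT _).2.1 hs h2
    · rintro ⟨h1, h2⟩
      have := hval (a₂ := 2) (add_left_cancel h1)
      subst this
      exact (hT _).2.2 hs h2

end Split

section Split
variable {m : ℕ}

/-- The differences `a`, `b`, `a + b` and `m` give degree 7: four neighbours in triples, two
matchings of the gadget and one common matching. The extra matching `half c` stands first in the
chain, where it can form a connected union with the distinguished matching of the linked gadget. -/
theorem hasSplitGadget_two {a b c : ℤ} (h3 : 3 ∣ 2 * m) (hm : 0 < m) (ha : a % 3 = 1)
    (hb : b % 3 = 1) (ha1 : -(m : ℤ) < a) (ha2 : a < m) (hb1 : -(m : ℤ) < b) (hb2 : b < m)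
    (hc1 : -(m : ℤ) < a + b) (hc2 : a + b < m) (hab : a ≠ b) (hac : 2 * a + b ≠ 0)
    (hbc : a + 2 * b ≠ 0) (hodd : c % 2 = 1) (hc01 : -(m : ℤ) < c) (hc02 : c ≤ m) (hca : c ≠ a)
    (hcb : c ≠ b) (hcc : c ≠ a + b) (hca' : c ≠ -a) (hcb' : c ≠ -b) (hcc' : c ≠ -(a + b))
    (hcm : c ≠ m) :
    ∃ q : ZMod (2 * m) → ZMod (2 * m), HasSplitGadget m 4
        (fun i : Fin 2 => Sum.elim (fun _ : Unit => half (c : ZMod (2 * m))) (fun _ : Unit => q)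
          ((![Sum.inl (), Sum.inr ()] : Fin 2 → Unit ⊕ Unit) i))
        (fun t => t = a ∨ t = b ∨ t = a + b ∨ t = -a ∨ t = -b ∨ t = -(a + b) ∨ t = m ∨ t = c)
        fun x y => (∃ t : ℤ, x + (t : ZMod (2 * m)) = y ∧
          (t = a ∨ t = b ∨ t = a + b ∨ t = -a ∨ t = -b ∨ t = -(a + b))) ∧
          ¬ (y = x + (b : ZMod (2 * m)) ∧ residue h3 x = 0) := by
  let w : Fin 7 → ℤ := ![a, b, a + b, -a, -b, -(a + b), m]
  let val : Fin 7 → ZMod (2 * m) := fun s => (w s : ℤ)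
  let ρ : ZMod (2 * m) →+ ZMod 3 := (residue h3).toAddMonoidHom
  have hwb : ∀ s, -(m : ℤ) < w s ∧ w s ≤ m := by
    intro s
    fin_cases s <;> simp [w] <;> omega
  have hw : ∀ s t, w s = w t → s = t := by
    intro s t
    fin_cases s <;> fin_cases t <;> simp [w] <;> omega
  have hval : val.Injective := fun s t h => hw s t
    ((intCast_eq_iff (hwb s).1 (hwb s).2 (hwb t).1 (hwb t).2).1 h)
  have hres : ∀ s, ρ (val s) = heptRes s := by
    intro s
    fin_cases s
    · exact residue_intCast h3 (r := 1) ha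
    · exact residue_intCast h3 (r := 1) hb
    · exact residue_intCast h3 (r := 2) (by simp [w]; omega)
    · exact residue_intCast h3 (r := 2) (by simp [w]; omega)
    · exact residue_intCast h3 (r := 2) (by simp [w]; omega)
    · exact residue_intCast h3 (r := 1) (by simp [w]; omega)
    · exact residue_intCast h3 (r := 0) (by simp [w]; omega)
  have hw0 : ∀ s, w s ≠ 0 := by
    intro s
    fin_cases s <;> simp [w] <;> omega
  have hne : ∀ s, val s ≠ 0 := by
    intro s h
    have := (intCast_eq_iff (m := m) (hwb s).1 (hwb s).2 (t := 0) (by omega) (by omega)).1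
      (by rw [Int.cast_zero]; exact h)
    exact hw0 s this
  have hneg : ∀ s, val (heptNeg s) = -val s := by
    intro s
    simp only [val]
    fin_cases s <;> simp [w, heptNeg, neg_natCast_self]
  have hsub₀ : ∀ g s t, heptT₀ g s = some t → val (heptSub t s) = val t - val s := by
    have key : ∀ g s t, heptT₀ g s = some t → w (heptSub t s) = w t - w s := by
      have h : ∀ g s t, heptT₀ g s = some t → (s = 0 ∧ t = 2) ∨ (s = 2 ∧ t = 0) ∨ (s = 1 ∧ t = 3) ∨
        (s = 3 ∧ t = 1) ∨ (s = 4 ∧ t = 5) ∨ (s = 5 ∧ t = 4) := by decide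
      intro g s t hT
      rcases h g s t hT with ⟨rfl, rfl⟩ | ⟨rfl, rfl⟩ | ⟨rfl, rfl⟩ | ⟨rfl, rfl⟩ | ⟨rfl, rfl⟩ |
        ⟨rfl, rfl⟩ <;> (simp [w, heptSub]; try ring)
    intro g s t hT
    simp only [val]
    rw [← Int.cast_sub, key g s t hT]
  have hsub₁ : ∀ g s t, heptT₁ g s = some t → val (heptSub t s) = val t - val s := by
    have key : ∀ g s t, heptT₁ g s = some t → w (heptSub t s) = w t - w s := by
      have h : ∀ g s t, heptT₁ g s = some t → (s = 1 ∧ t = 2) ∨ (s = 2 ∧ t = 1) ∨ (s = 0 ∧ t = 4) ∨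
        (s = 4 ∧ t = 0) ∨ (s = 3 ∧ t = 5) ∨ (s = 5 ∧ t = 3) := by decide
      intro g s t hT
      rcases h g s t hT with ⟨rfl, rfl⟩ | ⟨rfl, rfl⟩ | ⟨rfl, rfl⟩ | ⟨rfl, rfl⟩ | ⟨rfl, rfl⟩ |
        ⟨rfl, rfl⟩ <;> (simp [w, heptSub]; try ring)
    intro g s t hT
    simp only [val]
    rw [← Int.cast_sub, key g s t hT]
  have sys₀ : IsSystem (fun d => tableMap ρ val (heptF₀ d)) (tableTriple ρ val heptT₀) :=
    isSystem_table hval hres hne hneg hsub₀ (by decide) (by decide) (by decide) (by decide)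
      (by decide)
  have sys₁ : IsSystem (fun d => tableMap ρ val (heptF₁ d)) (tableTriple ρ val heptT₁) :=
    isSystem_table hval hres hne hneg hsub₁ (by decide) (by decide) (by decide) (by decide)
      (by decide)
  have sysq : IsSystem (fun d => tableMap ρ val (heptQ d)) (tableTriple ρ val fun _ _ => none) :=
    isSystem_table (sub := heptSub) hval hres hne hneg (by simp) (by decide) (by decide) (by simp)
      (by simp) (by simp)
  have hw7 : ∀ s, w s = a ∨ w s = b ∨ w s = a + b ∨ w s = -a ∨ w s = -b ∨ w s = -(a + b) ∨
      w s = m := by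
    intro s
    fin_cases s <;> simp [w]
  have hkey : ∀ {x y : ZMod (2 * m)} {s}, x + val s = y → key x y = a ∨ key x y = b ∨
      key x y = a + b ∨ key x y = -a ∨ key x y = -b ∨ key x y = -(a + b) ∨ key x y = m := by
    intro x y s h
    have h1 := hw7 s
    rcases (hwb s).2.lt_or_eq with h2 | h2
    · have := key_eq_or (hwb s).1 h2 h
      omega
    · have : key x y = m := by
        unfold key
        rw [← eq_intCast_iff (by omega) le_rfl, Int.cast_natCast, signedDiff_eq_natCast_self]
        simp only [val] at h
        rw [h2, Int.cast_natCast] at h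
        exact h
      omega
  have hcq : ∀ x y, half (c : ZMod (2 * m)) x = y ↔ key x y = c := by
    intro x y
    rw [half_eq_iff, eq_intCast_iff hc01 hc02]
    rfl
  have sysc := (isSystem_half (par_intCast_eq_one (m := m).2 hodd)).sumElim sysq (by
    intro x y h h'
    obtain ⟨s, hs⟩ := exists_step_of_covers h'
    have := hkey hs
    rcases h with ⟨_, h⟩ | ⟨_, h⟩
    · rw [hcq] at h
      omega
    · exact h)
  have hnone : (fun x y z => False ∨ tableTriple ρ val (fun _ _ => none) x y z) =
      fun _ _ _ => False := by
    funext x y z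
    simp [tableTriple]
  rw [hnone] at sysc
  refine ⟨tableMap ρ val (heptQ ()), Unit, inferInstance, _, _, _, _,
    gadget_table hval sys₀ sys₁ (by decide) (by decide) (by decide),
    sysc.reindex (σ := ![Sum.inl (), Sum.inr ()]) (by decide), ?_, ?_, ?_, ?_, ?_⟩
  · intro P hP hP₀ hP₁ x y hxy
    exact link_table (start := fun g s => decide (s = heptF₀ none g ∨ s = heptF₁ none g)) (n := 4)
      hval hres hneg (by decide) (by decide) (by simp) (by decide) hP hP₀ hP₁ hxy
  · intro i x h
    fin_cases i
    · change Covers _ _ x (half (c : ZMod (2 * m)) x) at h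
      obtain ⟨s, hs⟩ := exists_step_of_covers h
      have := hkey hs
      have h' := (hcq x _).1 rfl
      omega
    · have hd : ∀ i g, ¬ ((∃ d, heptF₀ d g = heptQ i g) ∨ heptT₀ g (heptQ i g) ≠ none) := by decide
      exact hd () _ ((covers_table hval).1 h)
  · intro x y
    constructor
    · intro h
      have : (∃ s, x + val s = y) ∨ half (c : ZMod (2 * m)) x = y := by
        rcases h with h | ⟨i, h⟩
        · exact Or.inl (exists_step_of_covers h)
        · fin_cases i
          · exact Or.inr h
          · exact Or.inl ⟨_, h⟩
      rcases this with ⟨s, hs⟩ | h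
      · have := hkey hs
        omega
      · rw [hcq] at h
        omega
    · intro h
      have : (∃ s, x + val s = y) ∨ half (c : ZMod (2 * m)) x = y := by
        rw [hcq]
        rcases h with h | h | h | h | h | h | h | h
        · rcases eq_add_or_of_key h with h | h
          exacts [Or.inl ⟨0, h⟩, Or.inl ⟨3, h⟩]
        · rcases eq_add_or_of_key h with h | h
          exacts [Or.inl ⟨1, h⟩, Or.inl ⟨4, h⟩]
        · rcases eq_add_or_of_key h with h | h
          exacts [Or.inl ⟨2, h⟩, Or.inl ⟨5, h⟩]
        · rcases eq_add_or_of_key h with h | h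
          exacts [Or.inl ⟨3, h⟩, Or.inl ⟨0, by rw [neg_neg] at h; exact h⟩]
        · rcases eq_add_or_of_key h with h | h
          exacts [Or.inl ⟨4, h⟩, Or.inl ⟨1, by rw [neg_neg] at h; exact h⟩]
        · rcases eq_add_or_of_key h with h | h
          exacts [Or.inl ⟨5, h⟩, Or.inl ⟨2, by rw [neg_neg] at h; exact h⟩]
        · unfold key at h
          rw [← eq_intCast_iff (by omega) le_rfl, Int.cast_natCast, signedDiff_eq_natCast_self] at h
          exact Or.inl ⟨6, by simp only [val, w]; simpa using h⟩
        · exact Or.inr h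
      rcases this with ⟨s, rfl⟩ | h
      · rw [covers_table hval]
        have h : ∀ g s, ((∃ d, heptF₀ d g = s) ∨ heptT₀ g s ≠ none) ∨ ∃ i, heptQ i g = s := by decide
        refine (h (ρ x) s).imp id ?_
        rintro ⟨i, hi⟩
        exact ⟨1, by rw [← hi]; rfl⟩
      · exact Or.inr ⟨0, h⟩
  · obtain ⟨A, hA, hA'⟩ := exists_neighbours_table (ρ := ρ) hval (T := heptT₀)
    exact ⟨A, hA.trans (by decide), hA'⟩
  · have h : ∀ x y z, tableTriple ρ val heptT₀ x y z ∨ tableTriple ρ val heptT₁ x y z →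
        ∃ s, x + val s = y ∧ (heptT₀ (ρ x) s ≠ none ∨ heptT₁ (ρ x) s ≠ none) := by
      rintro x y z (⟨s, t, h, rfl, rfl⟩ | ⟨s, t, h, rfl, rfl⟩)
      · exact ⟨s, rfl, Or.inl (by rw [h]; exact Option.some_ne_none _)⟩
      · exact ⟨s, rfl, Or.inr (by rw [h]; exact Option.some_ne_none _)⟩
    have hT : ∀ g, heptT₀ g 1 ≠ none ∨ heptT₁ g 1 ≠ none → g ≠ 0 := by decide
    have h6 : ∀ g, ¬ (heptT₀ g 6 ≠ none ∨ heptT₁ g 6 ≠ none) := by decide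
    intro x y z H
    obtain ⟨s, rfl, hs⟩ := h x y z H
    refine ⟨⟨w s, rfl, ?_⟩, ?_⟩
    · fin_cases s
      · simp [w]
      · simp [w]
      · simp [w]
      · simp [w]
      · simp [w]
      · simp [w]
      · exact absurd hs (h6 _)
    · rintro ⟨h1, h2⟩
      have := hval (a₂ := 1) (add_left_cancel h1)
      subst this
      exact hT _ hs h2

end Split

/-! ### Triples developed cyclically from base triples. -/

/-- The signed differences of the triples `{y - p, y, y + d}`. -/
def triSteps (d p : ℤ) : Fin 6 → ℤ := ![d, p, d + p, -d, -p, -(d + p)]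

/-- The third point of the triple through a point and the end of a step. -/
def triNext : Fin 6 → Fin 6 := ![4, 2, 1, 5, 0, 3]

/-- The differences of the steps within a triple. -/
def triSub : Fin 6 → Fin 6 → Fin 6 :=
  ![![0, 0, 0, 0, 2, 0], ![0, 0, 3, 0, 0, 0], ![0, 0, 0, 0, 0, 0],
    ![0, 0, 0, 0, 0, 1], ![5, 0, 0, 0, 0, 0], ![0, 0, 0, 4, 0, 0]]

theorem triSteps_neg (d p : ℤ) : ∀ s, triSteps d p (hexNeg s) = -triSteps d p s := by
  intro s
  fin_cases s <;> simp [triSteps, hexNeg]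

theorem triSteps_sub (d p : ℤ) :
    ∀ s, triSteps d p (triSub (triNext s) s) = triSteps d p (triNext s) - triSteps d p s := by
  intro s
  fin_cases s <;> (simp [triSteps, triSub, triNext]; try ring)

/-- The differences `d i`, `p i` and `d i + p i` are positive, less than `m` and distinct. -/
structure IsTriFamily (m : ℕ) {k : ℕ} (d p : Fin k → ℤ) : Prop where
  d_pos : ∀ i, 0 < d i
  p_pos : ∀ i, 0 < p i
  lt : ∀ i, d i + p i < m
  dd : ∀ i j, d i = d j → i = j
  pp : ∀ i j, p i = p j → i = j
  qq : ∀ i j, d i + p i = d j + p j → i = j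
  dp : ∀ i j, d i ≠ p j
  dq : ∀ i j, d i ≠ d j + p j
  pq : ∀ i j, p i ≠ d j + p j

section Tri
variable {m k : ℕ}

/-- The triples `{y - p i, y, y + d i}`. -/
def triTriple (m : ℕ) {k : ℕ} (d p : Fin k → ℤ) (x y z : ZMod (2 * m)) : Prop :=
  ∃ i s, x + (triSteps (d i) (p i) s : ℤ) = y ∧ x + (triSteps (d i) (p i) (triNext s) : ℤ) = z

/-- The differences of a family of triples. -/
def triSize {k : ℕ} (d p : Fin k → ℤ) (t : ℤ) : Prop := ∃ i, t = d i ∨ t = p i ∨ t = d i + p i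

variable {d p : Fin k → ℤ}

theorem IsTriFamily.bounds (h : IsTriFamily m d p) (i : Fin k) (s : Fin 6) :
    -(m : ℤ) < triSteps (d i) (p i) s ∧ triSteps (d i) (p i) s < m := by
  have h1 := h.d_pos i
  have h2 := h.p_pos i
  have h3 := h.lt i
  fin_cases s <;> simp [triSteps] <;> omega

theorem IsTriFamily.ne_zero (h : IsTriFamily m d p) (i : Fin k) (s : Fin 6) :
    triSteps (d i) (p i) s ≠ 0 := by
  have h1 := h.d_pos i
  have h2 := h.p_pos i
  fin_cases s <;> simp [triSteps] <;> omega

theorem IsTriFamily.injective (h : IsTriFamily m d p) {i j : Fin k} {s t : Fin 6}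
    (e : triSteps (d i) (p i) s = triSteps (d j) (p j) t) : i = j ∧ s = t := by
  have h1 := h.d_pos i
  have h2 := h.p_pos i
  have h1' := h.d_pos j
  have h2' := h.p_pos j
  have a1 := h.dp i j
  have a2 := h.dq i j
  have a3 := h.pq i j
  have b1 := h.dp j i
  have b2 := h.dq j i
  have b3 := h.pq j i
  have hij : s = t → i = j := by
    rintro rfl
    have c1 := h.dd i j
    have c2 := h.pp i j
    have c3 := h.qq i j
    fin_cases s <;> simp [triSteps] at e
    · exact c1 e
    · exact c2 e
    · exact c3 e
    · exact c1 e
    · exact c2 e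
    · exact c3 (by omega)
  have hst : s = t := by
    revert e
    clear hij
    fin_cases s <;> fin_cases t <;> simp [triSteps] <;> omega
  exact ⟨hij hst, hst⟩

/-- The differences of all base triples are distinct and less than `m`, so each pair occurs at most
once, and each base triple gives every point six neighbours. This is a table with a single class. -/
theorem IsTriFamily.isSystem (hm : 0 < m) (h : IsTriFamily m d p) :
    IsSystem (fun e : Empty => e.elim) (triTriple m d p) ∧
      (∀ x y : ZMod (2 * m), (∃ z, triTriple m d p x y z) ↔ triSize d p |key x y|) ∧
      ∃ S : Finset (ZMod (2 * m)), S.card = 6 * k ∧ ∀ y, y ∈ S ↔ ∃ z, triTriple m d p 0 y z := by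
  let val : Fin k × Fin 6 → ZMod (2 * m) := fun a => (triSteps (d a.1) (p a.1) a.2 : ℤ)
  have hval : val.Injective := by
    rintro ⟨i, s⟩ ⟨j, t⟩ e
    have b := h.bounds i s
    have b' := h.bounds j t
    have := h.injective ((intCast_eq_iff b.1 b.2.le b'.1 b'.2.le).1 e)
    rw [this.1, this.2]
  let ρ : ZMod (2 * m) →+ ZMod 1 := 0
  let T : ZMod 1 → Fin k × Fin 6 → Option (Fin k × Fin 6) := fun _ a => some (a.1, triNext a.2)
  have hT : tableTriple ρ val T = triTriple m d p := by
    funext x y z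
    simp only [tableTriple, triTriple, T, Option.some.injEq, eq_iff_iff]
    constructor
    · rintro ⟨⟨i, s⟩, _, rfl, h1, h2⟩
      exact ⟨i, s, h1, h2⟩
    · rintro ⟨i, s, h1, h2⟩
      exact ⟨(i, s), _, rfl, h1, h2⟩
  have hnn : ∀ s, triNext (triNext s) = s := by decide
  have hns : ∀ s, triNext (hexNeg s) = triSub (triNext s) s := by decide
  have sys : IsSystem (fun e : Empty => tableMap ρ val e.elim) (tableTriple ρ val T) := by
    refine isSystem_table (res := fun _ => 0) (neg := fun a => (a.1, hexNeg a.2))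
      (sub := fun b a => (a.1, triSub b.2 a.2)) hval (fun _ => rfl) ?_ ?_ ?_ ?_ ?_ ?_ ?_ ?_
    · rintro ⟨i, s⟩ e
      have b := h.bounds i s
      refine h.ne_zero i s ((intCast_eq_iff (m := m) b.1 b.2.le (t := 0) (by omega) (by omega)).1 ?_)
      rw [Int.cast_zero]
      exact e
    · rintro ⟨i, s⟩
      simp only [val]
      rw [triSteps_neg, Int.cast_neg]
    · rintro _ ⟨i, s⟩ _ ⟨⟩
      simp only [val]
      rw [triSteps_sub, Int.cast_sub]
    · rintro ⟨⟩
    · rintro ⟨⟩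
    · rintro _ ⟨i, s⟩ _ ⟨⟩
      simp only [T, hnn]
    · rintro _ ⟨i, s⟩ _ ⟨⟩
      simp only [T, hns]
    · rintro ⟨⟩
  rw [hT] at sys
  refine ⟨?_, fun x y => ?_, ?_⟩
  · convert sys using 2 with e
  · constructor
    · rintro ⟨z, i, s, e, -⟩
      have b := h.bounds i s
      have hk := key_eq_or b.1 b.2 e
      have h1 := h.d_pos i
      have h2 := h.p_pos i
      have : |key x y| = |triSteps (d i) (p i) s| := by
        rcases hk with hk | hk <;> rw [hk]
        exact abs_neg _
      rw [this]
      refine ⟨i, ?_⟩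
      have h0 := abs_nonneg (triSteps (d i) (p i) s)
      rcases abs_choice (triSteps (d i) (p i) s) with h3 | h3 <;> rw [h3] at h0 ⊢ <;>
        fin_cases s <;> simp [triSteps] at h0 ⊢ <;> omega
    · rintro ⟨i, hi⟩
      suffices ∃ s, x + (triSteps (d i) (p i) s : ℤ) = y from
        this.elim fun s hs => ⟨_, i, s, hs, rfl⟩
      have e : ∀ s t, triSteps (d i) (p i) t = -triSteps (d i) (p i) s →
          |key x y| = triSteps (d i) (p i) s → ∃ s, x + (triSteps (d i) (p i) s : ℤ) = y := by
        intro s t ht hs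
        rcases abs_choice (key x y) with h' | h' <;> rw [h'] at hs
        · rcases eq_add_or_of_key hs with h | h
          · exact ⟨s, h⟩
          · exact ⟨t, by rw [ht]; exact h⟩
        · rcases eq_add_or_of_key (neg_eq_iff_eq_neg.1 hs) with h | h
          · exact ⟨t, by rw [ht]; exact h⟩
          · exact ⟨s, by rw [neg_neg] at h; exact h⟩
      rcases hi with hi | hi | hi
      · exact e 0 3 (by simp [triSteps]) hi
      · exact e 1 4 (by simp [triSteps]) hi
      · exact e 2 5 (by simp [triSteps]) hi
  · obtain ⟨S, hS, hS'⟩ := exists_neighbours_table (ρ := ρ) hval (T := T)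
    rw [hT] at hS'
    refine ⟨S, ?_, hS'⟩
    rw [hS]
    simp [T]
    ring

/-- The signs and sizes of the two steps from a point of a triple reveal which of the three points
it is, hence both `d` and `p`. Equal triples would thus force the same `d`, and then `p i = p' i`.
-/
theorem not_triTriple_of_triTriple {p' : Fin k → ℤ} (h : IsTriFamily m d p)
    (h' : IsTriFamily m d p') (hp : ∀ i, p i ≠ p' i) {x y z : ZMod (2 * m)}
    (H : triTriple m d p x y z) : ¬ triTriple m d p' x y z := by
  obtain ⟨i, s, rfl, rfl⟩ := H
  rintro ⟨j, t, e1, e2⟩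
  have b1 := h.bounds i s
  have b2 := h.bounds i (triNext s)
  have b1' := h'.bounds j t
  have b2' := h'.bounds j (triNext t)
  have f1 := (intCast_eq_iff b1'.1 b1'.2.le b1.1 b1.2.le).1 (add_left_cancel e1)
  have f2 := (intCast_eq_iff b2'.1 b2'.2.le b2.1 b2.2.le).1 (add_left_cancel e2)
  have h1 := h.d_pos i
  have h2 := h.p_pos i
  have h1' := h.d_pos j
  have h2' := h'.p_pos j
  have : d i = d j ∧ p i = p' j := by
    revert f1 f2
    clear b1 b2 b1' b2' e1 e2
    fin_cases s <;> fin_cases t <;> simp [triSteps, triNext] <;> omega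
  obtain rfl := h.dd _ _ this.1
  exact hp _ this.2

end Tri

/-! ### Linked gadgets from two families with the same set of differences. -/

section Linked
variable {m k : ℕ}

theorem exists_colouring_intCast {h : ℤ} (h0 : 0 < h) (hm : h < m) :
    ∃ c : ZMod (2 * m) → ZMod 3, ∀ x, c x ≠ c (x + (h : ZMod (2 * m))) := by
  lift h to ℕ using h0.le
  obtain ⟨c, hc⟩ := exists_colouring (d := h) (m := m) (by omega) (by omega)
  exact ⟨c, by simpa using hc⟩

/-- The matchings of a prism, and a further one. -/
def prismHalf (h α β : ZMod (2 * m)) (c : ZMod (2 * m) → ZMod 3) :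
    Option (ZMod 3) → ZMod (2 * m) → ZMod (2 * m)
  | none => half β
  | some i => prism h α c i

theorem half_eq_iff_key {t : ℤ} (h1 : -(m : ℤ) < t) (h2 : t ≤ m) {x y : ZMod (2 * m)} :
    half (t : ZMod (2 * m)) x = y ↔ key x y = t := by
  rw [half_eq_iff, eq_intCast_iff h1 h2]
  rfl

theorem prism_eq_iff_key {h α : ℤ} (h0 : 0 < h) (hm : h < m) (hα1 : -(m : ℤ) < α) (hα2 : α ≤ m)
    {c : ZMod (2 * m) → ZMod 3} (hc : ∀ x, c x ≠ c (x + (h : ZMod (2 * m)))) {x y : ZMod (2 * m)} :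
    (∃ i, prism (h : ZMod (2 * m)) (α : ZMod (2 * m)) c i x = y) ↔ |key x y| = h ∨ key x y = α := by
  have e : signedDiff x y = (h : ZMod (2 * m)) ∨ signedDiff x y = -(h : ZMod (2 * m)) ∨
      signedDiff x y = (α : ZMod (2 * m)) ↔ |key x y| = h ∨ key x y = α := by
    rw [← Int.cast_neg, eq_intCast_iff (by omega) (by omega), eq_intCast_iff (by omega) (by omega),
      eq_intCast_iff hα1 hα2, abs_eq h0.le, or_assoc]
    rfl
  rw [← e]
  constructor
  · rintro ⟨i, rfl⟩
    exact signedDiff_prism _ _ _ _ _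
  · exact exists_prism_eq hc

theorem isSystem_prismHalf {d p : Fin k → ℤ} (hm : 0 < m) (F : IsTriFamily m d p) {h α β : ℤ}
    (h0 : 0 < h) (h1 : h < m) (h2 : h % 2 = 0) (hα : α % 2 = 1) (hβ : β % 2 = 1)
    (hα1 : -(m : ℤ) < α) (hα2 : α ≤ m) (hβ1 : -(m : ℤ) < β) (hβ2 : β ≤ m) (hαβ : α ≠ β)
    (nh : ¬ triSize d p h) (nα : ¬ triSize d p |α|) (nβ : ¬ triSize d p |β|)
    {c : ZMod (2 * m) → ZMod 3} (hc : ∀ x, c x ≠ c (x + (h : ZMod (2 * m)))) :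
    IsSystem (prismHalf (h : ZMod (2 * m)) α β c) (triTriple m d p) ∧
      ∀ x y, Covers (prismHalf (h : ZMod (2 * m)) α β c) (triTriple m d p) x y ↔
        triSize d p |key x y| ∨ |key x y| = h ∨ key x y = α ∨ key x y = β := by
  obtain ⟨sT, cT, -⟩ := F.isSystem hm
  have sP := isSystem_prism (par_intCast_eq_zero.2 h2) (intCast_ne_neg h0 h1)
    (par_intCast_eq_one.2 hα) hc
  have sH := isSystem_half (par_intCast_eq_one (m := m).2 hβ)
  have cP : ∀ x y, Covers (prism (h : ZMod (2 * m)) α c) (fun _ _ _ => False) x y ↔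
      |key x y| = h ∨ key x y = α := by
    intro x y
    rw [← prism_eq_iff_key h0 h1 hα1 hα2 hc]
    simp [Covers]
  have cH : ∀ x y, Covers (fun _ : Unit => half (β : ZMod (2 * m))) (fun _ _ _ => False) x y ↔
      key x y = β := by
    intro x y
    rw [← half_eq_iff_key hβ1 hβ2]
    simp [Covers]
  have cT' : ∀ x y, Covers (fun e : Empty => e.elim) (triTriple m d p) x y ↔
      triSize d p |key x y| := by
    intro x y
    rw [← cT]
    simp [Covers]
  have s1 := sP.sumElim sH (by
    intro x y
    rw [cP, cH]
    rintro (h | h) h'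
    · rw [h'] at h
      rcases abs_choice β with e | e <;> omega
    · omega)
  have s2 := sT.sumElim s1 (by
    intro x y
    rw [covers_sumElim, cP, cH, cT']
    rintro h ((h' | h') | h') <;> rw [h'] at h
    exacts [nh h, nα h, nβ h])
  let σ : Option (ZMod 3) → Empty ⊕ ZMod 3 ⊕ Unit := fun o => o.elim (.inr (.inr ()))
    fun i => .inr (.inl i)
  have hσ : σ.Injective := by
    rintro (_ | i) (_ | j) h <;> simp [σ] at h ⊢
    exact h
  have hσ' : σ.Surjective := by
    rintro (⟨⟨⟩⟩ | i | ⟨⟩)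
    exacts [⟨some i, rfl⟩, ⟨none, rfl⟩]
  have s3 := s2.reindex hσ
  have c3 := fun x y => (covers_reindex hσ' (x := x) (y := y)
    (f := Sum.elim (fun e : Empty => e.elim) (Sum.elim (prism (h : ZMod (2 * m)) α c)
      fun _ : Unit => half (β : ZMod (2 * m))))
    (L := fun x y z => triTriple m d p x y z ∨ False ∨ False)).trans
      (covers_sumElim.trans (or_congr (cT' x y) (covers_sumElim.trans (or_congr (cP x y) (cH x y)))))
  have hf : (fun o => Sum.elim (fun e : Empty => e.elim) (Sum.elim (prism (h : ZMod (2 * m)) α c)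
      fun _ : Unit => half (β : ZMod (2 * m))) (σ o)) = prismHalf (h : ZMod (2 * m)) α β c := by
    funext o
    rcases o with _ | i <;> rfl
  have hL : (fun x y z => triTriple m d p x y z ∨ False ∨ False) = triTriple m d p := by
    funext x y z
    simp
  rw [hf, hL] at s3 c3
  refine ⟨s3, fun x y => ?_⟩
  rw [c3, or_assoc]

/-- The first family misses `h₀` of `K` and the second `h₁`. One side has a prism on `h₀, α` and the
spare matching `half β`, the other a prism on `h₁, β` and the spare matching `half α`; the three
colours of the prisms are the matched labels. By `hconn` a single linked pair of `K` suffices. -/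
theorem hasLinkedGadget_of_families {d p p' : Fin k → ℤ} (hm : 0 < m) (F₀ : IsTriFamily m d p)
    (F₁ : IsTriFamily m d p') (hpp : ∀ i, p i ≠ p' i) {h₀ h₁ α β : ℤ}
    (a0 : 0 < h₀) (a1 : h₀ < m) (a2 : h₀ % 2 = 0) (b0 : 0 < h₁) (b1 : h₁ < m) (b2 : h₁ % 2 = 0)
    (hh : h₀ ≠ h₁) (hα : α % 2 = 1) (hβ : β % 2 = 1)
    (hα1 : -(m : ℤ) < α) (hα2 : α ≤ m) (hβ1 : -(m : ℤ) < β) (hβ2 : β ≤ m) (hαβ : α ≠ β)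
    {K : ℤ → Prop} (hK₀ : ∀ t, K t ↔ triSize d p t ∨ t = h₀)
    (hK₁ : ∀ t, K t ↔ triSize d p' t ∨ t = h₁)
    (n₀ : ¬ triSize d p h₀) (n₁ : ¬ triSize d p' h₁) (nα : ¬ K |α|) (nβ : ¬ K |β|)
    (hconn : ∀ P : ZMod (2 * m) → ZMod (2 * m) → Prop, (∀ x y, P x y → P y x) →
      (∀ x y z, triTriple m d p x y z → P x y → P x z) →
      (∀ x y z, triTriple m d p' x y z → P x y → P x z) →
      (∃ x y, K |key x y| ∧ P x y) → ∀ x y, K |key x y| → P x y) :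
    HasLinkedGadget m (6 * k) (β : ZMod (2 * m)) (fun t => K |t| ∨ t = α ∨ t = β)
      fun x y => K |key x y| := by
  obtain ⟨c, hc⟩ := exists_colouring_intCast a0 a1
  obtain ⟨c', hc'⟩ := exists_colouring_intCast b0 b1
  -- The offset makes `c 0` the colour of the rung at 0 in the second prism. So the edge from 0 to
  -- `h₀` and the `half β` edge at 0 carry the same label.
  let e := c 0 + (c' 0 + c' (0 - (h₁ : ZMod (2 * m))))
  have hc'' : ∀ x, c' x + e ≠ c' (x + (h₁ : ZMod (2 * m))) + e := fun x h =>
    hc' x (add_right_cancel h)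
  have nα₀ : ¬ triSize d p |α| := fun h => nα ((hK₀ _).2 (Or.inl h))
  have nβ₀ : ¬ triSize d p |β| := fun h => nβ ((hK₀ _).2 (Or.inl h))
  have nα₁ : ¬ triSize d p' |α| := fun h => nα ((hK₁ _).2 (Or.inl h))
  have nβ₁ : ¬ triSize d p' |β| := fun h => nβ ((hK₁ _).2 (Or.inl h))
  obtain ⟨s₀, cov₀⟩ := isSystem_prismHalf hm F₀ a0 a1 a2 hα hβ hα1 hα2 hβ1 hβ2 hαβ n₀ nα₀ nβ₀ hc
  obtain ⟨s₁, cov₁⟩ := isSystem_prismHalf hm F₁ b0 b1 b2 hβ hα hβ1 hβ2 hα1 hα2 hαβ.symm n₁ nβ₁ nα₁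
    hc''
  have cov₀' : ∀ x y, Covers (prismHalf (h₀ : ZMod (2 * m)) α β c) (triTriple m d p) x y ↔
      K |key x y| ∨ key x y = α ∨ key x y = β := by
    intro x y
    rw [cov₀, hK₀, or_assoc]
  have cov₁' : ∀ x y, Covers (prismHalf (h₁ : ZMod (2 * m)) β α fun x => c' x + e)
      (triTriple m d p') x y ↔ K |key x y| ∨ key x y = α ∨ key x y = β := by
    intro x y
    rw [cov₁, hK₁, or_assoc, or_comm (a := key x y = α)]
  have e₀ := fun x y => prism_eq_iff_key a0 a1 hα1 hα2 hc (x := x) (y := y)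
  have e₁ := fun x y => prism_eq_iff_key b0 b1 hβ1 hβ2 hc'' (x := x) (y := y)
  have hne : ∀ i x, prism (h₀ : ZMod (2 * m)) α c i x ≠
      prism (h₁ : ZMod (2 * m)) β (fun x => c' x + e) i x := by
    intro i x h
    have h1 := (e₀ x _).1 ⟨i, h⟩
    have h2 := (e₁ x _).1 ⟨i, rfl⟩
    generalize key x _ = t at h1 h2
    clear_value e
    rcases h1 with h1 | h1 <;> rcases h2 with h2 | h2
    · exact hh (h1.symm.trans h2)
    · rw [h2] at h1
      rcases abs_choice β with e | e <;> omega
    · rw [h1] at h2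
      rcases abs_choice α with e | e <;> omega
    · exact hαβ (h1.symm.trans h2)
  refine ⟨ZMod 3, inferInstance, _, _, _, _, ⟨s₀, s₁, fun x y => (cov₀' x y).trans (cov₁' x y).symm,
    hne, fun x y z => not_triTriple_of_triTriple F₀ F₁ hpp⟩, rfl, ?_, cov₀', (F₀.isSystem hm).2.2, ?_⟩
  · intro P hP hβP
    have hpos : ∀ i x, P x (prism (h₀ : ZMod (2 * m)) α c i x) ↔
        P x (prism (h₁ : ZMod (2 * m)) β (fun x => c' x + e) i x) := hP.pos
    have hKP : ∀ x y, K |key x y| → P x y := by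
      apply hconn P hP.symm hP.pure₀ hP.pure₁
      refine ⟨0, prism (h₀ : ZMod (2 * m)) α c (c 0) 0, ?_, ?_⟩
      · have : prism (h₀ : ZMod (2 * m)) α c (c 0) 0 = 0 + (h₀ : ZMod (2 * m)) := by
          unfold prism
          rw [if_pos (map_zero par), if_pos rfl]
        rw [this, hK₀]
        right
        rcases key_eq_or (by omega) a1 (rfl : (0 : ZMod (2 * m)) + (h₀ : ZMod (2 * m)) = _) with h | h
        · rw [h, abs_of_pos a0]
        · rw [h, abs_neg, abs_of_pos a0]
      · rw [hpos]
        have : prism (h₁ : ZMod (2 * m)) β (fun x => c' x + e) (c 0) 0 = half (β : ZMod (2 * m)) 0 := by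
          have hne := hc' (0 - (h₁ : ZMod (2 * m)))
          rw [sub_add_cancel] at hne
          have key : ∀ x y z : ZMod 3, y ≠ z → z + (x + (z + y)) ≠ x ∧ y + (x + (z + y)) ≠ x := by
            decide
          have := key (c 0) _ _ hne
          unfold prism
          rw [if_pos (map_zero par), if_neg this.1, if_neg this.2]
        rw [this]
        exact hβP 0
    intro x y hxy
    rcases (cov₀' x y).1 hxy with h | h | h
    · exact hKP x y h
    -- An edge of `half α` carries the label of an edge with difference `h₁` or of a `half β` edge
    -- at the same point; both kinds are already linked.
    · obtain ⟨i, hi⟩ := (e₀ x y).2 (Or.inr h)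
      rw [← hi, hpos]
      rcases (e₁ x _).1 ⟨i, rfl⟩ with h' | h'
      · exact hKP _ _ ((hK₁ _).2 (Or.inr h'))
      · rw [← (half_eq_iff_key hβ1 hβ2).2 h']
        exact hβP x
    · rw [← (half_eq_iff_key hβ1 hβ2).2 h]
      exact hβP x
  · have hz : ∀ x y z, triTriple m d p x y z → K |key x y| := fun x y z h =>
      (hK₀ _).2 (Or.inl (((F₀.isSystem hm).2.1 x y).1 ⟨z, h⟩))
    have hz' : ∀ x y z, triTriple m d p' x y z → K |key x y| := fun x y z h =>
      (hK₁ _).2 (Or.inl (((F₁.isSystem hm).2.1 x y).1 ⟨z, h⟩))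
    rintro x y z (h | h)
    exacts [hz x y z h, hz' x y z h]

theorem hasLinkedGadget_zero {z : ℤ} (hz : z % 2 = 1) (h1 : -(m : ℤ) < z) (h2 : z ≤ m) :
    HasLinkedGadget m 0 (z : ZMod (2 * m)) (fun t => t = z) fun _ _ => False := by
  have hs := isSystem_half (par_intCast_eq_one (m := m).2 hz)
  have hsys := hs.reindex (σ := fun _ : Option Empty => ()) (by rintro (_ | ⟨⟨⟩⟩) (_ | ⟨⟨⟩⟩) _; rfl)
  refine ⟨Empty, inferInstance, fun _ => half z, fun _ => half z, fun _ _ _ => False,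
    fun _ _ _ => False, ⟨hsys, hsys, fun _ _ => Iff.rfl, by rintro ⟨⟩, fun _ _ _ h => h.elim⟩, rfl,
    ?_, ?_, ⟨∅, rfl, by simp⟩, by simp⟩
  · rintro P - h x y (⟨_, rfl⟩ | ⟨_, ⟨⟩⟩)
    exact h x
  · intro x y
    change _ ↔ key x y = z
    rw [← half_eq_iff_key h1 h2]
    simp [Covers]

end Linked

/-! ### Connectedness of the differences of the two families. -/

theorem iff_of_run {A : ℤ → Prop} {a b : ℤ} (h : ∀ z, a ≤ z → z < b → (A z ↔ A (z + 1))) :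
    ∀ z w, a ≤ z → z ≤ b → a ≤ w → w ≤ b → (A z ↔ A w) := by
  have key : ∀ z, a ≤ z → z ≤ b → (A a ↔ A z) := by
    intro z hz
    induction z, hz using Int.leInduction with
    | base => exact fun _ => Iff.rfl
    | succ z hz ih => exact fun hb => (ih (by omega)).trans (h z hz (by omega))
  exact fun z w h1 h2 h3 h4 => (key z h1 h2).symm.trans (key w h3 h4)

/-- A cyclic sequence of length `2 * n + 1`, rotated by `2 * (n / 2) + 1`, with three links
removed. -/
theorem iff_of_rotation {A : ℤ → Prop} {n f o : ℤ} (hn : 3 ≤ n) (hf : f = n / 2) (ho : o = n - f)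
    (h1 : ∀ z, 0 ≤ z → z < 2 * o → z ≠ o - 1 → z ≠ o → (A z ↔ A (z + (2 * f + 1))))
    (h2 : ∀ z, 2 * o ≤ z → z ≤ 2 * n → z ≠ 2 * o + f → (A z ↔ A (z - 2 * o))) {z w : ℤ}
    (z0 : 0 ≤ z) (z1 : z ≤ 2 * n) (z2 : z ≠ f) (z3 : z ≠ 2 * o + f)
    (w0 : 0 ≤ w) (w1 : w ≤ 2 * n) (w2 : w ≠ f) (w3 : w ≠ 2 * o + f) : A z ↔ A w := by
  have h12 : ∀ z, 0 ≤ z → z < 2 * o → z ≠ o - 1 → z ≠ o → 2 * o ≤ z + (2 * f + 1) →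
      z + (2 * f + 1) ≠ 2 * o + f → (A z ↔ A (z + (2 * f + 1) - 2 * o)) := fun z a1 a2 a3 a4 a5 a6 =>
    (h1 z a1 a2 a3 a4).trans (h2 _ a5 (by omega) a6)
  have h21 : ∀ z, 2 * o ≤ z → z ≤ 2 * n → z ≠ 2 * o + f → z - 2 * o < 2 * o → z - 2 * o ≠ o - 1 →
      z - 2 * o ≠ o → (A z ↔ A (z - 2 * o + (2 * f + 1))) := fun z a1 a2 a3 a4 a5 a6 =>
    (h2 z a1 a2 a3).trans (h1 _ (by omega) a4 a5 a6)
  have main : ∀ z, 0 ≤ z → z ≤ 2 * n → z ≠ f → z ≠ 2 * o + f → (A z ↔ A 0) := by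
    rcases Int.emod_two_eq_zero_or_one n with hp | hp
    -- With `n = 2 * f`, two rotations give `2 * (2 * f + 1)`, which is 1 modulo `2 * n + 1`. The
    -- removed links leave three runs of consecutive integers, joined below by `e1` and `e2`.
    · have hs : ∀ z, 0 ≤ z → z < 2 * n → z ≠ f - 1 → z ≠ f → z ≠ 3 * f - 1 → z ≠ 3 * f →
          (A z ↔ A (z + 1)) := by
        intro z a1 a2 a3 a4 a5 a6
        rcases lt_or_ge z (2 * o) with h | h
        · rw [h12 z a1 h (by omega) (by omega) (by omega) (by omega)]
          rw [show z + (2 * f + 1) - 2 * o = z + 1 by omega]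
        · rw [h21 z h (by omega) (by omega) (by omega) (by omega) (by omega)]
          rw [show z - 2 * o + (2 * f + 1) = z + 1 by omega]
      have ra := iff_of_run (A := A) (a := 0) (b := f - 1) fun z a b =>
        hs z a (by omega) (by omega) (by omega) (by omega) (by omega)
      have rb := iff_of_run (A := A) (a := f + 1) (b := 3 * f - 1) fun z a b =>
        hs z (by omega) (by omega) (by omega) (by omega) (by omega) (by omega)
      have rc := iff_of_run (A := A) (a := 3 * f + 1) (b := 2 * n) fun z a b =>
        hs z (by omega) (by omega) (by omega) (by omega) (by omega) (by omega)
      have e1 : A 0 ↔ A (2 * f + 1) := by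
        have := h1 0 le_rfl (by omega) (by omega) (by omega)
        rwa [zero_add] at this
      have e2 := h2 (2 * n) (by omega) le_rfl (by omega)
      intro z a1 a2 a3 a4
      rcases lt_or_gt_of_ne a3 with h | h
      · exact ra z 0 a1 (by omega) le_rfl (by omega)
      · rcases lt_or_gt_of_ne a4 with h' | h'
        · rw [e1]
          exact rb _ _ (by omega) (by omega) (by omega) (by omega)
        · rw [e1, rc z (2 * n) (by omega) a2 (by omega) le_rfl, e2]
          exact rb _ _ (by omega) (by omega) (by omega) (by omega)
    -- For odd `n`, two rotations move by -1 instead.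
    · have hs : ∀ z, 0 ≤ z → z < 2 * n → z ≠ f - 1 → z ≠ f → z ≠ 3 * f + 1 → z ≠ 3 * f + 2 →
          (A z ↔ A (z + 1)) := by
        intro z a1 a2 a3 a4 a5 a6
        rcases lt_or_ge (z + 1) (2 * o) with h | h
        · rw [h12 (z + 1) (by omega) h (by omega) (by omega) (by omega) (by omega)]
          rw [show z + 1 + (2 * f + 1) - 2 * o = z by omega]
        · rw [h21 (z + 1) h (by omega) (by omega) (by omega) (by omega) (by omega)]
          rw [show z + 1 - 2 * o + (2 * f + 1) = z by omega]
      have ra := iff_of_run (A := A) (a := 0) (b := f - 1) fun z a b =>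
        hs z a (by omega) (by omega) (by omega) (by omega) (by omega)
      have rb := iff_of_run (A := A) (a := f + 1) (b := 3 * f + 1) fun z a b =>
        hs z (by omega) (by omega) (by omega) (by omega) (by omega) (by omega)
      have rc := iff_of_run (A := A) (a := 3 * f + 3) (b := 2 * n) fun z a b =>
        hs z (by omega) (by omega) (by omega) (by omega) (by omega) (by omega)
      have e1 : A 0 ↔ A (2 * f + 1) := by
        have := h1 0 le_rfl (by omega) (by omega) (by omega)
        rwa [zero_add] at this
      have e2 := h2 (2 * n) (by omega) le_rfl (by omega)
      intro z a1 a2 a3 a4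
      rcases lt_or_gt_of_ne a3 with h | h
      · exact ra z 0 a1 (by omega) le_rfl (by omega)
      · rcases lt_or_gt_of_ne a4 with h' | h'
        · rw [e1]
          exact rb _ _ (by omega) (by omega) (by omega) (by omega)
        · rw [e1, rc z (2 * n) (by omega) a2 (by omega) le_rfl, e2]
          exact rb _ _ (by omega) (by omega) (by omega) (by omega)
  exact (main z z0 z1 z2 z3).trans (main w w0 w1 w2 w3).symm

section Conn
variable {m k : ℕ}

theorem link_of_triples {d p : Fin k → ℤ} {P : ZMod (2 * m) → ZMod (2 * m) → Prop}
    (hs : ∀ x y, P x y → P y x) (hP : ∀ x y z, triTriple m d p x y z → P x y → P x z) (i : Fin k)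
    (y : ZMod (2 * m)) : (P (y - (p i : ℤ)) y ↔ P y (y + (d i : ℤ))) ∧
      (P (y - (p i : ℤ)) (y + (d i : ℤ)) ↔ P y (y + (d i : ℤ))) := by
  have h1 := hP y (y + (d i : ℤ)) (y - (p i : ℤ)) ⟨i, 0, by simp [triSteps], by
    simp [triSteps, triNext]; ring⟩
  have h2 := hP y (y - (p i : ℤ)) (y + (d i : ℤ)) ⟨i, 4, by simp [triSteps]; ring, by
    simp [triSteps, triNext]⟩
  have h3 := hP (y + (d i : ℤ)) y (y - (p i : ℤ)) ⟨i, 3, by simp [triSteps], by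
    simp [triSteps, triNext]; ring⟩
  have h4 := hP (y + (d i : ℤ)) (y - (p i : ℤ)) y ⟨i, 5, by simp [triSteps]; ring, by
    simp [triSteps, triNext]⟩
  exact ⟨⟨fun h => h2 (hs _ _ h), fun h => hs _ _ (h1 h)⟩,
    ⟨fun h => hs _ _ (h4 (hs _ _ h)), fun h => hs _ _ (h3 (hs _ _ h))⟩⟩

theorem forall_key_of_forall_add {K : ℤ → Prop} {P : ZMod (2 * m) → ZMod (2 * m) → Prop}
    (hs : ∀ x y, P x y → P y x) {Q : Prop}
    (h : ∀ t, K t → ∀ x : ZMod (2 * m), P x (x + (t : ℤ)) ↔ Q)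
    (hP : ∃ x y, K |key x y| ∧ P x y) : ∀ x y, K |key x y| → P x y := by
  have key' : ∀ x y, K |key x y| → (P x y ↔ Q) := by
    intro x y hK
    have hsymm : P x y ↔ P y x := ⟨hs _ _, hs _ _⟩
    have : x + ((|key x y| : ℤ) : ZMod (2 * m)) = y ∨ y + ((|key x y| : ℤ) : ZMod (2 * m)) = x := by
      have h := eq_add_or_of_key (rfl : key x y = _)
      generalize key x y = t at h
      rcases abs_choice t with e | e <;> rw [e] <;> rcases h with h | h
      · exact Or.inl h
      · right; rw [← h]; push_cast; ring
      · right; rw [← h]; push_cast; ring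
      · exact Or.inl h
    rcases this with e | e
    · conv_lhs => rw [← e]
      exact h _ hK x
    · rw [hsymm]
      conv_lhs => rw [← e]
      exact h _ hK y
  obtain ⟨x, y, hK, hxy⟩ := hP
  have hQ := (key' x y hK).1 hxy
  exact fun x' y' h' => (key' x' y' h').2 hQ

theorem forall_iff_zero {A : ZMod (2 * m) → Prop} (hm : 0 < m) (h : ∀ y, A y ↔ A (y + 1))
    (y : ZMod (2 * m)) : A y ↔ A 0 := by
  have : NeZero (2 * m) := ⟨by omega⟩
  rw [← ZMod.natCast_zmod_val y]
  induction y.val with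
  | zero => rw [Nat.cast_zero]
  | succ n ih => rw [Nat.cast_succ, ← h]; exact ih

/-- One triple of each kind: the differences are `1, B, B + 1` and `1, B + 1, B + 2`. -/
theorem hasLinkedGadget_one (hm : 0 < m) {B α β : ℤ} (hB : 1 < B) (hB2 : B % 2 = 0)
    (hBm : B + 2 < m) (hα : α % 2 = 1) (hβ : β % 2 = 1)
    (hα1 : -(m : ℤ) < α) (hα2 : α ≤ m) (hβ1 : -(m : ℤ) < β) (hβ2 : β ≤ m) (hαβ : α ≠ β)
    (nα : ¬ (|α| = 1 ∨ |α| = B + 1)) (nβ : ¬ (|β| = 1 ∨ |β| = B + 1)) :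
    HasLinkedGadget m 6 (β : ZMod (2 * m))
      (fun t => (|t| = 1 ∨ |t| = B ∨ |t| = B + 1 ∨ |t| = B + 2) ∨ t = α ∨ t = β)
      fun x y => |key x y| = 1 ∨ |key x y| = B ∨ |key x y| = B + 1 ∨ |key x y| = B + 2 := by
  have F : ∀ b : ℤ, 1 < b → b + 1 < m → IsTriFamily m (fun _ : Fin 1 => 1) fun _ => b := by
    intro b h1 h2
    constructor <;> intros <;> omega
  have hα3 : |α| % 2 = 1 := by rcases abs_choice α with e | e <;> omega
  have hβ3 : |β| % 2 = 1 := by rcases abs_choice β with e | e <;> omega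
  refine hasLinkedGadget_of_families (k := 1) hm (F B hB (by omega)) (F (B + 1) (by omega) (by omega))
    (fun _ => by omega) (h₀ := B + 2) (h₁ := B) (by omega) hBm (by omega) (by omega) (by omega) hB2
    (by omega) hα hβ hα1 hα2 hβ1 hβ2 hαβ (K := fun t => t = 1 ∨ t = B ∨ t = B + 1 ∨ t = B + 2)
    ?_ ?_ ?_ ?_ (by omega) (by omega) ?_
  · intro t
    simp only [triSize, exists_const]
    omega
  · intro t
    simp only [triSize, exists_const]
    omega
  · simp only [triSize, exists_const]
    omega
  · simp only [triSize, exists_const]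
    omega
  · intro P hs hP₀ hP₁
    have l0 := fun y => link_of_triples hs hP₀ 0 y
    have l1 := fun y => link_of_triples hs hP₁ 0 y
    simp only [Int.cast_one] at l0 l1
    -- The triples `{y - B, y, y + 1}` and `{y - B, y + 1, y + 2}`, one from each family, share the
    -- pair `y - B, y + 1`.
    have step : ∀ y, P y (y + 1) ↔ P (y + 1) (y + 1 + 1) := by
      intro y
      rw [← (l0 y).2, ← (l1 (y + 1)).1]
      push_cast
      rw [show y + 1 - ((B : ZMod (2 * m)) + 1) = y - B by ring]
    have all := forall_iff_zero (A := fun y => P y (y + 1)) hm step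
    refine forall_key_of_forall_add (K := fun t => t = 1 ∨ t = B ∨ t = B + 1 ∨ t = B + 2) hs (Q := P 0 (0 + 1)) ?_
    rintro t (rfl | rfl | rfl | rfl) x
    · rw [Int.cast_one]
      exact all x
    · rw [← all (x + t), ← (l0 (x + t)).1, add_sub_cancel_right]
    · rw [← all (x + B), ← (l0 (x + B)).2, add_sub_cancel_right]
      push_cast
      rw [add_assoc]
    · rw [← all (x + (B + 1 : ℤ)), ← (l1 (x + (B + 1 : ℤ))).2, add_sub_cancel_right]
      push_cast
      rw [add_assoc, add_assoc, one_add_one_eq_two]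

end Conn

/-! ### Two Langford-type families of triples. -/

/-- The second difference of the first family of triples. -/
def famP (n B d : ℤ) : ℤ :=
  if d % 2 = 1 then B + (n - n / 2) - 1 - d / 2 else B + 2 * (n - n / 2) + n / 2 - d / 2

/-- The second difference of the second family of triples. -/
def famP' (n B d : ℤ) : ℤ :=
  if d % 2 = 1 then B + 2 * (n / 2) + (n - n / 2) - d / 2 else B + n / 2 - d / 2

/-- The differences covered by the two families. -/
def famK (n B t : ℤ) : Prop :=
  (2 ≤ t ∧ t ≤ n ∨ B ≤ t ∧ t ≤ B + 2 * n) ∧ t ≠ B + n / 2 ∧ t ≠ B + 2 * (n - n / 2) + n / 2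

section Family
variable {m k : ℕ} {n B : ℤ}

/-- Put `f = n / 2` and `o = n - f`. For odd `d` the numbers `p` and `d + p` are symmetric about `B
+ o - 1/2` and lie below `B + 2 * o`; for even `d` they are symmetric about `B + 2 * o + f` and lie
at or above `B + 2 * o`. Nested pairs do not collide, and `n < B` keeps them away from the `d`. -/
theorem isTriFamily_famP (hk : n = k + 1) (hB : n < B) (hBm : B + 2 * n < m) :
    IsTriFamily m (fun i : Fin k => (i : ℤ) + 2) fun i => famP n B (i + 2) := by
  constructor
  · intro i; omega
  · intro i
    have := i.2
    unfold famP
    split_ifs <;> omega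
  · intro i
    have := i.2
    unfold famP
    split_ifs <;> omega
  · intro i j h
    ext
    omega
  · intro i j h
    ext
    unfold famP at h
    split_ifs at h <;> omega
  · intro i j h
    ext
    unfold famP at h
    split_ifs at h <;> omega
  · intro i j
    have := i.2
    have := j.2
    unfold famP
    split_ifs <;> omega
  · intro i j
    have := i.2
    have := j.2
    unfold famP
    split_ifs <;> omega
  · intro i j
    have := i.2
    have := j.2
    unfold famP
    split_ifs <;> omega

/-- This is the reversal of the first arrangement within `[B, B + 2 * n]`: the centres become `B + 2
* f + o + 1/2` and `B + f`. -/
theorem isTriFamily_famP' (hk : n = k + 1) (hB : n < B) (hBm : B + 2 * n < m) :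
    IsTriFamily m (fun i : Fin k => (i : ℤ) + 2) fun i => famP' n B (i + 2) := by
  constructor
  · intro i; omega
  · intro i
    have := i.2
    unfold famP'
    split_ifs <;> omega
  · intro i
    have := i.2
    unfold famP'
    split_ifs <;> omega
  · intro i j h
    ext
    omega
  · intro i j h
    ext
    unfold famP' at h
    split_ifs at h <;> omega
  · intro i j h
    ext
    unfold famP' at h
    split_ifs at h <;> omega
  · intro i j
    have := i.2
    have := j.2
    unfold famP'
    split_ifs <;> omega
  · intro i j
    have := i.2
    have := j.2
    unfold famP'
    split_ifs <;> omega
  · intro i j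
    have := i.2
    have := j.2
    unfold famP'
    split_ifs <;> omega

theorem exists_fin_iff (hk : n = k + 1) {Q : ℤ → Prop} :
    (∃ i : Fin k, Q ((i : ℤ) + 2)) ↔ ∃ d, 2 ≤ d ∧ d ≤ n ∧ Q d := by
  constructor
  · rintro ⟨i, h⟩
    have := i.2
    exact ⟨_, by omega, by omega, h⟩
  · rintro ⟨d, h1, h2, h⟩
    refine ⟨⟨(d - 2).toNat, by omega⟩, ?_⟩
    simp only
    rwa [Int.toNat_of_nonneg (by omega), sub_add_cancel]

/-- Since `d` starts at 2, the pair `B + o - 1, B + o` that `d = 1` would use is free. One of the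
two is `B + f`, which `famK` omits, and the parity of `n` tells which; the other is the extra
difference. The centre `B + 2 * o + f` is omitted as well. -/
theorem famK_iff (hn : 3 ≤ n) (hk : n = k + 1) (hB : n < B) (t : ℤ) :
    famK n B t ↔ triSize (fun i : Fin k => (i : ℤ) + 2) (fun i => famP n B (i + 2)) t ∨
      t = if n % 2 = 0 then B + (n - n / 2) - 1 else B + (n - n / 2) := by
  unfold triSize
  rw [exists_fin_iff (Q := fun d => t = d ∨ t = famP n B d ∨ t = d + famP n B d) hk]
  unfold famK famP
  constructor
  · rintro ⟨h1 | h1, h2, h3⟩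
    · exact Or.inl ⟨t, h1.1, h1.2, Or.inl rfl⟩
    · by_cases h4 : t = if n % 2 = 0 then B + (n - n / 2) - 1 else B + (n - n / 2)
      · exact Or.inr h4
      · left
        have h5 : t ≠ B + (n - n / 2) - 1 ∧ t ≠ B + (n - n / 2) := by
          split_ifs at h4 <;> omega
        rcases lt_or_ge t (B + (n - n / 2)) with h | h
        · refine ⟨2 * (B + (n - n / 2) - 1 - t) + 1, by omega, by omega, ?_⟩
          rw [if_pos (by omega)]
          omega
        · rcases lt_or_ge t (B + 2 * (n - n / 2)) with h' | h'
          · refine ⟨2 * (t - (B + (n - n / 2))) + 1, by omega, by omega, ?_⟩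
            rw [if_pos (by omega)]
            omega
          · rcases lt_or_ge t (B + 2 * (n - n / 2) + n / 2) with h'' | h''
            · refine ⟨2 * (B + 2 * (n - n / 2) + n / 2 - t), by omega, by omega, ?_⟩
              rw [if_neg (by omega)]
              omega
            · refine ⟨2 * (t - (B + 2 * (n - n / 2) + n / 2)), by omega, by omega, ?_⟩
              rw [if_neg (by omega)]
              omega
  · rintro (⟨d, h1, h2, h⟩ | h)
    · split_ifs at h <;> omega
    · split_ifs at h <;> omega

/-- After reversal the free pair is `B + 2 * f + o` and its successor; one of them is the omitted `B
+ 2 * o + f`, and the other is `B + 3 * f + 1` for either parity of `n`. -/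
theorem famK_iff' (hn : 3 ≤ n) (hk : n = k + 1) (hB : n < B) (t : ℤ) :
    famK n B t ↔ triSize (fun i : Fin k => (i : ℤ) + 2) (fun i => famP' n B (i + 2)) t ∨
      t = B + 3 * (n / 2) + 1 := by
  unfold triSize
  rw [exists_fin_iff (Q := fun d => t = d ∨ t = famP' n B d ∨ t = d + famP' n B d) hk]
  unfold famK famP'
  constructor
  · rintro ⟨h1 | h1, h2, h3⟩
    · exact Or.inl ⟨t, h1.1, h1.2, Or.inl rfl⟩
    · by_cases h4 : t = B + 3 * (n / 2) + 1
      · exact Or.inr h4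
      · left
        have h5 : t ≠ B + 2 * (n / 2) + (n - n / 2) ∧ t ≠ B + 2 * (n / 2) + (n - n / 2) + 1 := by
          omega
        rcases lt_or_ge t (B + n / 2) with h | h
        · refine ⟨2 * (B + n / 2 - t), by omega, by omega, ?_⟩
          rw [if_neg (by omega)]
          omega
        · rcases le_or_gt t (B + 2 * (n / 2)) with h' | h'
          · refine ⟨2 * (t - (B + n / 2)), by omega, by omega, ?_⟩
            rw [if_neg (by omega)]
            omega
          · rcases lt_or_ge t (B + 2 * (n / 2) + (n - n / 2)) with h'' | h''
            · refine ⟨2 * (B + 2 * (n / 2) + (n - n / 2) - t) + 1, by omega, by omega, ?_⟩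
              rw [if_pos (by omega)]
              omega
            · refine ⟨2 * (t - (B + 2 * (n / 2) + (n - n / 2) + 1)) + 1, by omega, by omega, ?_⟩
              rw [if_pos (by omega)]
              omega
  · rintro (⟨d, h1, h2, h⟩ | h)
    · split_ifs at h <;> omega
    · omega

/-- `hB2` makes both extra differences even, as the prisms require, and both omitted ones odd. -/
theorem hasLinkedGadget_of_ge (hm : 0 < m) {α β : ℤ} (hn : 3 ≤ n) (hk : n = k + 1) (hB : n < B)
    (hB2 : (B - n / 2) % 2 = 1) (hBm : B + 2 * n < m) (hα : α % 2 = 1) (hβ : β % 2 = 1)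
    (hα1 : -(m : ℤ) < α) (hα2 : α ≤ m) (hβ1 : -(m : ℤ) < β) (hβ2 : β ≤ m) (hαβ : α ≠ β)
    (nα : ¬ famK n B |α|) (nβ : ¬ famK n B |β|) :
    HasLinkedGadget m (6 * k) (β : ZMod (2 * m)) (fun t => famK n B |t| ∨ t = α ∨ t = β)
      fun x y => famK n B |key x y| := by
  have F₀ := isTriFamily_famP (k := k) hk hB hBm
  have F₁ := isTriFamily_famP' (k := k) hk hB hBm
  have K₀ := famK_iff (k := k) hn hk hB
  have K₁ := famK_iff' (k := k) hn hk hB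
  refine hasLinkedGadget_of_families hm F₀ F₁ ?_
    (h₀ := if n % 2 = 0 then B + (n - n / 2) - 1 else B + (n - n / 2)) (h₁ := B + 3 * (n / 2) + 1)
    ?_ ?_ ?_ (by omega) (by omega) (by omega) ?_ hα hβ hα1 hα2 hβ1 hβ2 hαβ K₀ K₁ ?_ ?_ nα nβ ?_
  · intro i
    have := i.2
    unfold famP famP'
    split_ifs <;> omega
  · split_ifs <;> omega
  · split_ifs <;> omega
  · split_ifs <;> omega
  · split_ifs <;> omega
  · unfold triSize
    rw [exists_fin_iff (Q := fun d => _ = d ∨ _ = famP n B d ∨ _ = d + famP n B d) hk]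
    rintro ⟨d, h1, h2, h⟩
    unfold famP at h
    split_ifs at h <;> omega
  · unfold triSize
    rw [exists_fin_iff (Q := fun d => _ = d ∨ _ = famP' n B d ∨ _ = d + famP' n B d) hk]
    rintro ⟨d, h1, h2, h⟩
    unfold famP' at h
    split_ifs at h <;> omega
  · intro P hs hP₀ hP₁
    have l0 : ∀ d, 2 ≤ d → d ≤ n → ∀ y : ZMod (2 * m),
        (P (y - (famP n B d : ℤ)) y ↔ P y (y + (d : ℤ))) ∧
        (P (y - (famP n B d : ℤ)) (y + (d : ℤ)) ↔ P y (y + (d : ℤ))) := by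
      intro d h1 h2 y
      have := link_of_triples hs hP₀ ⟨(d - 2).toNat, by omega⟩ y
      simp only at this
      rwa [Int.toNat_of_nonneg (by omega), sub_add_cancel] at this
    have l1 : ∀ d, 2 ≤ d → d ≤ n → ∀ y : ZMod (2 * m),
        (P (y - (famP' n B d : ℤ)) y ↔ P y (y + (d : ℤ))) ∧
        (P (y - (famP' n B d : ℤ)) (y + (d : ℤ)) ↔ P y (y + (d : ℤ))) := by
      intro d h1 h2 y
      have := link_of_triples hs hP₁ ⟨(d - 2).toNat, by omega⟩ y
      simp only at this
      rwa [Int.toNat_of_nonneg (by omega), sub_add_cancel] at this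
    -- For fixed `y`, the long pairs ending at `y` are indexed by their position `z` above `B`.
    let A : ZMod (2 * m) → ℤ → Prop := fun y z => P (y - ((B + z : ℤ) : ZMod (2 * m))) y
    have r0 : ∀ d, 2 ≤ d → d ≤ n → ∀ y : ZMod (2 * m), (A y (famP n B d - B) ↔ P y (y + (d : ℤ))) ∧
        (A y (d + famP n B d - B) ↔ P (y - (d : ℤ)) y) := by
      intro d h1 h2 y
      simp only [A]
      have e := (l0 d h1 h2 (y - (d : ℤ))).2
      rw [sub_add_cancel] at e
      refine ⟨?_, ?_⟩
      · rw [← (l0 d h1 h2 y).1, add_sub_cancel]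
      · rw [← e, add_sub_cancel]
        push_cast
        rw [sub_sub]
    have r1 : ∀ d, 2 ≤ d → d ≤ n → ∀ y : ZMod (2 * m), (A y (famP' n B d - B) ↔ P y (y + (d : ℤ))) ∧
        (A y (d + famP' n B d - B) ↔ P (y - (d : ℤ)) y) := by
      intro d h1 h2 y
      simp only [A]
      have e := (l1 d h1 h2 (y - (d : ℤ))).2
      rw [sub_add_cancel] at e
      refine ⟨?_, ?_⟩
      · rw [← (l1 d h1 h2 y).1, add_sub_cancel]
      · rw [← e, add_sub_cancel]
        push_cast
        rw [sub_sub]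
    -- Both families link the position of `p` to the pair `y, y + d` and that of `d + p` to `y - d,
    -- y`. Comparing them for the same `d` moves a position by `2 * (n / 2) + 1` if `d` is odd and
    -- by `-2 * (n - n / 2)` if `d` is even: a rotation modulo `2 * n + 1`.
    have rot : ∀ y z w, 0 ≤ z → z ≤ 2 * n → z ≠ n / 2 → z ≠ 2 * (n - n / 2) + n / 2 → 0 ≤ w →
        w ≤ 2 * n → w ≠ n / 2 → w ≠ 2 * (n - n / 2) + n / 2 → (A y z ↔ A y w) := by
      intro y z w
      refine iff_of_rotation hn rfl rfl ?_ ?_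
      · intro z h1 h2 h3 h4
        rcases lt_or_ge z (n - n / 2) with h | h
        · have a := (r0 (2 * (n - n / 2 - 1 - z) + 1) (by omega) (by omega) y).1
          have b := (r1 (2 * (n - n / 2 - 1 - z) + 1) (by omega) (by omega) y).1
          rw [← b] at a
          unfold famP famP' at a
          rw [if_pos (by omega), if_pos (by omega)] at a
          convert a using 2 <;> omega
        · have a := (r0 (2 * (z - (n - n / 2)) + 1) (by omega) (by omega) y).2
          have b := (r1 (2 * (z - (n - n / 2)) + 1) (by omega) (by omega) y).2
          rw [← b] at a
          unfold famP famP' at a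
          rw [if_pos (by omega), if_pos (by omega)] at a
          convert a using 2 <;> omega
      · intro z h1 h2 h3
        rcases lt_or_ge z (2 * (n - n / 2) + n / 2) with h | h
        · have a := (r0 (2 * (2 * (n - n / 2) + n / 2 - z)) (by omega) (by omega) y).1
          have b := (r1 (2 * (2 * (n - n / 2) + n / 2 - z)) (by omega) (by omega) y).1
          rw [← b] at a
          unfold famP famP' at a
          rw [if_neg (by omega), if_neg (by omega)] at a
          convert a using 2 <;> omega
        · have a := (r0 (2 * (z - (2 * (n - n / 2) + n / 2))) (by omega) (by omega) y).2
          have b := (r1 (2 * (z - (2 * (n - n / 2) + n / 2))) (by omega) (by omega) y).2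
          rw [← b] at a
          unfold famP famP' at a
          rw [if_neg (by omega), if_neg (by omega)] at a
          convert a using 2 <;> omega
    have dA : ∀ d, 2 ≤ d → d ≤ n → ∀ y : ZMod (2 * m), A y 0 ↔ P y (y + (d : ℤ)) := by
      intro d h1 h2 y
      rw [← (r0 d h1 h2 y).1]
      apply rot <;> first | omega | (unfold famP; split_ifs <;> omega)
    have dA' : ∀ d, 2 ≤ d → d ≤ n → ∀ y : ZMod (2 * m), A y 0 ↔ P (y - (d : ℤ)) y := by
      intro d h1 h2 y
      rw [← (r0 d h1 h2 y).2]
      apply rot <;> first | omega | (unfold famP; split_ifs <;> omega)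
    have shift : ∀ d, 2 ≤ d → d ≤ n → ∀ y : ZMod (2 * m), A y 0 ↔ A (y + (d : ℤ)) 0 := by
      intro d h1 h2 y
      rw [dA d h1 h2, dA' d h1 h2, add_sub_cancel_right]
    -- Translations by 3 and by 2 are available because `3 ≤ n`; together they give translation by
    -- 1.
    have step : ∀ y, A y 0 ↔ A (y + 1) 0 := by
      intro y
      rw [shift 3 (by omega) hn y, shift 2 le_rfl (by omega) (y + 1)]
      push_cast
      rw [show y + 1 + 2 = y + 3 by ring]
    have all := forall_iff_zero hm step
    refine forall_key_of_forall_add (K := famK n B) hs (Q := A 0 0) ?_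
    rintro t ⟨h1 | h1, h2, h3⟩ x
    · rw [← all x, dA t h1.1 h1.2]
    · rw [← all (x + t), ← rot (x + t) (t - B) 0 (by omega) (by omega) (by omega) (by omega)
        le_rfl (by omega) (by omega) (by omega)]
      simp only [A]
      rw [add_sub_cancel, add_sub_cancel_right]

end Family

/-! ### The choice of differences in the nine cases. -/

section Scheme
variable {m : ℕ}

/-- Following both matchings translates the even elements by `β - c`. They are generated by 2, and
by 4 too if `m` is odd, since then `4 * ((m + 1) / 2)` is 2 modulo `2 * m`. -/
theorem connPair_half {β c : ℤ} (hm : 0 < m) (hβ : β % 2 = 1) (hc : c % 2 = 1)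
    (h : β - c = 2 ∨ β - c = -2 ∨ m % 2 = 1 ∧ (β - c = 4 ∨ β - c = -4)) :
    ConnPair (half (β : ZMod (2 * m))) (half (c : ZMod (2 * m))) := by
  have pβ := par_intCast_eq_one (m := m).2 hβ
  have pc := par_intCast_eq_one (m := m).2 hc
  refine connPair_of_cycle (half_invol pβ) (half_invol pc) hm {x | par x = 0} (d := β - c) ?_ ?_ ?_ ?_
  · intro x hx y hy
    have hx' : par x = 0 := hx
    have hy' : par y = 0 := hy
    have h0 : par (((y - x).valMinAbs : ℤ) : ZMod (2 * m)) = 0 := by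
      rw [ZMod.coe_valMinAbs, map_sub, hx', hy', sub_zero]
    rw [par_intCast_eq_zero] at h0
    obtain ⟨t, ht⟩ : ∃ t, (y - x).valMinAbs = 2 * t := ⟨(y - x).valMinAbs / 2, by omega⟩
    have e1 : y = x + ((2 * t : ℤ) : ZMod (2 * m)) := by
      rw [← ht, ZMod.coe_valMinAbs]; ring
    have h2m : ((2 * m : ℤ) : ZMod (2 * m)) = 0 := by
      have := ZMod.natCast_self (2 * m)
      push_cast at this ⊢
      exact this
    rcases h with h | h | ⟨h2, h | h⟩
    · exact ⟨t, by rw [h, mul_comm t 2]; exact e1⟩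
    · exact ⟨-t, by rw [h, show -t * -2 = 2 * t by ring]; exact e1⟩
    · refine ⟨t * ((m + 1) / 2), ?_⟩
      have : t * (((m : ℤ) + 1) / 2) * (β - c) = 2 * t + 2 * m * t := by
        have e : ((m : ℤ) + 1) / 2 * 2 = m + 1 := by omega
        rw [h]
        linear_combination (2 * t) * e
      rw [this, Int.cast_add, Int.cast_mul (2 * (m : ℤ)), h2m, zero_mul, add_zero]
      exact e1
    · refine ⟨-t * ((m + 1) / 2), ?_⟩
      have : -t * (((m : ℤ) + 1) / 2) * (β - c) = 2 * t + 2 * m * t := by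
        have e : ((m : ℤ) + 1) / 2 * 2 = m + 1 := by omega
        rw [h]
        linear_combination (2 * t) * e
      rw [this, Int.cast_add, Int.cast_mul (2 * (m : ℤ)), h2m, zero_mul, add_zero]
      exact e1
  · intro Q h1 h2 x hx hQ
    have hx' : par x = 0 := hx
    have := h2 _ (h1 _ hQ)
    have e1 : half (β : ZMod (2 * m)) x = x + β := if_pos hx'
    have e2 : half (c : ZMod (2 * m)) (half (β : ZMod (2 * m)) x) = x + β - c := by
      have : ¬ par (half (β : ZMod (2 * m)) x) = 0 := by
        rw [par_half pβ, hx']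
        decide
      rw [← e1]
      exact if_neg this
    rw [e2] at this
    push_cast
    rw [← add_sub_assoc]
    exact this
  · intro Q h1 h2 x
    rcases zmod_two_cases (par x) with hx | hx
    · exact ⟨x, hx, Iff.rfl⟩
    · refine ⟨half (β : ZMod (2 * m)) x, ?_, (h1 x).symm⟩
      change par _ = 0
      rw [par_half pβ, hx]
      decide
  · intro x hx
    have hx' : par x = 0 := hx
    change par _ = 0
    rw [map_add, hx', zero_add, par_intCast_eq_zero]
    omega

/-- The parts needed to extend a triple system of order `u` by `2 * m` points are available. -/
def HasScheme (m u : ℕ) : Prop :=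
  ∃ (N M p : ℕ) (β : ZMod (2 * m)) (W V : ℤ → Prop) (R S : ZMod (2 * m) → ZMod (2 * m) → Prop)
    (q : Fin p → ZMod (2 * m) → ZMod (2 * m)) (φ : ℤ → ℤ),
    HasLinkedGadget m N β W R ∧ HasSplitGadget m M q V S ∧ (∀ t, t ≠ 0 → W t → ¬ V t) ∧
    (∀ d : ℤ, d % 2 = 0 → 0 < d → d < m → (W d ∨ V d ↔ W (-d) ∨ V (-d))) ∧
    (∀ d : ℤ, d % 2 = 0 → 0 < d → d < m → ¬ W d → ¬ V d →
      φ d % 2 = 1 ∧ -(m : ℤ) < φ d ∧ φ d ≤ m ∧ ¬ W (φ d) ∧ ¬ V (φ d)) ∧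
    (∀ d d' : ℤ, d % 2 = 0 → 0 < d → d < m → ¬ W d → ¬ V d → d' % 2 = 0 → 0 < d' →
      d' < m → ¬ W d' → ¬ V d' → φ d = φ d' → d = d') ∧
    ((∃ h : 0 < p, ConnPair (half β) (q ⟨0, h⟩)) ∨
      ∃ h : 1 < p, ConnPair (q ⟨0, by omega⟩) (q ⟨1, h⟩)) ∧
    u + N + M + 1 = 2 * m ∧
    ∃ a b c : ZMod (2 * m), a ≠ b ∧ a ≠ c ∧ b ≠ c ∧
      ¬ R a b ∧ ¬ R a c ∧ ¬ R b c ∧ ¬ S a b ∧ ¬ S a c ∧ ¬ S b c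

theorem intCast_ne {s t : ℤ} (h1 : -(m : ℤ) < s) (h2 : s ≤ m) (h3 : -(m : ℤ) < t) (h4 : t ≤ m)
    (h : s ≠ t) : (s : ZMod (2 * m)) ≠ t := fun e => h ((intCast_eq_iff h1 h2 h3 h4).1 e)

theorem eq_of_add_eq {x y : ZMod (2 * m)} {s t : ℤ} (h1 : -(m : ℤ) < s) (h2 : s ≤ m)
    (h3 : -(m : ℤ) < t) (h4 : t ≤ m) (hs : x + (s : ZMod (2 * m)) = y)
    (ht : x + (t : ZMod (2 * m)) = y) : s = t :=
  (intCast_eq_iff h1 h2 h3 h4).1 (add_left_cancel (hs.trans ht.symm))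

theorem abs_key {x y : ZMod (2 * m)} {t : ℤ} (h1 : -(m : ℤ) < t) (h2 : t ≤ m)
    (h : x + (t : ZMod (2 * m)) = y) : |key x y| = |t| := by
  rcases h2.lt_or_eq with h3 | h3
  · rcases key_eq_or h1 h3 h with e | e <;> rw [e]
    exact abs_neg t
  · have : key x y = m := by
      unfold key
      rw [← eq_intCast_iff (by omega) le_rfl, Int.cast_natCast, signedDiff_eq_natCast_self]
      rw [h3, Int.cast_natCast] at h
      exact h
    rw [this, h3]

theorem hasScheme_zero_zero {u : ℕ} (hu : u + 1 = 2 * m) (hm : 8 ≤ m) : HasScheme m u := by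
  refine ⟨0, 0, 1, ((3 : ℤ) : ZMod (2 * m)), _, _, _, _, _, fun d => -(d - 1),
    hasLinkedGadget_zero (z := 3) (by omega) (by omega) (by omega),
    hasSplitGadget_zero (c := 5) (g := 1) (by omega) (by omega) (by omega) (by omega) (by omega)
      (by omega) (by omega), ?_, ?_, ?_, ?_, Or.inl ⟨one_pos, ?_⟩, by omega,
    ((0 : ℤ) : ZMod (2 * m)), ((1 : ℤ) : ZMod (2 * m)), ((2 : ℤ) : ZMod (2 * m)), ?_, ?_, ?_, ?_⟩
  · intro t; omega
  · intro d; omega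
  · intro d h1 h2 h3 h4 h5
    beta_reduce at *
    omega
  · intro d d' h1 h2 h3 h4 h5 h1' h2' h3' h4' h5' h
    beta_reduce at *
    omega
  · exact connPair_half (by omega) (by omega) (by omega) (by omega)
  · exact intCast_ne (by omega) (by omega) (by omega) (by omega) (by omega)
  · exact intCast_ne (by omega) (by omega) (by omega) (by omega) (by omega)
  · exact intCast_ne (by omega) (by omega) (by omega) (by omega) (by omega)
  · simp

/-- The split gadget uses the differences 2, 5, 7 with both signs. The rule `d ↦ -(d - 1)` would
send 6 and 8 to occupied values, whence the exceptions. Of the pairs among `0, -2, -6`, the first is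
an excluded edge of the gadget, and the differences 4 and 6 are not used by it. -/
theorem hasScheme_zero_one {u : ℕ} (hu : u + 3 = 2 * m) (hm : 9 ≤ m) (h3 : m % 3 = 0) :
    HasScheme m u := by
  obtain ⟨q, hq, hX⟩ := hasSplitGadget_one (m := m) (a := -5) (b := -2) (by omega) (by omega)
    (by omega) (by omega) (by omega) (by omega) (by omega) (by omega) (by omega) (by omega)
    (by omega) (e := 3) (by omega) (by norm_num)
  refine ⟨0, 2, 2, ((3 : ℤ) : ZMod (2 * m)), _, _, _, _, _,
    fun d => if d = 4 then -3 else if d = 6 then -1 else if d = 8 then 1 else -(d - 1),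
    hasLinkedGadget_zero (z := 3) (by omega) (by omega) (by omega), hX,
    ?_, ?_, ?_, ?_, Or.inr ⟨one_lt_two, hq⟩, by omega,
    ((0 : ℤ) : ZMod (2 * m)), ((-2 : ℤ) : ZMod (2 * m)), ((-6 : ℤ) : ZMod (2 * m)),
    ?_, ?_, ?_, id, id, id, ?_, ?_, ?_⟩
  · intro t; omega
  · intro d; omega
  · intro d h1 h2 h3 h4 h5
    beta_reduce at *
    split_ifs
    · norm_num; omega
    · norm_num; omega
    · norm_num; omega
    · omega
  · intro d d' h1 h2 h3 h4 h5 h1' h2' h3' h4' h5' h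
    beta_reduce at *
    split_ifs at h <;> omega
  · exact intCast_ne (by omega) (by omega) (by omega) (by omega) (by omega)
  · exact intCast_ne (by omega) (by omega) (by omega) (by omega) (by omega)
  · exact intCast_ne (by omega) (by omega) (by omega) (by omega) (by omega)
  · rintro ⟨-, h, -⟩
    exact h ⟨by push_cast; ring, by rw [Int.cast_zero, map_zero]⟩
  · rintro ⟨⟨t, ht, h⟩, -⟩
    have := eq_of_add_eq (s := t) (t := -6) (by omega) (by omega) (by omega) (by omega) ht
      (by push_cast; ring)
    omega
  · rintro ⟨⟨t, ht, h⟩, -⟩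
    have := eq_of_add_eq (s := t) (t := -4) (by omega) (by omega) (by omega) (by omega) ht
      (by push_cast; ring)
    omega

theorem hasScheme_zero_two {u : ℕ} (hu : u + 5 = 2 * m) (hm : 12 ≤ m) (h3 : m % 3 = 0) :
    HasScheme m u := by
  obtain ⟨q, hX⟩ := hasSplitGadget_two (m := m) (a := -8) (b := -2) (c := 9) (by omega) (by omega)
    (by omega) (by omega) (by omega) (by omega) (by omega) (by omega) (by omega) (by omega)
    (by omega) (by omega) (by omega) (by omega) (by omega) (by omega) (by omega) (by omega)
    (by omega) (by omega) (by omega) (by omega) (by omega)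
  refine ⟨0, 4, 2, ((7 : ℤ) : ZMod (2 * m)), _, _, _, _, _, fun d => -(d - 1),
    hasLinkedGadget_zero (z := 7) (by omega) (by omega) (by omega), hX,
    ?_, ?_, ?_, ?_, Or.inl ⟨two_pos, ?_⟩, by omega,
    ((0 : ℤ) : ZMod (2 * m)), ((-2 : ℤ) : ZMod (2 * m)), ((-9 : ℤ) : ZMod (2 * m)),
    ?_, ?_, ?_, id, id, id, ?_, ?_, ?_⟩
  · intro t; omega
  · intro d; omega
  · intro d h1 h2 h3 h4 h5
    beta_reduce at *
    omega
  · intro d d' h1 h2 h3 h4 h5 h1' h2' h3' h4' h5' h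
    beta_reduce at *
    omega
  · exact connPair_half (by omega) (by omega) (by omega) (by omega)
  · exact intCast_ne (by omega) (by omega) (by omega) (by omega) (by omega)
  · exact intCast_ne (by omega) (by omega) (by omega) (by omega) (by omega)
  · exact intCast_ne (by omega) (by omega) (by omega) (by omega) (by omega)
  · rintro ⟨-, h⟩
    exact h ⟨by push_cast; ring, by rw [Int.cast_zero, map_zero]⟩
  · rintro ⟨⟨t, ht, h⟩, -⟩
    have := eq_of_add_eq (s := t) (t := -9) (by omega) (by omega) (by omega) (by omega) ht
      (by push_cast; ring)
    omega
  · rintro ⟨⟨t, ht, h⟩, -⟩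
    have := eq_of_add_eq (s := t) (t := -7) (by omega) (by omega) (by omega) (by omega) ht
      (by push_cast; ring)
    omega

end Scheme

section Scheme
variable {m : ℕ}

theorem hasScheme_one_zero {u : ℕ} (hu : u + 7 = 2 * m) (hm : 11 ≤ m) : HasScheme m u := by
  refine ⟨6, 0, 1, ((7 : ℤ) : ZMod (2 * m)), _, _, _, _, _, fun d => if d = 2 then -3 else -(d - 1),
    hasLinkedGadget_one (B := 4) (α := 3) (β := 7) (by omega) (by omega) (by omega) (by omega)
      (by omega) (by omega) (by omega) (by omega) (by omega) (by omega) (by omega) (by norm_num)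
      (by norm_num),
    hasSplitGadget_zero (c := 9) (g := 11) (by omega) (by omega) (by omega) (by omega) (by omega)
      (by omega) (by omega), ?_, ?_, ?_, ?_, Or.inl ⟨one_pos, ?_⟩, by omega,
    ((0 : ℤ) : ZMod (2 * m)), ((2 : ℤ) : ZMod (2 * m)), ((9 : ℤ) : ZMod (2 * m)), ?_, ?_, ?_, ?_, ?_,
    ?_, id, id, id⟩
  · intro t
    have := abs_cases t
    omega
  · intro d h1 h2 h3
    rw [abs_neg, abs_of_pos h2]
    omega
  · intro d h1 h2 h3 h4 h5
    beta_reduce at *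
    obtain ⟨f, hf⟩ : ∃ f, f = if d = 2 then -3 else -(d - 1) := ⟨_, rfl⟩
    rw [← hf]
    have h6 := abs_cases f
    rw [abs_of_pos h2] at h4
    split_ifs at hf <;> omega
  · intro d d' h1 h2 h3 h4 h5 h1' h2' h3' h4' h5' h
    beta_reduce at *
    rw [abs_of_pos h2] at h4
    rw [abs_of_pos h2'] at h4'
    split_ifs at h <;> omega
  · exact connPair_half (by omega) (by omega) (by omega) (by omega)
  · exact intCast_ne (by omega) (by omega) (by omega) (by omega) (by omega)
  · exact intCast_ne (by omega) (by omega) (by omega) (by omega) (by omega)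
  · exact intCast_ne (by omega) (by omega) (by omega) (by omega) (by omega)
  · rw [abs_key (t := 2) (by omega) (by omega) (by push_cast; ring)]
    norm_num
  · rw [abs_key (t := 9) (by omega) (by omega) (by push_cast; ring)]
    norm_num
  · rw [abs_key (t := 7) (by omega) (by omega) (by push_cast; ring)]
    norm_num

/-- The triples use 1, 8, 9, 10 and the split gadget 2, 5, 7, while 3 and -3 are the distinguished
matchings. Hence `φ` sends 4 and 6 to 11 and -11, and 12 to -13 because 11 is taken. -/
theorem hasScheme_one_one {u : ℕ} (hu : u + 9 = 2 * m) (hm : 12 ≤ m) (h3 : m % 3 = 0) :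
    HasScheme m u := by
  obtain ⟨q, hq, hX⟩ := hasSplitGadget_one (m := m) (a := -5) (b := -2) (by omega) (by omega)
    (by omega) (by omega) (by omega) (by omega) (by omega) (by omega) (by omega) (by omega)
    (by omega) (e := 3) (by omega) (by norm_num)
  refine ⟨6, 2, 2, ((-3 : ℤ) : ZMod (2 * m)), _, _, _, _, _,
    fun d => if d = 4 then 11 else if d = 6 then -11 else if d = 12 then -13 else d - 1,
    hasLinkedGadget_one (B := 8) (α := 3) (β := -3) (by omega) (by omega) (by omega) (by omega)
      (by omega) (by omega) (by omega) (by omega) (by omega) (by omega) (by omega) (by norm_num)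
      (by norm_num), hX,
    ?_, ?_, ?_, ?_, Or.inr ⟨one_lt_two, hq⟩, by omega,
    ((0 : ℤ) : ZMod (2 * m)), ((-2 : ℤ) : ZMod (2 * m)), ((-6 : ℤ) : ZMod (2 * m)),
    ?_, ?_, ?_, ?_, ?_, ?_, ?_, ?_, ?_⟩
  · intro t
    have := abs_cases t
    omega
  · intro d h1 h2 h3
    rw [abs_neg, abs_of_pos h2]
    omega
  · intro d h1 h2 h3 h4 h5
    beta_reduce at *
    obtain ⟨f, hf⟩ : ∃ f, f = if d = 4 then 11 else if d = 6 then -11 else if d = 12 then -13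
      else d - 1 := ⟨_, rfl⟩
    rw [← hf]
    have h6 := abs_cases f
    rw [abs_of_pos h2] at h4
    split_ifs at hf <;> omega
  · intro d d' h1 h2 h3 h4 h5 h1' h2' h3' h4' h5' h
    beta_reduce at *
    rw [abs_of_pos h2] at h4
    rw [abs_of_pos h2'] at h4'
    split_ifs at h <;> omega
  · exact intCast_ne (by omega) (by omega) (by omega) (by omega) (by omega)
  · exact intCast_ne (by omega) (by omega) (by omega) (by omega) (by omega)
  · exact intCast_ne (by omega) (by omega) (by omega) (by omega) (by omega)
  · rw [abs_key (t := -2) (by omega) (by omega) (by push_cast; ring)]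
    norm_num
  · rw [abs_key (t := -6) (by omega) (by omega) (by push_cast; ring)]
    norm_num
  · rw [abs_key (t := -4) (by omega) (by omega) (by push_cast; ring)]
    norm_num
  · rintro ⟨-, h, -⟩
    exact h ⟨by push_cast; ring, by rw [Int.cast_zero, map_zero]⟩
  · rintro ⟨⟨t, ht, h⟩, -⟩
    have := eq_of_add_eq (s := t) (t := -6) (by omega) (by omega) (by omega) (by omega) ht
      (by push_cast; ring)
    omega
  · rintro ⟨⟨t, ht, h⟩, -⟩
    have := eq_of_add_eq (s := t) (t := -4) (by omega) (by omega) (by omega) (by omega) ht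
      (by push_cast; ring)
    omega

theorem hasScheme_one_two {u : ℕ} (hu : u + 11 = 2 * m) (hm : 15 ≤ m) (h3 : m % 3 = 0) :
    HasScheme m u := by
  obtain ⟨q, hX⟩ := hasSplitGadget_two (m := m) (a := -8) (b := -2) (c := 9) (by omega) (by omega)
    (by omega) (by omega) (by omega) (by omega) (by omega) (by omega) (by omega) (by omega)
    (by omega) (by omega) (by omega) (by omega) (by omega) (by omega) (by omega) (by omega)
    (by omega) (by omega) (by omega) (by omega) (by omega)
  refine ⟨6, 4, 2, ((7 : ℤ) : ZMod (2 * m)), _, _, _, _, _, fun d => -(d - 1),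
    hasLinkedGadget_one (B := 4) (α := 3) (β := 7) (by omega) (by omega) (by omega) (by omega)
      (by omega) (by omega) (by omega) (by omega) (by omega) (by omega) (by omega) (by norm_num)
      (by norm_num), hX,
    ?_, ?_, ?_, ?_, Or.inl ⟨two_pos, ?_⟩, by omega,
    ((0 : ℤ) : ZMod (2 * m)), ((-2 : ℤ) : ZMod (2 * m)), ((-9 : ℤ) : ZMod (2 * m)),
    ?_, ?_, ?_, ?_, ?_, ?_, ?_, ?_, ?_⟩
  · intro t
    have := abs_cases t
    omega
  · intro d h1 h2 h3
    rw [abs_neg, abs_of_pos h2]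
    omega
  · intro d h1 h2 h3 h4 h5
    beta_reduce at *
    have h6 := abs_cases (-(d - 1))
    rw [abs_of_pos h2] at h4
    omega
  · intro d d' h1 h2 h3 h4 h5 h1' h2' h3' h4' h5' h
    beta_reduce at *
    omega
  · exact connPair_half (by omega) (by omega) (by omega) (by omega)
  · exact intCast_ne (by omega) (by omega) (by omega) (by omega) (by omega)
  · exact intCast_ne (by omega) (by omega) (by omega) (by omega) (by omega)
  · exact intCast_ne (by omega) (by omega) (by omega) (by omega) (by omega)
  · rw [abs_key (t := -2) (by omega) (by omega) (by push_cast; ring)]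
    norm_num
  · rw [abs_key (t := -9) (by omega) (by omega) (by push_cast; ring)]
    norm_num
  · rw [abs_key (t := -7) (by omega) (by omega) (by push_cast; ring)]
    norm_num
  · rintro ⟨-, h⟩
    exact h ⟨by push_cast; ring, by rw [Int.cast_zero, map_zero]⟩
  · rintro ⟨⟨t, ht, h⟩, -⟩
    have := eq_of_add_eq (s := t) (t := -9) (by omega) (by omega) (by omega) (by omega) ht
      (by push_cast; ring)
    omega
  · rintro ⟨⟨t, ht, h⟩, -⟩
    have := eq_of_add_eq (s := t) (t := -7) (by omega) (by omega) (by omega) (by omega) ht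
      (by push_cast; ring)
    omega

/-- The first difference above `n` that is a base for the families. -/
def famBase (n : ℤ) : ℤ := if (n + 1 - n / 2) % 2 = 1 then n + 1 else n + 2

theorem famBase_spec (n : ℤ) : (famBase n - n / 2) % 2 = 1 ∧
    (famBase n = n + 1 ∨ famBase n = n + 2) := by
  unfold famBase
  split_ifs <;> omega

/-- Odd differences assigned to the even ones outside the families. -/
def famPhi (n B d : ℤ) : ℤ :=
  if d = B + 2 * n + 1 then B + 2 * (n - n / 2) + n / 2
  else if d = n + 1 then -(B + 2 * (n - n / 2) + n / 2) else -(d - 1)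

theorem famPhi_spec {n B d : ℤ} : d = B + 2 * n + 1 ∧ famPhi n B d = B + 2 * (n - n / 2) + n / 2 ∨
    d ≠ B + 2 * n + 1 ∧ d = n + 1 ∧ famPhi n B d = -(B + 2 * (n - n / 2) + n / 2) ∨
    d ≠ B + 2 * n + 1 ∧ d ≠ n + 1 ∧ famPhi n B d = -(d - 1) := by
  unfold famPhi
  split_ifs <;> simp_all

theorem famK_abs {n B t : ℤ} (hn : 3 ≤ n) (hB : n < B) (h : famK n B |t|) :
    -(B + 2 * n) ≤ t ∧ t ≤ B + 2 * n ∧ (t < -1 ∨ 1 < t) ∧ t ≠ B + n / 2 ∧ t ≠ -(B + n / 2) ∧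
      t ≠ B + 2 * (n - n / 2) + n / 2 ∧ t ≠ -(B + 2 * (n - n / 2) + n / 2) := by
  obtain ⟨h1, h2, h3⟩ := h
  have h4 : |t| ≤ B + 2 * n ∧ 2 ≤ |t| := by omega
  clear h1
  rcases abs_choice t with e | e <;> rw [e] at h2 h3 h4 <;>
    exact ⟨by omega, by omega, by omega, by omega, by omega, by omega, by omega⟩

theorem even_of_not_famK {n B d : ℤ} (hB2 : (B - n / 2) % 2 = 1) (hB : B = n + 1 ∨ B = n + 2)
    (hd : d % 2 = 0) (h0 : 0 < d) (h : ¬ famK n B d) : d = n + 1 ∧ B = n + 2 ∨ B + 2 * n < d := by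
  by_contra hc
  apply h
  refine ⟨?_, by omega, by omega⟩
  rcases le_or_gt d n with h1 | h1
  · exact Or.inl (by omega)
  · exact Or.inr (by omega)

/-- The even differences outside the families are those above `B + 2 * n`, and `n + 1` if `B = n +
2`. The rule `d ↦ -(d - 1)` fails only where it lands on an end of a family, at `B + 2 * n + 1` and
at `n + 1`; these get the two signs of the omitted difference `B + 2 * (n - n / 2) + n / 2`. The
matchings for 1 and -1 start the chain. -/
theorem hasScheme_ge_zero {u k : ℕ} (hk : 2 ≤ k) (hu : u + 6 * k + 1 = 2 * m) (hm : 3 * k + 8 ≤ m) :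
    HasScheme m u := by
  obtain ⟨n, hn⟩ : ∃ n : ℤ, n = k + 1 := ⟨_, rfl⟩
  obtain ⟨B, hB⟩ : ∃ B, B = famBase n := ⟨_, rfl⟩
  obtain ⟨hB2, hB1⟩ := famBase_spec n
  rw [← hB] at hB2 hB1
  refine ⟨6 * k, 0, 1, ((1 : ℤ) : ZMod (2 * m)), _, _, _, _, _, famPhi n B,
    hasLinkedGadget_of_ge (k := k) (n := n) (B := B) (α := B + n / 2) (β := 1) (by omega) (by omega)
      hn (by omega) hB2 (by omega) (by omega) (by omega) (by omega) (by omega) (by omega) (by omega)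
      (by omega) ?_ ?_,
    hasSplitGadget_zero (c := -1) (g := -(B + n / 2)) (by omega) (by omega) (by omega) (by omega)
      (by omega) (by omega) (by omega), ?_, ?_, ?_, ?_, Or.inl ⟨one_pos, ?_⟩, by omega,
    ((0 : ℤ) : ZMod (2 * m)), ((1 : ℤ) : ZMod (2 * m)), ((m : ℤ) : ZMod (2 * m)), ?_, ?_, ?_, ?_, ?_,
    ?_, id, id, id⟩
  · rw [abs_of_pos (by omega)]
    unfold famK
    omega
  · rw [abs_one]
    unfold famK
    omega
  · intro t
    have := abs_cases t
    unfold famK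
    omega
  · intro d h1 h2 h3
    rw [abs_neg, abs_of_pos h2]
    unfold famK
    omega
  · intro d h1 h2 h3 h4 h5
    have h6 := abs_cases (famPhi n B d)
    have h7 := famPhi_spec (n := n) (B := B) (d := d)
    rw [abs_of_pos h2] at h4
    unfold famK at h4 ⊢
    generalize famPhi n B d = f at *
    have h8 : d = n + 1 ∧ B = n + 2 ∨ B + 2 * n < d := by omega
    clear h4
    omega
  · intro d d' h1 h2 h3 h4 h5 h1' h2' h3' h4' h5' h
    rw [abs_of_pos h2] at h4
    rw [abs_of_pos h2'] at h4'
    have h7 := famPhi_spec (n := n) (B := B) (d := d)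
    have h7' := famPhi_spec (n := n) (B := B) (d := d')
    have h8 : d = n + 1 ∧ B = n + 2 ∨ B + 2 * n < d := by unfold famK at h4; omega
    have h8' : d' = n + 1 ∧ B = n + 2 ∨ B + 2 * n < d' := by unfold famK at h4'; omega
    clear h4 h4'
    omega
  · exact connPair_half (by omega) (by omega) (by omega) (by omega)
  · exact intCast_ne (by omega) (by omega) (by omega) (by omega) (by omega)
  · exact intCast_ne (by omega) (by omega) (by omega) (by omega) (by omega)
  · exact intCast_ne (by omega) (by omega) (by omega) (by omega) (by omega)
  · rw [abs_key (t := 1) (by omega) (by omega) (by push_cast; ring), abs_one]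
    unfold famK
    omega
  · rw [abs_key (t := m) (by omega) (by omega) (by push_cast; ring), abs_of_pos (by omega)]
    unfold famK
    omega
  · rw [abs_key (t := m - 1) (by omega) (by omega) (by push_cast; ring), abs_of_pos (by omega)]
    unfold famK
    omega

end Scheme

section Scheme
variable {m : ℕ}

-- The split gadget uses `m - 1`, `m - 2` and 1, beyond and below the families. The signs of `a` and
-- `b` depend on the parity of `m`, so that they are 1 and 4 modulo 6; in both cases `a + b = -1`
-- and `b - a` is `3` or `-3` modulo `2 * m`.
set_option maxHeartbeats 1000000 in
theorem hasScheme_ge_one {u k : ℕ} (hk : 2 ≤ k) (hu : u + 6 * k + 3 = 2 * m) (hm : 3 * k + 9 ≤ m)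
    (h3 : m % 3 = 0) : HasScheme m u := by
  obtain ⟨n, hn⟩ : ∃ n : ℤ, n = k + 1 := ⟨_, rfl⟩
  obtain ⟨B, hB⟩ : ∃ B, B = famBase n := ⟨_, rfl⟩
  obtain ⟨hB2, hB1⟩ := famBase_spec n
  rw [← hB] at hB2 hB1
  have hmm := natCast_add_self (m := m)
  -- `t₀` is the representative of `a - 1` in the range of `key`.
  obtain ⟨a, b, e, t₀, hab, hba, ht₀⟩ : ∃ a b e t₀ : ℤ,
      ((m : ℤ) % 2 = 0 ∧ a = 1 - m ∧ b = m - 2 ∧ e = -3 ∧ t₀ = m ∨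
        (m : ℤ) % 2 = 1 ∧ a = m - 2 ∧ b = 1 - m ∧ e = 3 ∧ t₀ = m - 3) ∧
      ((b - a : ℤ) : ZMod (2 * m)) = e ∧ ((1 : ℤ) : ZMod (2 * m)) + (t₀ : ZMod (2 * m)) = a := by
    rcases Int.emod_two_eq_zero_or_one (m : ℤ) with h | h
    · refine ⟨_, _, _, _, Or.inl ⟨h, rfl, rfl, rfl, rfl⟩, ?_, ?_⟩
      · push_cast
        linear_combination hmm
      · push_cast
        linear_combination hmm
    · refine ⟨_, _, _, _, Or.inr ⟨h, rfl, rfl, rfl, rfl⟩, ?_, ?_⟩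
      · push_cast
        linear_combination -hmm
      · push_cast
        ring
  have ha : B + 2 * n < a ∧ a < m ∨ -(m : ℤ) < a ∧ a < -(B + 2 * n) := by omega
  have ht1 : B + 2 * n < t₀ ∧ t₀ ≤ m := by omega
  have hV : ∀ t, (t = a ∨ t = b ∨ t = a + b ∨ t = -a ∨ t = -b ∨ t = -(a + b)) ↔
      (t = m - 1 ∨ t = m - 2 ∨ t = 1 ∨ t = -(m - 1) ∨ t = -(m - 2) ∨ t = -1) := by
    rcases hab with ⟨-, rfl, rfl, -, -⟩ | ⟨-, rfl, rfl, -, -⟩ <;> intro t <;>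
      constructor <;> intro h <;> omega
  have h6 : 6 ∣ 2 * m := by omega
  obtain ⟨q, hq, hX⟩ := hasSplitGadget_one (m := m) (a := a) (b := b) h6 (by omega)
    (by omega) (by omega) (by omega) (by omega) (by omega) (by omega) (by omega) (by omega)
    (by omega) (e := e) (by omega) hba
  refine ⟨6 * k, 2, 2, ((-(B + n / 2) : ℤ) : ZMod (2 * m)), _, _, _, _, _, famPhi n B,
    hasLinkedGadget_of_ge (k := k) (n := n) (B := B) (α := B + n / 2) (β := -(B + n / 2)) (by omega)
      (by omega) hn (by omega) hB2 (by omega) (by omega) (by omega) (by omega) (by omega) (by omega)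
      (by omega) (by omega) ?_ ?_, hX,
    ?_, ?_, ?_, ?_, Or.inr ⟨one_lt_two, hq⟩, by omega,
    ((1 : ℤ) : ZMod (2 * m)), ((1 + a : ℤ) : ZMod (2 * m)), ((a : ℤ) : ZMod (2 * m)),
    ?_, ?_, ?_, ?_, ?_, ?_, ?_, ?_, ?_⟩
  · rw [abs_of_pos (by omega)]
    unfold famK
    omega
  · rw [abs_neg, abs_of_pos (by omega)]
    unfold famK
    omega
  · intro t _ h h'
    rw [hV] at h'
    clear hV hab ha ht1
    rcases h with h | h
    · have := famK_abs (by omega) (by omega) h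
      omega
    · omega
  · intro d h1 h2 h3
    rw [abs_neg, abs_of_pos h2, hV, hV]
    clear hV hab ha ht1
    refine or_congr (or_congr_right ?_) ?_ <;> omega
  · intro d h1 h2 h3 h4 h5
    have h7 := famPhi_spec (n := n) (B := B) (d := d)
    have h8 := even_of_not_famK hB2 hB1 h1 h2 fun h => h4 (Or.inl (by rw [abs_of_pos h2]; exact h))
    rw [hV] at h5 ⊢
    generalize famPhi n B d = f at *
    clear hV hab ha ht1 h4
    refine ⟨by omega, by omega, by omega, ?_, by omega⟩
    rintro (h | h)
    · have h := famK_abs (by omega) (by omega) h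
      omega
    · omega
  · intro d d' h1 h2 h3 h4 h5 h1' h2' h3' h4' h5' h
    have h7 := famPhi_spec (n := n) (B := B) (d := d)
    have h7' := famPhi_spec (n := n) (B := B) (d := d')
    have h8 := even_of_not_famK hB2 hB1 h1 h2 fun h => h4 (Or.inl (by rw [abs_of_pos h2]; exact h))
    have h8' := even_of_not_famK hB2 hB1 h1' h2' fun h =>
      h4' (Or.inl (by rw [abs_of_pos h2']; exact h))
    clear hV hab ha ht1 h4 h4' h5 h5'
    omega
  · clear hab
    exact intCast_ne (by omega) (by omega) (by omega) (by omega) (by omega)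
  · clear hab
    exact intCast_ne (by omega) (by omega) (by omega) (by omega) (by omega)
  · clear hab
    exact intCast_ne (by omega) (by omega) (by omega) (by omega) (by omega)
  · clear hab
    rw [abs_key (t := a) (by omega) (by omega) (by push_cast; ring)]
    intro h
    have := famK_abs (by omega) (by omega) h
    omega
  · clear hab
    rw [abs_key (t := t₀) (by omega) (by omega) ht₀]
    intro h
    have := famK_abs (by omega) (by omega) h
    omega
  · rw [abs_key (t := -1) (by omega) (by omega) (by push_cast; ring), abs_neg, abs_one]
    unfold famK
    omega
  · rintro ⟨-, -, h, -⟩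
    exact h ⟨by push_cast; ring, by rw [Int.cast_one, map_one]⟩
  · rintro ⟨⟨t, ht, h⟩, -⟩
    have := eq_of_add_eq (s := t) (t := t₀) (by omega) (by omega) (by omega) (by omega) ht ht₀
    omega
  · rintro ⟨-, -, -, h⟩
    refine h ⟨?_, residue_intCast h6 (r := 2) (by omega)⟩
    rw [show a + b = -1 by omega]
    push_cast
    ring

-- The split gadget uses `m - 5`, 1, `m - 4` and `m`. The odd differences `β` and `c` near `m` must
-- avoid these and differ by 2, or by 4 for odd `m`. For odd `m` the even difference `m - 3` would
-- go to the occupied `-(m - 4)`; it takes `-(m - 6)`, which is free because `m - 5` belongs to the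
-- gadget.
set_option maxHeartbeats 1000000 in
theorem hasScheme_ge_two {u k : ℕ} (hk : 2 ≤ k) (hu : u + 6 * k + 5 = 2 * m) (hm : 3 * k + 12 ≤ m)
    (h3 : m % 3 = 0) : HasScheme m u := by
  obtain ⟨n, hn⟩ : ∃ n : ℤ, n = k + 1 := ⟨_, rfl⟩
  obtain ⟨B, hB⟩ : ∃ B, B = famBase n := ⟨_, rfl⟩
  obtain ⟨hB2, hB1⟩ := famBase_spec n
  rw [← hB] at hB2 hB1
  obtain ⟨β, c, hβc⟩ : ∃ β c : ℤ, (m : ℤ) % 2 = 0 ∧ β = m - 3 ∧ c = m - 1 ∨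
      (m : ℤ) % 2 = 1 ∧ β = m - 6 ∧ c = m - 2 := by
    rcases Int.emod_two_eq_zero_or_one (m : ℤ) with h | h
    · exact ⟨_, _, Or.inl ⟨h, rfl, rfl⟩⟩
    · exact ⟨_, _, Or.inr ⟨h, rfl, rfl⟩⟩
  obtain ⟨q, hX⟩ := hasSplitGadget_two (m := m) (a := m - 5) (b := 1) (c := c) (by omega) (by omega)
    (by omega) (by omega) (by omega) (by omega) (by omega) (by omega) (by omega) (by omega)
    (by omega) (by omega) (by omega) (by omega) (by omega) (by omega) (by omega) (by omega)
    (by omega) (by omega) (by omega) (by omega) (by omega)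
  refine ⟨6 * k, 4, 2, (β : ZMod (2 * m)), _, _, _, _, _,
    fun d => if d = m - 3 then -(m - 6) else famPhi n B d,
    hasLinkedGadget_of_ge (k := k) (n := n) (B := B) (α := B + n / 2) (β := β) (by omega)
      (by omega) hn (by omega) hB2 (by omega) (by omega) (by omega) (by omega) (by omega) (by omega)
      (by omega) (by omega) ?_ ?_, hX,
    ?_, ?_, ?_, ?_, Or.inl ⟨two_pos, ?_⟩, by omega,
    ((0 : ℤ) : ZMod (2 * m)), ((1 : ℤ) : ZMod (2 * m)), ((m : ℤ) : ZMod (2 * m)),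
    ?_, ?_, ?_, ?_, ?_, ?_, ?_, ?_, ?_⟩
  · rw [abs_of_pos (by omega)]
    unfold famK
    omega
  · rw [abs_of_pos (by omega)]
    unfold famK
    omega
  · rintro t - (h | h) h' <;> beta_reduce at h' <;> [have h := famK_abs (by omega) (by omega) h; skip] <;> omega
  · intro d h1 h2 h3
    rw [abs_neg, abs_of_pos h2]
    unfold famK
    omega
  · intro d h1 h2 h3 h4 h5
    beta_reduce at *
    obtain ⟨f, hf⟩ : ∃ f, f = if d = m - 3 then -((m : ℤ) - 6) else famPhi n B d := ⟨_, rfl⟩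
    rw [← hf]
    have h7 := famPhi_spec (n := n) (B := B) (d := d)
    rw [abs_of_pos h2] at h4
    have h8 := even_of_not_famK hB2 hB1 h1 h2 fun h => h4 (Or.inl h)
    have h9 : d ≠ m - 5 := fun h => h5 (by omega)
    have h9' : d ≠ m - 4 := fun h => h5 (by omega)
    clear h4 h5
    have h10 : f = -(m - 6) ∧ (m : ℤ) % 2 = 1 ∨ d ≠ m - 3 ∧ f = famPhi n B d := by
      split_ifs at hf with h
      · left; omega
      · exact Or.inr ⟨h, hf⟩
    generalize famPhi n B d = g at *
    clear hf
    refine ⟨by omega, by omega, by omega, ?_, by omega⟩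
    rintro (h | h) <;> [have h := famK_abs (by omega) (by omega) h; skip] <;> omega
  · intro d d' h1 h2 h3 h4 h5 h1' h2' h3' h4' h5' h
    beta_reduce at *
    rw [abs_of_pos h2] at h4
    rw [abs_of_pos h2'] at h4'
    have h7 := famPhi_spec (n := n) (B := B) (d := d)
    have h7' := famPhi_spec (n := n) (B := B) (d := d')
    have h8 := even_of_not_famK hB2 hB1 h1 h2 fun h => h4 (Or.inl h)
    have h8' := even_of_not_famK hB2 hB1 h1' h2' fun h => h4' (Or.inl h)
    have h9 : d ≠ m - 5 := fun h => h5 (by omega)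
    have h9' : d' ≠ m - 5 := fun h => h5' (by omega)
    clear h4 h4' h5 h5'
    generalize famPhi n B d = g at *
    generalize famPhi n B d' = g' at *
    split_ifs at h <;> omega
  · exact connPair_half (by omega) (by omega) (by omega) (by omega)
  · exact intCast_ne (by omega) (by omega) (by omega) (by omega) (by omega)
  · exact intCast_ne (by omega) (by omega) (by omega) (by omega) (by omega)
  · exact intCast_ne (by omega) (by omega) (by omega) (by omega) (by omega)
  · rw [abs_key (t := 1) (by omega) (by omega) (by push_cast; ring), abs_one]
    unfold famK
    omega
  · rw [abs_key (t := m) (by omega) (by omega) (by push_cast; ring), abs_of_pos (by omega)]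
    unfold famK
    omega
  · rw [abs_key (t := m - 1) (by omega) (by omega) (by push_cast; ring), abs_of_pos (by omega)]
    unfold famK
    omega
  · rintro ⟨-, h⟩
    exact h ⟨by push_cast; ring, by rw [Int.cast_zero, map_zero]⟩
  · rintro ⟨⟨t, ht, h⟩, -⟩
    have := eq_of_add_eq (s := t) (t := m) (by omega) (by omega) (by omega) (by omega) ht
      (by push_cast; ring)
    omega
  · rintro ⟨⟨t, ht, h⟩, -⟩
    have := eq_of_add_eq (s := t) (t := m - 1) (by omega) (by omega) (by omega) (by omega) ht
      (by push_cast; ring)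
    omega

/-- Admissibility of `u` and `u + 2 * m` gives `r = 1` only for `u` congruent to 3 and `r = 2` only
for `u` congruent to 1 modulo 6, with 3 dividing `m` in both cases. So `13 < u` means `u ≥ 15`, and
`u ≥ 19` if `r = 2`, which yields the lower bounds on `m`. -/
theorem hasScheme {u : ℕ} (hu : 13 < u) (hu' : Admissible u) (hv : Admissible (u + 2 * m))
    (h : u < 2 * m) : HasScheme m u := by
  unfold Admissible at hu' hv
  obtain ⟨k, r, hr, hk⟩ : ∃ k r, r < 3 ∧ u + 6 * k + 2 * r + 1 = 2 * m :=
    ⟨(2 * m - u - 1) / 6, (2 * m - u - 1) % 6 / 2, by omega, by omega⟩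
  have hk' : k = 0 ∨ k = 1 ∨ 2 ≤ k := by omega
  have hr' : r = 0 ∨ r = 1 ∨ r = 2 := by omega
  rcases hr' with rfl | rfl | rfl <;> rcases hk' with rfl | rfl | hk'
  · exact hasScheme_zero_zero (by omega) (by omega)
  · exact hasScheme_one_zero (by omega) (by omega)
  · exact hasScheme_ge_zero hk' (by omega) (by omega)
  · exact hasScheme_zero_one (by omega) (by omega) (by omega)
  · exact hasScheme_one_one (by omega) (by omega) (by omega)
  · exact hasScheme_ge_one hk' (by omega) (by omega) (by omega)
  · exact hasScheme_zero_two (by omega) (by omega) (by omega)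
  · exact hasScheme_one_two (by omega) (by omega) (by omega)
  · exact hasScheme_ge_two hk' (by omega) (by omega) (by omega)

end Scheme

theorem theorem3 {α : Type*} [DecidableEq α] [Infinite α]
    (u : ℕ) (hu : 13 < u) (U : Finset α) (T : Finset (Finset α)) (hT : IsTTS U T u)
    (hbip : (blockIntersectionGraph 2 T).IsBipartite)
    (hconn : (blockIntersectionGraph 2 T).Connected)
    (v : ℕ) (hv : Admissible v) (huv : 2 * u < v) :
    ∃ (V : Finset α) (T' : Finset (Finset α)),
      IsTTS V T' v ∧ U ⊂ V ∧ T ⊂ T' ∧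
      (blockIntersectionGraph 2 T').IsBipartite ∧
      Nat.card (blockIntersectionGraph 2 T').ConnectedComponent = 2 ∧
      ∃ a ∈ V \ U, ∃ b ∈ V \ U, ∃ c ∈ V \ U, a ≠ b ∧ a ≠ c ∧ b ≠ c ∧
        ∀ B ∈ T', Disjoint B U → (B ∩ {a, b, c}).card ≤ 1 := by
  have hu' := admissible_of_isBipartite (by omega) hT hbip
  obtain ⟨m, rfl⟩ : ∃ m, v = u + 2 * m := by
    unfold Admissible at hu' hv
    exact ⟨(v - u) / 2, by omega⟩
  obtain ⟨N, M, p, β, W, V, R, S, q, φ, h1, h2, h3, h4, h5, h6, h7, h8, h9⟩ :=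
    hasScheme hu hu' hv (by omega)
  exact exists_tts_of_cyclic hT hbip hconn (by omega) h1 h2 h3 φ h4 h5 h6 h7 h8 h9
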